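/- Let $\langle x\rangle=(1+|x|^2)^{1/2}$, let $\sigma>1$, and let $V:\mathbb R^3\to\mathbb R$ be a real potential with $\langle x\rangle^{2\sigma}V\in L^\infty(\mathbb R^3)$. Put $H_0=-\Delta$ and $H=H_0+V$ on $L^2(\mathbb R^3)$, both with domain $H^2(\mathbb R^3)$, and $L^2_\sigma=\{f:\langle x\rangle^\sigma f\in L^2(\mathbb R^3)\}$. Assume that $0$ is not an eigenvalue of $H$ and not a resonance of $H$, i.e. there is no distributional solution $\psi\notin L^2$ of $H\psi=0$ with $\langle x\rangle^{-s}\psi\in L^2$ for all $s>1/2$. For $f\in L^2_\sigma$ and $t\in\mathbb R$ let $\frac{e^{-itH_0}}{H_0}f$ be the Fourier multiplier with symbol $e^{-it\lambda}/\lambda$, $\lambda=4\pi^2|\xi|^2$ (Fourier transform $\hat f(\xi)=\int e^{-2\pi i x\cdot\xi}f(x)\,dx$), applied to $f$; its value at $t=0$ is $H_0^{-1}f$. Then: 1. $1+VH_0^{-1}$ maps $L^2_\sigma$ bijectively onto itself, and its inverse $(1+VH_0^{-1})^{-1}:L^2_\sigma\to L^2_\sigma$ is bounded. 2. $H$ generates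 a strongly continuous unitary group $e^{-itH}$, and the wave operators $\Omega_\pm=\mathrm{s}\text{-}\lim_{t\to\pm\infty}e^{itH}e^{-itH_0}$ exist on $L^2(\mathbb R^3)$. Their adjoints $\Omega_\pm^*$ satisfy $\Omega_\pm^*\psi=\lim_{t\to\pm\infty}e^{itH_0}e^{-itH}P_c\psi$, weakly in $L^2$, for every $\psi\in L^2$, where $P_c$ is the projection onto the orthogonal complement of the span of the eigenvectors of $H$. 3. For every $g\in L^2_\sigma$ and for both signs, $$\Omega_\pm^*g=(1+VH_0^{-1})^{-1}g-i\int_0^{\pm\infty}H_0e^{itH_0}\,\Omega_\pm^*\,V\,\frac{e^{-itH_0}}{H_0}(1+VH_0^{-1})^{-1}g\,dt .$$ Here $V\frac{e^{-itH_0}}{H_0}(1+VH_0^{-1})^{-1}g\in L^2$, the outer $H_0=-\Delta$ acts in the sense of tempered distributions, the integrals $\int_0^T$ (taken weakly, against Schwartz functions) are elements of $L^2$, and $\int_0^{\pm\infty}=\lim_{T\to\pm\infty}\int_0^T$ with convergence in the norm of $L^2$. -/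

import Mathlib

open MeasureTheory Filter Topology
open scoped FourierTransform SchwartzMap Laplacian ContDiff NNReal ENNReal

namespace ScatteringR3

noncomputable section

/-- Euclidean space `ℝ³`. -/
abbrev R3 : Type := EuclideanSpace ℝ (Fin 3)

/-- The Hilbert space `L²(ℝ³; ℂ)`. -/
abbrev L2 : Type := Lp (α := R3) ℂ 2 (volume : Measure R3)

/-- The Japanese bracket `⟨x⟩ = (1 + |x|²)^{1/2}`. -/
def japanese (x : R3) : ℝ := Real.sqrt (1 + ‖x‖ ^ 2)

open Classical in
/-- The class in `L²` of a square integrable function (and `0` for other functions). -/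
def toL2 (u : R3 → ℂ) : L2 :=
  if h : MemLp u 2 (volume : Measure R3) then h.toLp u else 0

/-- The product `V u` of a real potential and a function, as an element of `L²`. -/
def potentialMul (V : R3 → ℝ) (u : R3 → ℂ) : L2 := toL2 (fun x => (V x : ℂ) * u x)

/-- The weighted space `L²_σ = {f : ⟨x⟩^σ f ∈ L²}`, for `σ ≥ 0` a subset of `L²`. -/
def weightedL2 (σ : ℝ) : Set L2 :=
  {f | MemLp (fun x => ((japanese x ^ σ : ℝ) : ℂ) * f x) 2 (volume : Measure R3)}

/-- The norm `‖⟨x⟩^σ f‖_{L²}` of the weighted space. -/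
def weightedNorm (σ : ℝ) (f : L2) : ℝ≥0∞ :=
  eLpNorm (fun x => ((japanese x ^ σ : ℝ) : ℂ) * f x) 2 (volume : Measure R3)

/-- The graph of `H = -Δ + V` (`V` bounded) on `L²`: `ψ ∈ D(H) = H²(ℝ³)` and `H ψ = η`.
For `ψ ∈ L²`, one has `ψ ∈ H²` if and only if the distribution `Δ ψ` lies in `L²`. -/
def HamiltonianGraph (V : R3 → ℝ) (ψ η : L2) : Prop :=
  -Δ (ψ : 𝓢'(R3, ℂ)) + (potentialMul V ψ : 𝓢'(R3, ℂ)) = (η : 𝓢'(R3, ℂ))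

/-- `ψ` is an eigenvector or zero: `H ψ = E ψ`. -/
def IsEigenpair (V : R3 → ℝ) (E : ℝ) (ψ : L2) : Prop :=
  HamiltonianGraph V ψ ((E : ℂ) • ψ)

/-- `0` is an eigenvalue of `H = -Δ + V`. -/
def ZeroIsEigenvalue (V : R3 → ℝ) : Prop := ∃ ψ : L2, ψ ≠ 0 ∧ IsEigenpair V 0 ψ

/-- `0` is a resonance of `H = -Δ + V`: the equation `H ψ = 0` has a distributional solution `ψ`
with `⟨x⟩^{-s} ψ ∈ L²` for every `s > 1/2`, which is not in `L²`. -/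
def ZeroIsResonance (V : R3 → ℝ) : Prop :=
  ∃ ψ : R3 → ℂ,
    (∀ s : ℝ, 1 / 2 < s →
      MemLp (fun x => ((japanese x ^ (-s) : ℝ) : ℂ) * ψ x) 2 (volume : Measure R3)) ∧
    ¬ MemLp ψ 2 (volume : Measure R3) ∧
    ∀ φ : R3 → ℂ, ContDiff ℝ ∞ φ → HasCompactSupport φ →
      ∫ x, ψ x * (-(Δ φ) x + (V x : ℂ) * φ x) = 0

/-- The symbol `λ = 4π²|ξ|²` of `H₀ = -Δ`, for the Fourier transform
`f̂(ξ) = ∫ e^{-2πi x·ξ} f(x) dx`. -/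
def freeSymbol (ξ : R3) : ℝ := 4 * Real.pi ^ 2 * ‖ξ‖ ^ 2

/-- The free propagator `e^{-itH₀}` on `L²`, as a Fourier multiplier. -/
def freePropagator (t : ℝ) (f : L2) : L2 :=
  𝓕⁻ (toL2 fun ξ => Complex.exp (-Complex.I * t * freeSymbol ξ) * (𝓕 f : L2) ξ)

/-- The function `(e^{-itH₀} / H₀) f`, i.e. the Fourier multiplier `e^{-itλ} / λ` with
`λ = 4π²|ξ|²`, applied to `f`. For `f ∈ L²_σ` with `σ > 1` the function `f̂(ξ) / |ξ|²` is
integrable on `ℝ³`, so that the inverse Fourier integral is absolutely convergent; the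
resulting function of `x` is bounded and continuous but in general not in `L²`. -/
def freePropagatorDivH₀ (t : ℝ) (f : L2) : R3 → ℂ :=
  𝓕⁻ (fun ξ : R3 =>
    Complex.exp (-Complex.I * t * freeSymbol ξ) / (freeSymbol ξ : ℂ) * (𝓕 f : L2) ξ)

/-- `H₀⁻¹ f`, i.e. the Fourier multiplier `1 / (4π²|ξ|²)` applied to `f`. -/
def freeInverse (f : L2) : R3 → ℂ :=
  𝓕⁻ (fun ξ : R3 => (1 / (freeSymbol ξ : ℂ)) * (𝓕 f : L2) ξ)

/-- The operator `1 + V H₀⁻¹`. -/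
def onePlusVH₀Inv (V : R3 → ℝ) (f : L2) : L2 := f + potentialMul V (freeInverse f)

/-- The inverse `(1 + V H₀⁻¹)⁻¹` on `L²_σ`
(meaningful when `1 + V H₀⁻¹` is a bijection of `L²_σ`). -/
def onePlusVH₀InvInverse (V : R3 → ℝ) (σ : ℝ) : L2 → L2 :=
  Function.invFunOn (onePlusVH₀Inv V) (weightedL2 σ)

/-- `U t = e^{-itH}`: `U` is the strongly continuous one-parameter unitary group on `L²` whose
infinitesimal generator is `-iH`, with `H = -Δ + V` on its full domain. -/
structure IsUnitaryGroupOf (V : R3 → ℝ) (U : ℝ → L2 →L[ℂ] L2) : Prop where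
  map_zero : U 0 = ContinuousLinearMap.id ℂ L2
  map_add : ∀ s t : ℝ, U (s + t) = (U s).comp (U t)
  norm_map : ∀ (t : ℝ) (ψ : L2), ‖U t ψ‖ = ‖ψ‖
  continuous : ∀ ψ : L2, Continuous fun t => U t ψ
  generator : ∀ ψ η : L2,
    HamiltonianGraph V ψ η ↔ HasDerivAt (fun t : ℝ => U t ψ) (-Complex.I • η) 0

/-- The orthogonal projection `P_c` onto the continuous spectral subspace of `H`, which is the
orthogonal complement of the span of all eigenvectors. -/
def continuousProjection (V : R3 → ℝ) : L2 →L[ℂ] L2 :=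
  (Submodule.span ℂ {ψ : L2 | ∃ E : ℝ, IsEigenpair V E ψ})ᗮ.starProjection

/-- `Ω` is the wave operator `s-lim e^{itH} e^{-itH₀}` along `l`
(`l = atTop` for `Ω_+`, `l = atBot` for `Ω_-`), where `U t = e^{-itH}`. -/
def IsWaveOperator (U : ℝ → L2 →L[ℂ] L2) (l : Filter ℝ) (Ω : L2 →L[ℂ] L2) : Prop :=
  ∀ ψ : L2, Tendsto (fun t : ℝ => U (-t) (freePropagator t ψ)) l (𝓝 (Ω ψ))

/-- `J = ∫_0^T F(t) dt` for a family `F` of tempered distributions, in the weak sense. -/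
def IsDistributionIntegral (F : ℝ → 𝓢'(R3, ℂ)) (T : ℝ) (J : 𝓢'(R3, ℂ)) : Prop :=
  ∀ φ : 𝓢(R3, ℂ), IntervalIntegrable (fun t => F t φ) volume 0 T ∧ ∫ t in (0 : ℝ)..T, F t φ = J φ

/-- `J = ∫_0^{±∞} F(t) dt` (`l = atTop` for `+∞`, `l = atBot` for `-∞`) as an improper integral
converging in `L²`: each `∫_0^T F(t) dt` is an element of `L²`, and these converge to `J` in the
norm of `L²` as `T → ±∞`. -/
def HasImproperIntegral (F : ℝ → 𝓢'(R3, ℂ)) (l : Filter ℝ) (J : L2) : Prop :=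
  ∃ K : ℝ → L2, (∀ T : ℝ, IsDistributionIntegral F T (K T : 𝓢'(R3, ℂ))) ∧ Tendsto K l (𝓝 J)

/-- The integrand `H₀ e^{itH₀} Ω^* V (e^{-itH₀} / H₀) f`. The argument of the outer `H₀` is in `L²`
but need not be in the domain `H²`, so `H₀ = -Δ` acts in the sense of distributions. -/
def integrand (V : R3 → ℝ) (Ωstar : L2 →L[ℂ] L2) (f : L2) (t : ℝ) : 𝓢'(R3, ℂ) :=
  -Δ (freePropagator (-t) (Ωstar (potentialMul V (freePropagatorDivH₀ t f))) : 𝓢'(R3, ℂ))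

end

end ScatteringR3

/-!
The wave operators are treated by the time-dependent method, and the operator `1 + V H₀⁻¹` by
compactness.

*The group and the wave operators.* The free group is a Fourier multiplier, and `e^{-itH}` is
obtained from it by solving the equation of the interaction picture, which is a linear ordinary
differential equation with bounded coefficients because `V` is bounded
(`IsUnitaryGroup.exists_isPerturbation`); the generators are compared in
`isUnitaryGroupOf_of_isPerturbation`. Since `σ > 1`, the potential is square integrable, and Cook's
criterion applies to Gaussian wave packets, whose free evolution is explicit and decays uniformly
like `|t|^{-3/2}` (`integrable_potentialOp_gaussianState`). The same packets show that the free
group tends weakly to zero, hence that the range of the wave operator is orthogonal to the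
eigenvectors; this gives the weak limit (`tendsto_inner_continuousProjection`).

*The operator `1 + V H₀⁻¹`.* Writing `1/λ` as an integral of heat multipliers bounds `H₀⁻¹ f`
pointwise by the Riesz potential `∫ |f(y)| / |x - y| dy`, and the quadratic form `∫ |f̂|² / λ` by
that of the Riesz potential. For `f ∈ L²_σ` with `σ > 1` the Riesz potential is
`O(⟨x⟩^{-1/2})` (`exists_riesz_le`), so that `f̂ / λ` is integrable and the functions
`⟨x⟩^σ V H₀⁻¹ ⟨x⟩^{-σ} u`, `‖u‖ ≤ 1`, have a common majorant in `L²`. As their values are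
continuous linear functionals of `u`, dominated convergence turns weak into strong convergence, and
the operator is compact. By the Fredholm alternative it remains to see that `1 + V H₀⁻¹` is
injective. If `f + V H₀⁻¹ f = 0`, then `ψ = H₀⁻¹ f` solves `H ψ = 0`, and iterating the kernel bound
gives `ψ = O(⟨x⟩^{-a})` for all `a < 1`; hence `ψ` is an eigenvector or a resonance, unless it is
zero (`eq_zero_of_onePlusVH₀Inv_eq_zero`).

*The formula.* Let `f = (1 + V H₀⁻¹)⁻¹ g` and `w(t) = V (e^{-itH₀} / H₀) f`. Although
`(e^{-itH₀} / H₀) f` is not in `L²`, one has `w' = -i V e^{-itH₀} f` in `L²`. Together with the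
intertwining property `Ω e^{-itH₀} = e^{-itH} Ω` this shows that the integrand is the derivative of
`-i Ω^* (e^{itH} w(t) + e^{itH} e^{-itH₀} f)`. At `t = 0` the bracket is `f + V H₀⁻¹ f = g`. As
`t → ±∞` the first term tends to zero in `L²` by the Riemann–Lebesgue lemma, and the second one
tends to `Ω f`, where `Ω^* Ω f = f`. So the integral equals `-i (f - Ω^* g)`.
-/

/-! ### Bounded perturbations of unitary groups -/

namespace ScatteringR3

noncomputable section AbstractGroups

/-- An ordinary differential equation whose right-hand side vanishes at `0` and is Lipschitz
uniformly in time has solutions for all times. The integral equation is a contraction for the norm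
`sup_t ‖z t‖ / cosh (k t)` once `k` exceeds the Lipschitz constant. -/
theorem exists_global_solution {E : Type*} [NormedAddCommGroup E] [NormedSpace ℝ E]
    [CompleteSpace E] {v : ℝ → E → E} (hv : Continuous fun p : ℝ × E => v p.1 p.2) {M : ℝ}
    (hM : 0 ≤ M) (hlip : ∀ t x y, ‖v t x - v t y‖ ≤ M * ‖x - y‖) (h0 : ∀ t, v t 0 = 0) (x₀ : E) :
    ∃ z : ℝ → E, z 0 = x₀ ∧ ∀ t, HasDerivAt z (v t (z t)) t := by
  set k : ℝ := M + 1 with hk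
  have hkpos : 0 < k := by positivity
  let w : ℝ → ℝ := fun t => Real.cosh (k * t)
  have hw : Continuous w := by fun_prop
  have hwpos : ∀ t, 0 < w t := fun t => Real.cosh_pos _
  have hw1 : ∀ t, 1 ≤ w t := fun t => Real.one_le_cosh _
  have hint : ∀ t, ∫ s in (0 : ℝ)..t, w s = Real.sinh (k * t) / k := by
    intro t
    have := intervalIntegral.integral_eq_sub_of_hasDerivAt (a := 0) (b := t)
      (f := fun s => Real.sinh (k * s) / k) (f' := w) (fun s _ => by
        have := ((Real.hasDerivAt_sinh (k * s)).comp s ((hasDerivAt_id s).const_mul k)).div_const k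
        refine this.congr_deriv ?_
        simp only [w]
        field_simp) (hw.intervalIntegrable _ _)
    simpa using this
  have hbound : ∀ (f : ℝ → E) (C : ℝ), 0 ≤ C → (∀ s, ‖f s‖ ≤ C * w s) → ∀ t,
      ‖(w t)⁻¹ • ∫ s in (0 : ℝ)..t, f s‖ ≤ C / k := by
    intro f C hC hf t
    have h1 : ‖∫ s in (0 : ℝ)..t, f s‖ ≤ |∫ s in (0 : ℝ)..t, C * w s| :=
      intervalIntegral.norm_integral_le_abs_of_norm_le (by filter_upwards with s using hf s)
        ((hw.const_mul C).intervalIntegrable _ _)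
    rw [intervalIntegral.integral_const_mul, hint, abs_mul, abs_of_nonneg hC, abs_div,
      abs_of_pos hkpos] at h1
    have h2 : |Real.sinh (k * t)| ≤ w t := by
      rw [Real.abs_sinh]
      exact (Real.sinh_lt_cosh _).le.trans_eq (Real.cosh_abs _)
    rw [norm_smul, norm_inv, Real.norm_of_nonneg (hwpos t).le, inv_mul_le_iff₀ (hwpos t)]
    refine h1.trans ?_
    rw [show w t * (C / k) = C * (w t / k) by ring]
    gcongr
  have hvn : ∀ t x, ‖v t x‖ ≤ M * ‖x‖ := fun t x => by simpa [h0] using hlip t x 0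
  have hcont : ∀ y : BoundedContinuousFunction ℝ E, Continuous fun s => v s (w s • y s) :=
    fun y => hv.comp (continuous_id.prodMk (hw.smul y.continuous))
  have hsub : ∀ (y : BoundedContinuousFunction ℝ E) (s : ℝ), ‖v s (w s • y s)‖ ≤ M * ‖y‖ * w s := by
    intro y s
    refine (hvn s _).trans ?_
    rw [norm_smul, Real.norm_of_nonneg (hwpos s).le, mul_comm (w s), ← mul_assoc]
    have := y.norm_coe_le_norm s
    have := (hwpos s).le
    gcongr
  have hprim : ∀ y : BoundedContinuousFunction ℝ E,
      Continuous fun t => ∫ s in (0 : ℝ)..t, v s (w s • y s) := fun y =>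
    intervalIntegral.continuous_primitive (fun a b => (hcont y).intervalIntegrable a b) 0
  let Φ : BoundedContinuousFunction ℝ E → BoundedContinuousFunction ℝ E := fun y =>
    BoundedContinuousFunction.ofNormedAddCommGroup
      (fun t => (w t)⁻¹ • (x₀ + ∫ s in (0 : ℝ)..t, v s (w s • y s)))
      ((hw.inv₀ fun t => (hwpos t).ne').smul (continuous_const.add (hprim y)))
      (‖x₀‖ + M * ‖y‖ / k) (fun t => by
        rw [smul_add]
        refine (norm_add_le _ _).trans (add_le_add ?_ (hbound _ _ (by positivity) (hsub y) t))
        rw [norm_smul, norm_inv, Real.norm_of_nonneg (hwpos t).le, inv_mul_le_iff₀ (hwpos t)]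
        nlinarith [norm_nonneg x₀, hw1 t])
  have hΦ : ∀ y t, Φ y t = (w t)⁻¹ • (x₀ + ∫ s in (0 : ℝ)..t, v s (w s • y s)) := fun _ _ => rfl
  have hcontr : ContractingWith (Real.toNNReal (M / k)) Φ := by
    refine ⟨?_, LipschitzWith.of_dist_le_mul fun y₁ y₂ => ?_⟩
    · rw [Real.toNNReal_lt_one, div_lt_one hkpos]
      linarith
    · rw [Real.coe_toNNReal _ (by positivity), dist_eq_norm, dist_eq_norm,
        BoundedContinuousFunction.norm_le (by positivity)]
      intro t
      have : (Φ y₁ - Φ y₂) t =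
          (w t)⁻¹ • ∫ s in (0 : ℝ)..t, (v s (w s • y₁ s) - v s (w s • y₂ s)) := by
        rw [intervalIntegral.integral_sub ((hcont y₁).intervalIntegrable _ _)
          ((hcont y₂).intervalIntegrable _ _), BoundedContinuousFunction.sub_apply, hΦ, hΦ,
          ← smul_sub]
        congr 1
        abel
      rw [this, show M / k * ‖y₁ - y₂‖ = (M * ‖y₁ - y₂‖) / k by ring]
      refine hbound _ _ (by positivity) (fun s => (hlip s _ _).trans ?_) t
      rw [← smul_sub, norm_smul, Real.norm_of_nonneg (hwpos s).le, mul_comm (w s), ← mul_assoc]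
      have := (y₁ - y₂).norm_coe_le_norm s
      have := (hwpos s).le
      gcongr
      simpa using (y₁ - y₂).norm_coe_le_norm s
  obtain ⟨y, hy⟩ : ∃ y, Φ y = y := ⟨_, hcontr.fixedPoint_isFixedPt⟩
  have hz : ∀ t, w t • y t = x₀ + ∫ s in (0 : ℝ)..t, v s (w s • y s) := by
    intro t
    conv_lhs => rw [← hy, hΦ, smul_smul, mul_inv_cancel₀ (hwpos t).ne', one_smul]
  refine ⟨fun t => w t • y t, ?_, fun t => ?_⟩
  · change w 0 • y 0 = x₀
    rw [hz, intervalIntegral.integral_same, add_zero]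
  have : (fun t => w t • y t) = fun t => x₀ + ∫ s in (0 : ℝ)..t, v s (w s • y s) := funext hz
  change HasDerivAt (fun t => w t • y t) (v t (w t • y t)) t
  rw [this]
  exact (intervalIntegral.integral_hasDerivAt_right ((hcont y).intervalIntegrable _ _)
    (hcont y).stronglyMeasurable.stronglyMeasurableAtFilter (hcont y).continuousAt).const_add _

variable {E : Type*} [NormedAddCommGroup E] [InnerProductSpace ℂ E]

/-- A strongly continuous one-parameter group of isometries of a complex Hilbert space. -/
structure IsUnitaryGroup (U : ℝ → E →L[ℂ] E) : Prop where
  map_zero : ∀ x, U 0 x = x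
  map_add : ∀ s t x, U (s + t) x = U s (U t x)
  norm_map : ∀ t x, ‖U t x‖ = ‖x‖
  continuous : ∀ x, Continuous fun t => U t x

namespace IsUnitaryGroup

variable {U U₀ : ℝ → E →L[ℂ] E} {B : E →L[ℂ] E}

theorem neg_apply (hU : IsUnitaryGroup U) (t : ℝ) (x : E) : U (-t) (U t x) = x := by
  rw [← hU.map_add, neg_add_cancel, hU.map_zero]

theorem apply_neg (hU : IsUnitaryGroup U) (t : ℝ) (x : E) : U t (U (-t) x) = x := by
  rw [← hU.map_add, add_neg_cancel, hU.map_zero]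

theorem inner_map_map (hU : IsUnitaryGroup U) (t : ℝ) (x y : E) :
    inner ℂ (U t x) (U t y) = inner ℂ x y :=
  (LinearMap.norm_map_iff_inner_map_map (U t)).1 (hU.norm_map t) x y

theorem inner_apply_left (hU : IsUnitaryGroup U) (t : ℝ) (x y : E) :
    inner ℂ (U t x) y = inner ℂ x (U (-t) y) := by
  rw [← hU.inner_map_map t x, hU.apply_neg]

theorem continuous_uncurry (hU : IsUnitaryGroup U) :
    Continuous fun p : ℝ × E => U p.1 p.2 := by
  have : Continuous fun p : E × ℝ => U p.2 p.1 :=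
    continuous_prod_of_continuous_lipschitzWith _ 1 (fun x => hU.continuous x) fun t =>
      LipschitzWith.of_dist_le_mul fun x y => by
        simp [dist_eq_norm, ← map_sub, hU.norm_map]
  exact this.comp continuous_swap

theorem continuous_apply (hU : IsUnitaryGroup U) {z : ℝ → E} {τ : ℝ → ℝ} (hτ : Continuous τ)
    (hz : Continuous z) : Continuous fun t => U (τ t) (z t) :=
  hU.continuous_uncurry.comp (hτ.prodMk hz)

theorem tendsto_apply (hU : IsUnitaryGroup U) {α : Type*} {l : Filter α} {z : α → E} {τ : α → ℝ}
    {t : ℝ} {x : E} (hτ : Tendsto τ l (𝓝 t)) (hz : Tendsto z l (𝓝 x)) :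
    Tendsto (fun a => U (τ a) (z a)) l (𝓝 (U t x)) :=
  (hU.continuous_uncurry.tendsto (t, x)).comp (hτ.prodMk_nhds hz)

section Wave

variable {Ω : E →L[ℂ] E} {l : Filter ℝ} [l.NeBot]

theorem norm_wave (hU₀ : IsUnitaryGroup U₀) (hU : IsUnitaryGroup U)
    (hΩ : ∀ x, Tendsto (fun t => U (-t) (U₀ t x)) l (𝓝 (Ω x))) (x : E) : ‖Ω x‖ = ‖x‖ :=
  tendsto_nhds_unique (hΩ x).norm (by simp [hU.norm_map, hU₀.norm_map])

theorem adjoint_wave_wave [CompleteSpace E] (hU₀ : IsUnitaryGroup U₀) (hU : IsUnitaryGroup U)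
    (hΩ : ∀ x, Tendsto (fun t => U (-t) (U₀ t x)) l (𝓝 (Ω x))) (x : E) :
    ContinuousLinearMap.adjoint Ω (Ω x) = x := by
  refine ext_inner_left ℂ fun y => ?_
  rw [ContinuousLinearMap.adjoint_inner_right]
  exact (LinearMap.norm_map_iff_inner_map_map Ω).1 (norm_wave hU₀ hU hΩ) y x

/-- The intertwining property `Ω e^{-itH₀} = e^{-itH} Ω`. -/
theorem wave_apply (hU₀ : IsUnitaryGroup U₀) (hU : IsUnitaryGroup U)
    (hΩ : ∀ x, Tendsto (fun t => U (-t) (U₀ t x)) l (𝓝 (Ω x)))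
    (hl : ∀ t : ℝ, Tendsto (fun s => s + t) l l) (t : ℝ) (x : E) : Ω (U₀ t x) = U t (Ω x) := by
  have h1 := ((U t).continuous.tendsto _).comp ((hΩ x).comp (hl t))
  refine tendsto_nhds_unique (hΩ (U₀ t x)) (h1.congr fun s => ?_)
  simp only [Function.comp_apply]
  rw [← hU.map_add, hU₀.map_add, show t + -(s + t) = -s by ring]

end Wave

variable [NormedSpace ℝ E]

/-- Conservation of the norm for a linear equation whose coefficients are skew-adjoint. -/
theorem norm_eq_of_hasDerivAt_skew {A : ℝ → E → E} (hA : ∀ t x, (inner ℂ x (A t x)).re = 0)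
    {z : ℝ → E} (hz : ∀ t, HasDerivAt z (A t (z t)) t) (t : ℝ) : ‖z t‖ = ‖z 0‖ := by
  have h1 : ∀ t, HasDerivAt (fun s => ‖z s‖ ^ 2) 0 t := by
    intro t
    have := ((hz t).inner ℂ (hz t))
    have h2 := Complex.reCLM.hasFDerivAt.comp_hasDerivAt t this
    have h3 : Complex.reCLM (inner ℂ (z t) (A t (z t)) + inner ℂ (A t (z t)) (z t)) = 0 := by
      rw [← inner_conj_symm (A t (z t)) (z t), Complex.reCLM_apply, Complex.add_re,
        Complex.conj_re, hA, add_zero]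
    rw [h3] at h2
    refine h2.congr_of_eventuallyEq (Eventually.of_forall fun s => ?_)
    simp only [Function.comp_apply, inner_self_eq_norm_sq_to_K]
    norm_cast
  have h2 : ‖z t‖ ^ 2 = ‖z 0‖ ^ 2 :=
    is_const_of_deriv_eq_zero (fun t => (h1 t).differentiableAt) (fun t => (h1 t).deriv) t 0
  exact (pow_left_inj₀ (norm_nonneg _) (norm_nonneg _) two_ne_zero).1 h2

variable [IsScalarTower ℝ ℂ E]

/-- A curve `z` vanishing at `0` with derivative `y` there keeps this derivative when it is moved
by a strongly continuous group. -/
theorem hasDerivAt_apply_of_zero (hU : IsUnitaryGroup U) {z : ℝ → E} {y : E} (hz0 : z 0 = 0)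
    (hz : HasDerivAt z y 0) {τ : ℝ → ℝ} (hτ : Continuous τ) (hτ0 : τ 0 = 0) :
    HasDerivAt (fun t => U (τ t) (z t)) y 0 := by
  rw [hasDerivAt_iff_tendsto_slope_zero] at hz ⊢
  have h1 : Tendsto τ (𝓝[≠] 0) (𝓝 0) := by
    simpa [hτ0] using (hτ.tendsto 0).mono_left nhdsWithin_le_nhds
  have := hU.tendsto_apply h1 hz
  rw [hU.map_zero] at this
  refine this.congr fun t => ?_
  simp [hz0, hτ0]

/-- The derivative at `0` determines the derivative everywhere. -/
theorem hasDerivAt_of_zero (hU : IsUnitaryGroup U) {x y : E}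
    (h : HasDerivAt (fun t => U t x) y 0) (t : ℝ) : HasDerivAt (fun s => U s x) (U t y) t := by
  have h1 : HasDerivAt (fun s => U (s - t) x) y t := by
    have := HasDerivAt.scomp t (g₁ := fun t => U t x) (h := fun s => s - t) (by simpa using h)
      ((hasDerivAt_id t).sub_const t)
    simpa [Function.comp_def] using this
  have h2 := ((U t).restrictScalars ℝ).hasFDerivAt.comp_hasDerivAt t h1
  refine h2.congr_of_eventuallyEq (Eventually.of_forall fun s => ?_)
  simp [← hU.map_add]

/-- `U` is the group generated by the generator of `U₀` plus `-iB`. This is expressed by the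
equation of the interaction picture `U₀(-t) U(t) x`, which makes sense for every vector `x`, and not
only in the domain of the generator. -/
structure IsPerturbation (U₀ : ℝ → E →L[ℂ] E) (B : E →L[ℂ] E) (U : ℝ → E →L[ℂ] E) : Prop where
  isUnitaryGroup : IsUnitaryGroup U
  hasDerivAt : ∀ x t, HasDerivAt (fun s => U₀ (-s) (U s x))
    (-Complex.I • U₀ (-t) (B (U t x))) t

/-- A bounded symmetric operator `B` perturbs the unitary group `U₀ t = e^{-itH₀}` into a unitary
group `U t = e^{-it(H₀+B)}`. -/
theorem exists_isPerturbation [CompleteSpace E] (hU₀ : IsUnitaryGroup U₀)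
    (hB : ∀ x y, inner ℂ (B x) y = inner ℂ x (B y)) : ∃ U, IsPerturbation U₀ B U := by
  let A : ℝ → E → E := fun t x => -Complex.I • U₀ (-t) (B (U₀ t x))
  have hAadd : ∀ t x y, A t (x + y) = A t x + A t y := by
    intros; simp only [A, _root_.map_add, smul_add]
  have hAsub : ∀ t x y, A t (x - y) = A t x - A t y := by
    intros; simp only [A, map_sub, smul_sub]
  have hAsmul : ∀ t (c : ℂ) x, A t (c • x) = c • A t x := by
    intros; simp [A, smul_smul, mul_comm]
  have hAc : Continuous fun p : ℝ × E => A p.1 p.2 := by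
    have h1 : Continuous fun p : ℝ × E => (-p.1, B (U₀ p.1 p.2)) :=
      continuous_fst.neg.prodMk (B.continuous.comp hU₀.continuous_uncurry)
    exact (hU₀.continuous_uncurry.comp h1).const_smul (-Complex.I)
  have hAlip : ∀ t x y, ‖A t x - A t y‖ ≤ ‖B‖ * ‖x - y‖ := by
    intro t x y
    rw [← hAsub]
    simp only [A, norm_smul, norm_neg, Complex.norm_I, one_mul, hU₀.norm_map]
    simpa only [hU₀.norm_map] using B.le_opNorm (U₀ t (x - y))
  have hA0 : ∀ t, A t 0 = 0 := by intro t; simp [A]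
  have hAskew : ∀ t x, (inner ℂ x (A t x)).re = 0 := by
    intro t x
    have h1 : inner ℂ x (U₀ (-t) (B (U₀ t x))) = inner ℂ (U₀ t x) (B (U₀ t x)) :=
      (hU₀.inner_apply_left t x _).symm
    have h2 : (inner ℂ (U₀ t x) (B (U₀ t x))).im = 0 := by
      rw [← Complex.conj_eq_iff_im, inner_conj_symm, hB]
    simp only [A, inner_smul_right, h1, Complex.mul_re, Complex.neg_re, Complex.neg_im,
      Complex.I_re, Complex.I_im, h2]
    simp
  -- `z x t` is the interaction picture; its uniqueness makes it linear in `x`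
  choose z hz0 hz using exists_global_solution hAc (norm_nonneg B) hAlip hA0
  have huniq : ∀ (y₁ y₂ : ℝ → E), (∀ t, HasDerivAt y₁ (A t (y₁ t)) t) →
      (∀ t, HasDerivAt y₂ (A t (y₂ t)) t) → y₁ 0 = y₂ 0 → y₁ = y₂ := by
    intro y₁ y₂ h₁ h₂ h
    funext t
    have := norm_eq_of_hasDerivAt_skew hAskew (z := fun t => y₁ t - y₂ t)
      (fun t => by rw [hAsub]; exact (h₁ t).sub (h₂ t)) t
    simpa [h, sub_eq_zero] using this
  have hzadd : ∀ x y t, z (x + y) t = z x t + z y t := fun x y => congrFun <|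
    huniq _ (fun t => z x t + z y t) (hz _)
      (fun t => by rw [hAadd]; exact (hz x t).add (hz y t)) (by simp [hz0])
  have hzsmul : ∀ (c : ℂ) x t, z (c • x) t = c • z x t := fun c x => congrFun <|
    huniq _ (fun t => c • z x t) (hz _)
      (fun t => by rw [hAsmul]; exact (hz x t).const_smul c) (by simp [hz0])
  let U : ℝ → E →L[ℂ] E := fun t => LinearMap.mkContinuous
    { toFun := fun x => U₀ t (z x t)
      map_add' := fun x y => by simp [hzadd]
      map_smul' := fun c x => by simp [hzsmul] } 1 (fun x => by
        simp [hU₀.norm_map, norm_eq_of_hasDerivAt_skew hAskew (hz x) t, hz0])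
  have hUdef : ∀ t x, U t x = U₀ t (z x t) := fun _ _ => rfl
  have hUz : ∀ t x, U₀ (-t) (U t x) = z x t := fun t x => by rw [hUdef, hU₀.neg_apply]
  refine ⟨U, ⟨fun x => by simp [hUdef, hz0, hU₀.map_zero], fun s t x => ?_, fun t x => ?_,
    fun x => ?_⟩, fun x t => ?_⟩
  · -- both sides solve the interaction equation in the variable `s`
    have h1 := huniq (fun s => U₀ t (z x (s + t))) (z (U t x)) (fun s => ?_) (hz _)
      (by simp [hz0, hUdef])
    · rw [hUdef (s + t), hUdef s, ← congrFun h1 s, ← hU₀.map_add]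
    · have h2 := ((U₀ t).restrictScalars ℝ).hasFDerivAt.comp_hasDerivAt s
        ((hz x (s + t)).comp_add_const s t)
      refine h2.congr_deriv ?_
      simp only [A, ContinuousLinearMap.coe_restrictScalars', map_smul]
      rw [← hU₀.map_add s t, ← hU₀.map_add t, show t + -(s + t) = -s by ring]
  · simp [hUdef, hU₀.norm_map, norm_eq_of_hasDerivAt_skew hAskew (hz x) t, hz0]
  · exact hU₀.continuous_apply continuous_id
      (continuous_iff_continuousAt.2 fun t => (hz x t).continuousAt)
  · simp only [hUz]
    exact hz x t

namespace IsPerturbation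

/-- The generator of the perturbed group is the generator of `U₀` plus `-iB`. -/
theorem hasDerivAt_zero_iff (hU₀ : IsUnitaryGroup U₀) (h : IsPerturbation U₀ B U) (x y : E) :
    HasDerivAt (fun t => U t x) (y - Complex.I • B x) 0 ↔ HasDerivAt (fun t => U₀ t x) y 0 := by
  have hU := h.isUnitaryGroup
  have h1 := (h.hasDerivAt x 0).sub_const x
  rw [neg_zero, hU₀.map_zero, hU.map_zero] at h1
  have h2 := hU₀.hasDerivAt_apply_of_zero (by simp [hU₀.map_zero, hU.map_zero]) h1
    continuous_id rfl
  have h3 : ∀ t, U t x = U₀ t x + U₀ (id t) (U₀ (-t) (U t x) - x) := by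
    intro t
    rw [map_sub, id, hU₀.apply_neg]
    abel
  constructor
  · intro h4
    have h5 := h4.sub h2
    refine (h5.congr_of_eventuallyEq (Eventually.of_forall fun t => ?_)).congr_deriv ?_
    · exact eq_sub_of_add_eq (h3 t).symm
    · simp
  · intro h4
    have h5 := h4.add h2
    refine (h5.congr_of_eventuallyEq (Eventually.of_forall fun t => ?_)).congr_deriv ?_
    · exact h3 t
    · simp [sub_eq_add_neg]

/-- The derivative of `e^{itH} e^{-itH₀}` is `e^{itH} iB e^{-itH₀}`. -/
theorem hasDerivAt_wave (hU₀ : IsUnitaryGroup U₀) (h : IsPerturbation U₀ B U) (x : E) (t : ℝ) :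
    HasDerivAt (fun s => U (-s) (U₀ s x)) (Complex.I • U (-t) (B (U₀ t x))) t := by
  have hU := h.isUnitaryGroup
  have key : ∀ y, HasDerivAt (fun s => U (-s) (U₀ s y)) (Complex.I • B y) 0 := by
    intro y
    have h1 := ((h.hasDerivAt y 0).const_sub y)
    rw [neg_zero, hU₀.map_zero, hU.map_zero] at h1
    have h2 := hU₀.hasDerivAt_apply_of_zero (by simp [hU₀.map_zero, hU.map_zero]) h1
      continuous_id rfl
    have h3 := hU.hasDerivAt_apply_of_zero (by simp [hU₀.map_zero, hU.map_zero]) h2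
      continuous_neg neg_zero
    refine ((h3.add_const y).congr_of_eventuallyEq (Eventually.of_forall fun t => ?_)).congr_deriv
      (by simp)
    simp [map_sub, hU₀.apply_neg, hU.neg_apply]
  have h1 : HasDerivAt (fun s => U (-(s - t)) (U₀ (s - t) (U₀ t x)))
      (Complex.I • B (U₀ t x)) t := by
    have := HasDerivAt.scomp t (g₁ := fun s => U (-s) (U₀ s (U₀ t x))) (h := fun s => s - t)
      (by simpa using key (U₀ t x)) ((hasDerivAt_id t).sub_const t)
    simpa [Function.comp_def] using this
  have h2 := ((U (-t)).restrictScalars ℝ).hasFDerivAt.comp_hasDerivAt t h1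
  refine (h2.congr_of_eventuallyEq (Eventually.of_forall fun s => ?_)).congr_deriv (by simp)
  simp only [Function.comp_apply, ContinuousLinearMap.coe_restrictScalars']
  rw [← hU.map_add, ← hU₀.map_add, sub_add_cancel, show -t + -(s - t) = -s by ring]

/-- Cook's method: the wave operators exist if `‖B U₀(t) x‖` is integrable in time for `x` in a set
whose span is dense. -/
theorem exists_waveOperator [CompleteSpace E] (hU₀ : IsUnitaryGroup U₀) (h : IsPerturbation U₀ B U)
    {S : Set E} (hS : Dense (Submodule.span ℂ S : Set E))
    (hint : ∀ x ∈ S, Integrable fun t => B (U₀ t x)) {l : Filter ℝ} (hl : l = atTop ∨ l = atBot) :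
    ∃ Ω : E →L[ℂ] E, ∀ x, Tendsto (fun t => U (-t) (U₀ t x)) l (𝓝 (Ω x)) := by
  have hU := h.isUnitaryGroup
  have hl' : l.NeBot := by rcases hl with rfl | rfl <;> infer_instance
  have hS' : ∀ x ∈ S, ∃ y, Tendsto (fun t => U (-t) (U₀ t x)) l (𝓝 y) := by
    intro x hx
    have h1 : Integrable fun t => Complex.I • U (-t) (B (U₀ t x)) := by
      refine ((hint x hx).norm).mono' ?_ (by simp [norm_smul, hU.norm_map])
      exact ((hU.continuous_apply continuous_neg
        (B.continuous.comp (hU₀.continuous x))).const_smul Complex.I).aestronglyMeasurable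
    rcases hl with rfl | rfl
    · exact ⟨_, tendsto_limUnder_of_hasDerivAt_of_integrableOn_Ioi (a := 0)
        (fun t _ => h.hasDerivAt_wave hU₀ x t) h1.integrableOn⟩
    · exact ⟨_, tendsto_limUnder_of_hasDerivAt_of_integrableOn_Iic (a := 0)
        (fun t _ => h.hasDerivAt_wave hU₀ x t) h1.integrableOn⟩
  have hspan : ∀ x ∈ Submodule.span ℂ S, ∃ y, Tendsto (fun t => U (-t) (U₀ t x)) l (𝓝 y) := by
    intro x hx
    induction hx using Submodule.span_induction with
    | mem x hx => exact hS' x hx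
    | zero => exact ⟨0, by simp⟩
    | add x y _ _ hx hy =>
      obtain ⟨a, ha⟩ := hx
      obtain ⟨b, hb⟩ := hy
      exact ⟨a + b, by simpa using ha.add hb⟩
    | smul c x _ hx =>
      obtain ⟨a, ha⟩ := hx
      exact ⟨c • a, by simpa using ha.const_smul c⟩
  have hall : ∀ x, ∃ y, Tendsto (fun t => U (-t) (U₀ t x)) l (𝓝 y) := by
    intro x
    -- the operators `U (-t) (U₀ t ·)` are isometries, so convergence extends to the closure
    refine cauchy_map_iff_exists_tendsto.1 ?_
    rw [Metric.cauchy_iff]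
    refine ⟨inferInstance, fun ε hε => ?_⟩
    obtain ⟨x', hx', hxx⟩ := Metric.mem_closure_iff.1 (hS x) (ε / 3) (by positivity)
    obtain ⟨y, hy⟩ := hspan x' hx'
    have h1 : ∀ t, dist (U (-t) (U₀ t x)) (U (-t) (U₀ t x')) < ε / 3 := by
      intro t
      rw [dist_eq_norm, ← map_sub, ← map_sub, hU.norm_map, hU₀.norm_map, ← dist_eq_norm]
      exact hxx
    refine ⟨_, image_mem_map (Metric.tendsto_nhds.1 hy (ε / 6) (by positivity)), ?_⟩
    rintro _ ⟨s, hs, rfl⟩ _ ⟨t, ht, rfl⟩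
    simp only [Set.mem_ofPred_eq] at hs ht
    have h2 := dist_triangle (U (-s) (U₀ s x)) (U (-s) (U₀ s x')) (U (-t) (U₀ t x))
    have h3 := dist_triangle (U (-s) (U₀ s x')) (U (-t) (U₀ t x')) (U (-t) (U₀ t x))
    have h4 := dist_triangle_right (U (-s) (U₀ s x')) (U (-t) (U₀ t x')) y
    have h5 := h1 s
    have h6 := h1 t
    rw [dist_comm] at h6
    linarith
  choose Ω hΩ using hall
  refine ⟨LinearMap.mkContinuous
    { toFun := Ω
      map_add' := fun x y => tendsto_nhds_unique (hΩ (x + y)) (by simpa using (hΩ x).add (hΩ y))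
      map_smul' := fun c x => tendsto_nhds_unique (hΩ (c • x))
        (by simpa using (hΩ x).const_smul c) } 1 (fun x => ?_), hΩ⟩
  refine le_of_eq (tendsto_nhds_unique (hΩ x).norm ?_)
  simp [hU.norm_map, hU₀.norm_map]

end IsPerturbation

end IsUnitaryGroup

end AbstractGroups

end ScatteringR3

/-! ### Square integrable functions and multiplication operators -/

namespace ScatteringR3

noncomputable section L2Basics

theorem toL2_eq {u : R3 → ℂ} (h : MemLp u 2) : toL2 u = h.toLp u := dif_pos h

theorem toL2_ae {u : R3 → ℂ} (h : MemLp u 2) : toL2 u =ᵐ[volume] u := by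
  rw [toL2_eq h]
  exact h.coeFn_toLp

theorem toL2_congr {u v : R3 → ℂ} (h : u =ᵐ[volume] v) : toL2 u = toL2 v := by
  by_cases hu : MemLp u 2
  · have hv : MemLp v 2 := (memLp_congr_ae h).1 hu
    rw [toL2_eq hu, toL2_eq hv]
    exact (MemLp.toLp_eq_toLp_iff hu hv).2 h
  · have hv : ¬ MemLp v 2 := fun hv => hu ((memLp_congr_ae h).2 hv)
    rw [toL2, toL2, dif_neg hu, dif_neg hv]

@[simp]
theorem toL2_coe (f : L2) : toL2 f = f := by
  rw [toL2_eq (Lp.memLp f)]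
  exact Lp.toLp_coeFn f _

theorem eq_toL2 {f : L2} {u : R3 → ℂ} (h : f =ᵐ[volume] u) : f = toL2 u := by
  rw [← toL2_coe f]
  exact toL2_congr h

theorem memLp_congr_coe {f : L2} {u : R3 → ℂ} (h : f =ᵐ[volume] u) : MemLp u 2 :=
  (memLp_congr_ae h).1 (Lp.memLp f)

theorem norm_sq_eq_integral (f : L2) : ‖f‖ ^ 2 = ∫ x, ‖f x‖ ^ 2 := by
  have h : ((‖f‖ ^ 2 : ℝ) : ℂ) = ∫ x, ((‖f x‖ ^ 2 : ℝ) : ℂ) := by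
    have h1 := (inner_self_eq_norm_sq_to_K (𝕜 := ℂ) f).symm.trans (L2.inner_def (𝕜 := ℂ) f f)
    simp_rw [inner_self_eq_norm_sq_to_K] at h1
    push_cast
    exact h1
  rw [integral_complex_ofReal] at h
  exact_mod_cast h

theorem norm_le_of_ae_le {f g : L2} {c : ℝ} (hc : 0 ≤ c) (h : ∀ᵐ x, ‖f x‖ ≤ c * ‖g x‖) :
    ‖f‖ ≤ c * ‖g‖ := by
  refine le_of_sq_le_sq ?_ (by positivity)
  rw [mul_pow, norm_sq_eq_integral, norm_sq_eq_integral, ← integral_const_mul]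
  refine integral_mono_ae ((Lp.memLp f).integrable_norm_pow two_ne_zero)
    (((Lp.memLp g).integrable_norm_pow two_ne_zero).const_mul _) (h.mono fun x hx => ?_)
  simp only [← mul_pow]
  gcongr

theorem inner_eq_integral (f g : L2) :
    inner ℂ f g = ∫ x, (starRingEnd ℂ) (f x) * g x := by
  rw [L2.inner_def]
  simp [mul_comm]

theorem inner_toL2 {u v : R3 → ℂ} (hu : MemLp u 2) (hv : MemLp v 2) :
    inner ℂ (toL2 u) (toL2 v) = ∫ x, (starRingEnd ℂ) (u x) * v x := by
  rw [inner_eq_integral]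
  refine integral_congr_ae ?_
  filter_upwards [toL2_ae hu, toL2_ae hv] with x h1 h2
  rw [h1, h2]

theorem inner_toL2_left {u : R3 → ℂ} (hu : MemLp u 2) (g : L2) :
    inner ℂ (toL2 u) g = ∫ x, (starRingEnd ℂ) (u x) * g x := by
  rw [← inner_toL2 hu (Lp.memLp g), toL2_coe]

/-- Dominated convergence in `L²`. -/
theorem tendsto_toL2_of_dominated {ι : Type*} {l : Filter ι} [l.IsCountablyGenerated]
    {F : ι → R3 → ℂ} {f : R3 → ℂ} {g : R3 → ℝ} (hg : MemLp g 2)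
    (hF : ∀ n, AEStronglyMeasurable (F n)) (hf : AEStronglyMeasurable f)
    (hFg : ∀ n, ∀ᵐ x, ‖F n x‖ ≤ g x) (hfg : ∀ᵐ x, ‖f x‖ ≤ g x)
    (hlim : ∀ᵐ x, Tendsto (fun n => F n x) l (𝓝 (f x))) :
    Tendsto (fun n => toL2 (F n)) l (𝓝 (toL2 f)) := by
  have hFm : ∀ n, MemLp (F n) 2 := fun n => hg.mono' (hF n) (hFg n)
  have hfm : MemLp f 2 := hg.mono' hf hfg
  rw [tendsto_iff_norm_sub_tendsto_zero]
  have h1 : ∀ n, ‖toL2 (F n) - toL2 f‖ ^ 2 = ∫ x, ‖F n x - f x‖ ^ 2 := by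
    intro n
    rw [norm_sq_eq_integral]
    refine integral_congr_ae ?_
    filter_upwards [toL2_ae (hFm n), toL2_ae hfm, Lp.coeFn_sub (toL2 (F n)) (toL2 f)]
      with x h1 h2 h3
    rw [h3, Pi.sub_apply, h1, h2]
  have h2 : Tendsto (fun n => ∫ x, ‖F n x - f x‖ ^ 2) l (𝓝 (∫ _ : R3, (0 : ℝ))) := by
    refine tendsto_integral_filter_of_dominated_convergence (fun x => 4 * g x ^ 2)
      (Eventually.of_forall fun n => ((hF n).sub hf).norm.pow 2) (Eventually.of_forall fun n => ?_)
      (hg.integrable_sq.const_mul 4) ?_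
    · filter_upwards [hFg n, hfg] with x h1 h2
      rw [norm_pow, norm_norm]
      have h3 : ‖F n x - f x‖ ≤ 2 * g x := (norm_sub_le _ _).trans (by linarith)
      nlinarith [norm_nonneg (F n x - f x)]
    · filter_upwards [hlim] with x hx
      have := ((hx.sub_const (f x)).norm).pow 2
      simpa using this
  rw [integral_zero] at h2
  have h3 : Tendsto (fun n => ‖toL2 (F n) - toL2 f‖ ^ 2) l (𝓝 0) := by simpa only [h1] using h2
  have h4 := (Real.continuous_sqrt.tendsto 0).comp h3
  rw [Real.sqrt_zero] at h4
  refine h4.congr fun n => ?_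
  simp [Real.sqrt_sq (norm_nonneg _)]

theorem memLp_mul_of_memLp_top {m u : R3 → ℂ} (hm : MemLp m ∞) (hu : MemLp u 2) :
    MemLp (fun x => m x * u x) 2 := hu.mul' hm

theorem ae_bound_of_memLp_top {F : Type*} [NormedAddCommGroup F] {m : R3 → F} (hm : MemLp m ∞) :
    ∃ C : ℝ, 0 ≤ C ∧ ∀ᵐ x, ‖m x‖ ≤ C := by
  refine ⟨(eLpNorm m ⊤ volume).toReal, ENNReal.toReal_nonneg, ?_⟩
  filter_upwards [enorm_ae_le_eLpNormEssSup m volume] with x hx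
  have h : eLpNorm m ⊤ volume ≠ ⊤ := hm.2.ne
  have := ENNReal.toReal_mono h (by simpa using hx)
  simpa using this

/-- Multiplication by an essentially bounded function, as an operator on `L²`. -/
def mulL2 (m : R3 → ℂ) (hm : MemLp m ∞) : L2 →L[ℂ] L2 :=
  LinearMap.mkContinuousOfExistsBound
    { toFun := fun f => toL2 fun x => m x * f x
      map_add' := fun f g => by
        refine (eq_toL2 ?_).symm
        filter_upwards [Lp.coeFn_add f g, toL2_ae (memLp_mul_of_memLp_top hm (Lp.memLp f)),
          toL2_ae (memLp_mul_of_memLp_top hm (Lp.memLp g)),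
          Lp.coeFn_add (toL2 fun x => m x * f x) (toL2 fun x => m x * g x)] with x h1 h2 h3 h4
        rw [h4, h1, Pi.add_apply, Pi.add_apply, h2, h3, mul_add]
      map_smul' := fun c f => by
        refine (eq_toL2 ?_).symm
        filter_upwards [Lp.coeFn_smul c f, toL2_ae (memLp_mul_of_memLp_top hm (Lp.memLp f)),
          Lp.coeFn_smul c (toL2 fun x => m x * f x)] with x h1 h2 h4
        simp only [RingHom.id_apply]
        rw [h4, h1, Pi.smul_apply, Pi.smul_apply, h2, smul_eq_mul, smul_eq_mul]
        ring }
    (by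
      obtain ⟨C, hC, h⟩ := ae_bound_of_memLp_top hm
      refine ⟨C, fun f => norm_le_of_ae_le hC ?_⟩
      filter_upwards [h, toL2_ae (memLp_mul_of_memLp_top hm (Lp.memLp f))] with x h1 h2
      simp only [LinearMap.coe_mk, AddHom.coe_mk]
      rw [h2, norm_mul]
      gcongr)

theorem mulL2_apply (m : R3 → ℂ) (hm : MemLp m ∞) (f : L2) :
    mulL2 m hm f = toL2 fun x => m x * f x := rfl

theorem mulL2_ae (m : R3 → ℂ) (hm : MemLp m ∞) (f : L2) :
    mulL2 m hm f =ᵐ[volume] fun x => m x * f x :=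
  toL2_ae (memLp_mul_of_memLp_top hm (Lp.memLp f))

theorem inner_mulL2_left {m m' : R3 → ℂ} (hm : MemLp m ∞) (hm' : MemLp m' ∞)
    (h : ∀ x, m' x = (starRingEnd ℂ) (m x)) (f g : L2) :
    inner ℂ (mulL2 m hm f) g = inner ℂ f (mulL2 m' hm' g) := by
  rw [inner_eq_integral, inner_eq_integral]
  refine integral_congr_ae ?_
  filter_upwards [mulL2_ae m hm f, mulL2_ae m' hm' g] with x h1 h2
  rw [h1, h2, h, map_mul]
  ring

/-- Locally integrable functions which agree against all Schwartz functions agree almost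
everywhere. -/
theorem ae_eq_of_integral_schwartz_mul_eq {u v : R3 → ℂ} (hu : LocallyIntegrable u)
    (hv : LocallyIntegrable v) (h : ∀ φ : 𝓢(R3, ℂ), ∫ x, φ x * u x = ∫ x, φ x * v x) :
    u =ᵐ[volume] v := by
  refine ae_eq_of_integral_contDiff_smul_eq hu hv fun g hg hgc => ?_
  have hg₁ : HasCompactSupport (Complex.ofRealCLM ∘ g) := hgc.comp_left rfl
  have hg₂ : ContDiff ℝ ∞ (Complex.ofRealCLM ∘ g) := by fun_prop
  simpa using h (hg₁.toSchwartzMap hg₂)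

theorem integral_mul_fourier_eq {f g : R3 → ℂ} (hf : Integrable f) (hg : Integrable g) :
    ∫ x, 𝓕 f x * g x = ∫ x, f x * 𝓕 g x := by
  have := VectorFourier.integral_bilin_fourierIntegral_eq_flip (ContinuousLinearMap.mul ℂ ℂ)
    (L := innerₗ R3) Real.continuous_fourierChar continuous_inner hf hg
  rw [flip_innerₗ] at this
  exact this

theorem integral_mul_fourierInv_eq {f g : R3 → ℂ} (hf : Integrable f) (hg : Integrable g) :
    ∫ x, 𝓕⁻ f x * g x = ∫ x, f x * 𝓕⁻ g x := by
  have h1 := integral_mul_fourier_eq hf hg.comp_neg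
  have h2 : ∀ x, 𝓕 (fun y => g (-y)) x = 𝓕⁻ g x := fun x => by
    rw [Real.fourierInv_eq_fourier_comp_neg]
  simp_rw [h2] at h1
  rw [← h1, ← integral_neg_eq_self]
  simp [Real.fourierInv_eq_fourier_neg]

theorem continuous_fourierInv {u : R3 → ℂ} (h : Integrable u) : Continuous (𝓕⁻ u) := by
  have : 𝓕⁻ u = fun x => 𝓕 u (-x) := funext fun x => Real.fourierInv_eq_fourier_neg u x
  rw [this]
  exact (VectorFourier.fourierIntegral_continuous Real.continuous_fourierChar
    (L := innerₗ R3) continuous_inner h).comp continuous_neg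

theorem norm_fourierInv_le (u : R3 → ℂ) (x : R3) : ‖𝓕⁻ u x‖ ≤ ∫ ξ, ‖u ξ‖ := by
  rw [Real.fourierInv_eq_fourier_neg]
  exact VectorFourier.norm_fourierIntegral_le_integral_norm _ _ _ _ _

/-- On `L¹ ∩ L²` the inverse Fourier transform of `L²` is given by the Fourier integral. -/
theorem fourierInv_toL2_ae {u : R3 → ℂ} (h1 : Integrable u) (h2 : MemLp u 2) :
    (𝓕⁻ (toL2 u) : L2) =ᵐ[volume] 𝓕⁻ u := by
  refine ae_eq_of_integral_schwartz_mul_eq ((Lp.memLp _).locallyIntegrable (by norm_num))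
    (continuous_fourierInv h1).locallyIntegrable fun φ => ?_
  have h3 : (((𝓕⁻ (toL2 u) : L2) : 𝓢'(R3, ℂ))) φ = (𝓕⁻ ((toL2 u : L2) : 𝓢'(R3, ℂ))) φ := by
    rw [Lp.fourierInv_toTemperedDistribution_eq]
  rw [TemperedDistribution.fourierInv_apply, Lp.toTemperedDistribution_apply,
    Lp.toTemperedDistribution_apply] at h3
  simp only [smul_eq_mul] at h3
  rw [h3, ← integral_mul_fourierInv_eq φ.integrable h1, SchwartzMap.fourierInv_coe]
  refine integral_congr_ae ((toL2_ae h2).mono fun x hx => ?_)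
  simp only [hx]

theorem inner_fourierInv_left (f g : L2) : inner ℂ (𝓕⁻ f : L2) g = inner ℂ f (𝓕 g : L2) := by
  rw [← Lp.inner_fourier_eq (𝓕⁻ f) g, FourierTransform.fourier_fourierInv_eq]

theorem inner_fourierInv_right (f g : L2) : inner ℂ f (𝓕⁻ g : L2) = inner ℂ (𝓕 f : L2) g := by
  rw [← Lp.inner_fourier_eq f (𝓕⁻ g), FourierTransform.fourier_fourierInv_eq]

theorem norm_fourierInv_eq (f : L2) : ‖(𝓕⁻ f : L2)‖ = ‖f‖ := by
  rw [← Lp.norm_fourier_eq (𝓕⁻ f), FourierTransform.fourier_fourierInv_eq]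

end L2Basics

end ScatteringR3

/-! ### The free group and its generator -/

namespace ScatteringR3

noncomputable section FreeGroup

theorem freeSymbol_nonneg (ξ : R3) : 0 ≤ freeSymbol ξ := by
  unfold freeSymbol
  positivity

theorem continuous_freeSymbol : Continuous freeSymbol := by
  unfold freeSymbol
  fun_prop

/-- The symbol `e^{-itλ}` of the free propagator. -/
def phase (t : ℝ) (ξ : R3) : ℂ := Complex.exp (-Complex.I * t * freeSymbol ξ)

theorem norm_phase (t : ℝ) (ξ : R3) : ‖phase t ξ‖ = 1 := by
  rw [phase, show -Complex.I * t * freeSymbol ξ = ((-(t * freeSymbol ξ) : ℝ) : ℂ) * Complex.I by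
    push_cast; ring, Complex.norm_exp_ofReal_mul_I]

theorem continuous_phase (t : ℝ) : Continuous (phase t) := by
  have := continuous_freeSymbol
  unfold phase
  fun_prop

theorem continuous_phase_left (ξ : R3) : Continuous fun t => phase t ξ := by
  unfold phase
  fun_prop

theorem phase_add (s t : ℝ) (ξ : R3) : phase (s + t) ξ = phase s ξ * phase t ξ := by
  rw [phase, phase, phase, ← Complex.exp_add]
  push_cast
  ring_nf

theorem phase_zero (ξ : R3) : phase 0 ξ = 1 := by simp [phase]

theorem norm_phase_sub_one_le (t : ℝ) (ξ : R3) : ‖phase t ξ - 1‖ ≤ |t| * freeSymbol ξ := by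
  have := Real.norm_exp_I_mul_ofReal_sub_one_le (x := -(t * freeSymbol ξ))
  rw [Real.norm_eq_abs, abs_neg, abs_mul, abs_of_nonneg (freeSymbol_nonneg ξ)] at this
  refine le_trans (le_of_eq ?_) this
  rw [phase]
  congr 3
  push_cast
  ring

theorem hasDerivAt_phase (ξ : R3) (t : ℝ) :
    HasDerivAt (fun s => phase s ξ) (-Complex.I * freeSymbol ξ * phase t ξ) t := by
  have h1 : HasDerivAt (fun s : ℝ => -Complex.I * s * freeSymbol ξ)
      (-Complex.I * freeSymbol ξ) t := by
    have := ((Complex.ofRealCLM.hasDerivAt (x := t)).const_mul (-Complex.I)).mul_const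
      (freeSymbol ξ : ℂ)
    simpa using this
  exact h1.cexp.congr_deriv (by rw [phase]; ring)

theorem memLp_phase (t : ℝ) : MemLp (phase t) ⊤ :=
  memLp_top_of_bound (continuous_phase t).aestronglyMeasurable 1
    (Eventually.of_forall fun ξ => (norm_phase t ξ).le)

/-- The free propagator `e^{-itH₀}` as a bounded operator. -/
def freeGroup (t : ℝ) : L2 →L[ℂ] L2 :=
  ((Lp.fourierTransformₗᵢ R3 ℂ).symm.toContinuousLinearEquiv : L2 →L[ℂ] L2) ∘L
    mulL2 (phase t) (memLp_phase t) ∘L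
    ((Lp.fourierTransformₗᵢ R3 ℂ).toContinuousLinearEquiv : L2 →L[ℂ] L2)

theorem freeGroup_apply (t : ℝ) (f : L2) :
    freeGroup t f = 𝓕⁻ (mulL2 (phase t) (memLp_phase t) (𝓕 f)) := rfl

theorem freePropagator_eq (t : ℝ) (f : L2) : freePropagator t f = freeGroup t f := rfl

theorem fourier_freeGroup (t : ℝ) (f : L2) :
    (𝓕 (freeGroup t f) : L2) = mulL2 (phase t) (memLp_phase t) (𝓕 f) := by
  rw [freeGroup_apply, FourierTransform.fourier_fourierInv_eq]

theorem fourier_freeGroup_ae (t : ℝ) (f : L2) :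
    (𝓕 (freeGroup t f) : L2) =ᵐ[volume] fun ξ => phase t ξ * (𝓕 f : L2) ξ := by
  rw [fourier_freeGroup]
  exact mulL2_ae _ _ _

theorem fourier_injective {f g : L2} (h : (𝓕 f : L2) = 𝓕 g) : f = g :=
  (Lp.fourierTransformₗᵢ R3 ℂ).injective h

theorem isUnitaryGroup_freeGroup : IsUnitaryGroup freeGroup where
  map_zero f := by
    refine fourier_injective (Lp.ext ?_)
    filter_upwards [fourier_freeGroup_ae 0 f] with ξ h
    rw [h, phase_zero, one_mul]
  map_add s t f := by
    refine fourier_injective (Lp.ext ?_)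
    filter_upwards [fourier_freeGroup_ae (s + t) f, fourier_freeGroup_ae s (freeGroup t f),
      fourier_freeGroup_ae t f] with ξ h1 h2 h3
    rw [h1, h2, h3, phase_add, mul_assoc]
  norm_map t f := by
    rw [← Lp.norm_fourier_eq, ← Lp.norm_fourier_eq f]
    have h := fourier_freeGroup_ae t f
    refine le_antisymm ?_ ?_
    · rw [← one_mul ‖(𝓕 f : L2)‖]
      refine norm_le_of_ae_le zero_le_one (h.mono fun ξ h => ?_)
      simp [h, norm_phase]
    · rw [← one_mul ‖(𝓕 (freeGroup t f) : L2)‖]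
      refine norm_le_of_ae_le zero_le_one (h.mono fun ξ h => ?_)
      simp [h, norm_phase]
  continuous f := by
    refine continuous_iff_continuousAt.2 fun t => ?_
    have h : Tendsto (fun s => toL2 fun ξ => phase s ξ * (𝓕 f : L2) ξ) (𝓝 t)
        (𝓝 (toL2 fun ξ => phase t ξ * (𝓕 f : L2) ξ)) :=
      tendsto_toL2_of_dominated (g := fun ξ => ‖(𝓕 f : L2) ξ‖) (Lp.memLp _).norm
        (fun s => (continuous_phase s).aestronglyMeasurable.mul (Lp.aestronglyMeasurable _))
        ((continuous_phase t).aestronglyMeasurable.mul (Lp.aestronglyMeasurable _))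
        (fun s => Eventually.of_forall fun ξ => by simp [norm_phase])
        (Eventually.of_forall fun ξ => by simp [norm_phase])
        (Eventually.of_forall fun ξ =>
          ((continuous_phase_left ξ).tendsto t).mul_const _)
    exact ((Lp.fourierTransformₗᵢ R3 ℂ).symm.continuous.tendsto _).comp h

/-- On the Fourier side `-Δ` acts on `L²` as multiplication by the symbol. -/
theorem neg_laplacian_eq_iff (ψ ζ : L2) :
    -Δ (ψ : 𝓢'(R3, ℂ)) = (ζ : 𝓢'(R3, ℂ)) ↔
      ∀ᵐ ξ, (freeSymbol ξ : ℂ) * (𝓕 ψ : L2) ξ = (𝓕 ζ : L2) ξ := by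
  have htg : (fun x : R3 => Complex.ofReal (‖x‖ ^ 2)).HasTemperateGrowth := by fun_prop
  have h1 : ∀ φ : 𝓢(R3, ℂ), (-Δ (ψ : 𝓢'(R3, ℂ))) (𝓕 φ) =
      ∫ ξ, φ ξ * ((freeSymbol ξ : ℂ) * (𝓕 ψ : L2) ξ) := by
    intro φ
    rw [TemperedDistribution.laplacian_eq_fourierMultiplierCLM,
      TemperedDistribution.fourierMultiplierCLM_apply]
    simp only [neg_smul, neg_neg, _root_.smul_apply,
      TemperedDistribution.fourierInv_apply, FourierTransform.fourierInv_fourier_eq,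
      TemperedDistribution.smulLeftCLM_apply_apply, Lp.fourier_toTemperedDistribution_eq,
      Lp.toTemperedDistribution_apply]
    rw [Complex.real_smul, ← integral_const_mul]
    refine integral_congr_ae (Eventually.of_forall fun ξ => ?_)
    simp only [SchwartzMap.smulLeftCLM_apply_apply htg, smul_eq_mul, freeSymbol]
    push_cast
    ring
  have h2 : ∀ φ : 𝓢(R3, ℂ), (ζ : 𝓢'(R3, ℂ)) (𝓕 φ) = ∫ ξ, φ ξ * (𝓕 ζ : L2) ξ := by
    intro φ
    rw [← TemperedDistribution.fourier_apply, Lp.fourier_toTemperedDistribution_eq,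
      Lp.toTemperedDistribution_apply]
    simp
  constructor
  · intro h
    refine ae_eq_of_integral_schwartz_mul_eq ?_ ((Lp.memLp _).locallyIntegrable (by norm_num))
      fun φ => by rw [← h1, ← h2, h]
    have := ((Lp.memLp (𝓕 ψ : L2)).locallyIntegrable (by norm_num : (1 : ℝ≥0∞) ≤ 2)).smul_continuous
      (g := fun ξ => (freeSymbol ξ : ℂ)) (by have := continuous_freeSymbol; fun_prop)
    simpa [mul_comm] using this
  · intro h
    ext φ
    have : φ = 𝓕 (𝓕⁻ φ) := (FourierTransform.fourier_fourierInv_eq φ).symm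
    rw [this, h1, h2]
    exact integral_congr_ae (h.mono fun ξ hξ => by simp only [hξ])

theorem tendsto_slope_phase_apply (ξ : R3) (z : ℂ) :
    Tendsto (fun t : ℝ => (t : ℂ)⁻¹ * (phase t ξ - 1) * z) (𝓝[≠] 0)
      (𝓝 (-Complex.I * (freeSymbol ξ * z))) := by
  have := (hasDerivAt_iff_tendsto_slope_zero.1 (hasDerivAt_phase ξ 0)).mul_const z
  rw [phase_zero, mul_one, mul_assoc] at this
  refine this.congr fun t => ?_
  rw [zero_add, Complex.real_smul, Complex.ofReal_inv]

theorem memLp_slope_phase (t : ℝ) (h : L2) :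
    MemLp (fun ξ => (t : ℂ)⁻¹ * (phase t ξ - 1) * h ξ) 2 := by
  refine memLp_mul_of_memLp_top (memLp_top_of_bound
    ((((continuous_phase t).sub continuous_const).const_mul _).aestronglyMeasurable)
    (‖(t : ℂ)⁻¹‖ * 2) (Eventually.of_forall fun ξ => ?_)) (Lp.memLp h)
  rw [norm_mul]
  gcongr
  refine (norm_sub_le _ _).trans ?_
  rw [norm_phase]
  norm_num

/-- Difference quotients of `e^{-itλ} h` converge in `L²` if `λ h` is square integrable. -/
theorem tendsto_slope_phase {h k : L2} (hk : ∀ᵐ ξ, (freeSymbol ξ : ℂ) * h ξ = k ξ) :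
    Tendsto (fun t : ℝ => toL2 fun ξ => (t : ℂ)⁻¹ * (phase t ξ - 1) * h ξ) (𝓝[≠] 0)
      (𝓝 (-Complex.I • k)) := by
  have h2 : -Complex.I • k = toL2 fun ξ => -Complex.I * (freeSymbol ξ * h ξ) := by
    refine eq_toL2 ?_
    filter_upwards [hk, Lp.coeFn_smul (-Complex.I) k] with ξ h3 h4
    rw [h4, Pi.smul_apply, smul_eq_mul, h3]
  rw [h2]
  refine tendsto_toL2_of_dominated (g := fun ξ => ‖k ξ‖) (Lp.memLp k).norm
    (fun t => ?_) ?_ (fun t => ?_) ?_ (Eventually.of_forall fun ξ => ?_)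
  · exact (((continuous_phase _).sub continuous_const).const_mul _).aestronglyMeasurable.mul
      (Lp.aestronglyMeasurable _)
  · exact (((Complex.continuous_ofReal.comp continuous_freeSymbol).aestronglyMeasurable.mul
      (Lp.aestronglyMeasurable _)).const_mul _)
  · filter_upwards [hk] with ξ hξ
    rw [← hξ, norm_mul, norm_mul, norm_mul, norm_inv, Complex.norm_real, Real.norm_eq_abs,
      Complex.norm_of_nonneg (freeSymbol_nonneg ξ)]
    gcongr
    rcases eq_or_ne t 0 with rfl | ht
    · simpa using freeSymbol_nonneg ξ
    · rw [inv_mul_le_iff₀ (abs_pos.2 ht)]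
      exact norm_phase_sub_one_le t ξ
  · filter_upwards [hk] with ξ hξ
    rw [hξ]
    simp
  · exact tendsto_slope_phase_apply ξ (h ξ)

/-- Conversely, the limit of the difference quotients in `L²` can only be `-iλ h`. -/
theorem eq_of_tendsto_slope_phase {h k : L2}
    (hk : Tendsto (fun t : ℝ => toL2 fun ξ => (t : ℂ)⁻¹ * (phase t ξ - 1) * h ξ) (𝓝[≠] 0)
      (𝓝 (-Complex.I • k))) : ∀ᵐ ξ, (freeSymbol ξ : ℂ) * h ξ = k ξ := by
  -- a subsequence of the difference quotients converges almost everywhere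
  obtain ⟨τ, hτ, hτ'⟩ := (tendstoInMeasure_of_tendsto_Lp hk).exists_seq_tendsto_ae'
  have h2 := ae_all_iff.2 fun n => toL2_ae (memLp_slope_phase (τ n) h)
  filter_upwards [hτ', h2, Lp.coeFn_smul (-Complex.I) k] with ξ h3 h4 h5
  have h6 := (tendsto_slope_phase_apply ξ (h ξ)).comp hτ
  have h7 := tendsto_nhds_unique h3 (h6.congr fun n => (h4 n).symm)
  rw [h5, Pi.smul_apply, smul_eq_mul] at h7
  exact (mul_left_cancel₀ (neg_ne_zero.2 Complex.I_ne_zero) h7).symm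

theorem slope_freeGroup (ψ : L2) (t : ℝ) :
    t⁻¹ • (freeGroup (0 + t) ψ - freeGroup 0 ψ) =
      𝓕⁻ (toL2 fun ξ => (t : ℂ)⁻¹ * (phase t ξ - 1) * (𝓕 ψ : L2) ξ) := by
  refine fourier_injective ?_
  rw [FourierTransform.fourier_fourierInv_eq]
  refine eq_toL2 ?_
  have h0 : t⁻¹ • (freeGroup (0 + t) ψ - freeGroup 0 ψ) =
      (t : ℂ)⁻¹ • (freeGroup (0 + t) ψ - freeGroup 0 ψ) := by
    rw [← Complex.ofReal_inv, ← algebraMap_smul ℂ t⁻¹, Complex.coe_algebraMap]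
  have h1 : (𝓕 ((t : ℂ)⁻¹ • (freeGroup (0 + t) ψ - freeGroup 0 ψ)) : L2) =
      (t : ℂ)⁻¹ • ((𝓕 (freeGroup (0 + t) ψ) : L2) - 𝓕 (freeGroup 0 ψ)) := by
    exact (Lp.fourierTransformₗᵢ R3 ℂ).map_smul _ _ |>.trans
      (congrArg _ ((Lp.fourierTransformₗᵢ R3 ℂ).map_sub _ _))
  rw [h0, h1]
  filter_upwards [Lp.coeFn_smul (t : ℂ)⁻¹ ((𝓕 (freeGroup (0 + t) ψ) : L2) - 𝓕 (freeGroup 0 ψ)),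
    Lp.coeFn_sub (𝓕 (freeGroup (0 + t) ψ) : L2) (𝓕 (freeGroup 0 ψ)),
    fourier_freeGroup_ae (0 + t) ψ, fourier_freeGroup_ae 0 ψ] with ξ h1 h2 h3 h4
  rw [h1, Pi.smul_apply, h2, Pi.sub_apply, h3, h4, ← sub_mul, smul_eq_mul, phase_zero, zero_add,
    mul_assoc]

/-- The generator of the free group is `-iH₀`, with `H₀ = -Δ` on its maximal domain. -/
theorem hasDerivAt_freeGroup_iff (ψ ζ : L2) :
    HasDerivAt (fun t => freeGroup t ψ) (-Complex.I • ζ) 0 ↔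
      -Δ (ψ : 𝓢'(R3, ℂ)) = (ζ : 𝓢'(R3, ℂ)) := by
  have hFζ : (𝓕 (-Complex.I • ζ) : L2) = -Complex.I • (𝓕 ζ : L2) :=
    FourierTransform.fourier_smul _ _
  rw [neg_laplacian_eq_iff, hasDerivAt_iff_tendsto_slope_zero]
  simp only [slope_freeGroup]
  constructor
  · intro h
    have h1 := ((Lp.fourierTransformₗᵢ R3 ℂ).continuous.tendsto _).comp h
    refine eq_of_tendsto_slope_phase (h := 𝓕 ψ) (k := 𝓕 ζ) ?_
    rw [← hFζ]
    refine h1.congr fun t => ?_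
    exact (Lp.fourierTransformₗᵢ R3 ℂ).apply_symm_apply _
  · intro h
    have h3 := ((Lp.fourierTransformₗᵢ R3 ℂ).symm.continuous.tendsto _).comp (tendsto_slope_phase h)
    rw [← hFζ] at h3
    have h4 : (Lp.fourierTransformₗᵢ R3 ℂ).symm (𝓕 (-Complex.I • ζ)) = -Complex.I • ζ :=
      (Lp.fourierTransformₗᵢ R3 ℂ).symm_apply_apply _
    rw [h4] at h3
    exact h3

end FreeGroup

/-! ### Bounded potentials -/

noncomputable section Potential

variable {V : R3 → ℝ}

/-- Multiplication by a bounded real potential. -/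
def potentialOp (V : R3 → ℝ) (hV : MemLp V ⊤) : L2 →L[ℂ] L2 := mulL2 (fun x => (V x : ℂ)) hV.ofReal

theorem potentialMul_eq (hV : MemLp V ⊤) (f : L2) : potentialMul V f = potentialOp V hV f := rfl

theorem inner_potentialOp (hV : MemLp V ⊤) (f g : L2) :
    inner ℂ (potentialOp V hV f) g = inner ℂ f (potentialOp V hV g) :=
  inner_mulL2_left _ _ (fun x => by simp) f g

theorem hamiltonianGraph_iff (hV : MemLp V ⊤) (ψ η : L2) :
    HamiltonianGraph V ψ η ↔
      -Δ (ψ : 𝓢'(R3, ℂ)) = ((η - potentialOp V hV ψ : L2) : 𝓢'(R3, ℂ)) := by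
  rw [HamiltonianGraph, potentialMul_eq hV, ← eq_sub_iff_add_eq]
  have : ((η - potentialOp V hV ψ : L2) : 𝓢'(R3, ℂ)) =
      (η : 𝓢'(R3, ℂ)) - (potentialOp V hV ψ : 𝓢'(R3, ℂ)) :=
    map_sub (Lp.toTemperedDistributionCLM ℂ (volume : Measure R3) 2) _ _
  rw [this]

/-- The group generated by a bounded perturbation of `H₀` by the potential is `e^{-itH}`. -/
theorem isUnitaryGroupOf_of_isPerturbation (hV : MemLp V ⊤) {U : ℝ → L2 →L[ℂ] L2}
    (h : IsUnitaryGroup.IsPerturbation freeGroup (potentialOp V hV) U) : IsUnitaryGroupOf V U where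
  map_zero := ContinuousLinearMap.ext h.isUnitaryGroup.map_zero
  map_add s t := ContinuousLinearMap.ext (h.isUnitaryGroup.map_add s t)
  norm_map := h.isUnitaryGroup.norm_map
  continuous := h.isUnitaryGroup.continuous
  generator ψ η := by
    rw [hamiltonianGraph_iff hV, ← hasDerivAt_freeGroup_iff,
      ← h.hasDerivAt_zero_iff isUnitaryGroup_freeGroup, smul_sub, neg_smul, neg_smul,
      sub_neg_eq_add, neg_add_eq_sub, sub_sub_cancel_left]

end Potential

end ScatteringR3

/-! ### Gaussian states, local decay and wave operators -/

namespace ScatteringR3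

noncomputable section Gaussians

/-- The function `e^{-b|ξ|² - 2πi y·ξ}`, whose inverse Fourier transform is a Gaussian centred
at `y`. -/
def gaussian (b : ℂ) (y ξ : R3) : ℂ :=
  Complex.exp (-b * ‖ξ‖ ^ 2 + 2 * Real.pi * Complex.I * (inner ℝ (-y) ξ : ℝ))

theorem norm_gaussian (b : ℂ) (y ξ : R3) : ‖gaussian b y ξ‖ = Real.exp (-b.re * ‖ξ‖ ^ 2) := by
  rw [gaussian, Complex.norm_exp]
  congr 1
  have : ((‖ξ‖ : ℂ) ^ 2) = ((‖ξ‖ ^ 2 : ℝ) : ℂ) := by push_cast; ring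
  rw [this, Complex.add_re, ← Complex.ofReal_ofNat, ← Complex.ofReal_mul, mul_assoc,
    Complex.re_ofReal_mul, Complex.I_mul_re, Complex.ofReal_im, neg_zero, mul_zero, add_zero,
    Complex.re_mul_ofReal, Complex.neg_re]

theorem continuous_gaussian (b : ℂ) (y : R3) : Continuous (gaussian b y) := by
  unfold gaussian
  fun_prop

theorem integrable_gaussian {b : ℂ} (hb : 0 < b.re) (y : R3) : Integrable (gaussian b y) :=
  GaussianFourier.integrable_cexp_neg_mul_sq_norm_add hb _ _

theorem memLp_gaussian {b : ℂ} (hb : 0 < b.re) (y : R3) : MemLp (gaussian b y) 2 := by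
  rw [memLp_two_iff_integrable_sq_norm (continuous_gaussian b y).aestronglyMeasurable]
  have h := (integrable_gaussian (b := 2 * b) (by simpa using hb) y).norm
  refine h.congr (Eventually.of_forall fun ξ => ?_)
  simp only [norm_gaussian, ← Real.exp_nat_mul]
  congr 1
  simp
  ring

theorem fourierInv_gaussian {b : ℂ} (hb : 0 < b.re) (y x : R3) :
    𝓕⁻ (gaussian b y) x =
      (Real.pi / b) ^ (3 / 2 : ℂ) * Complex.exp (-Real.pi ^ 2 * ‖y - x‖ ^ 2 / b) := by
  rw [Real.fourierInv_eq_fourier_neg]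
  have := fourier_gaussian_innerProductSpace' hb (-y) (-x)
  rw [show -y - -x = -(y - x) by abel, norm_neg] at this
  refine Eq.trans ?_ (this.trans ?_)
  · rfl
  · simp

theorem phase_mul_gaussian (b : ℂ) (y : R3) (t : ℝ) (ξ : R3) :
    phase t ξ * gaussian b y ξ = gaussian (b + 4 * Real.pi ^ 2 * t * Complex.I) y ξ := by
  rw [phase, gaussian, gaussian, ← Complex.exp_add]
  congr 1
  rw [freeSymbol]
  push_cast
  ring

/-- The Gaussian wave packet centred at `y`. -/
def gaussianState (y : R3) : L2 := 𝓕⁻ (toL2 (gaussian Real.pi y))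

theorem re_pi_pos : 0 < (Real.pi : ℂ).re := by simpa using Real.pi_pos

theorem fourier_gaussianState (y : R3) :
    (𝓕 (gaussianState y) : L2) = toL2 (gaussian Real.pi y) := by
  rw [gaussianState, FourierTransform.fourier_fourierInv_eq]

theorem freeGroup_gaussianState (t : ℝ) (y : R3) :
    freeGroup t (gaussianState y) =
      𝓕⁻ (toL2 (gaussian (Real.pi + 4 * Real.pi ^ 2 * t * Complex.I) y)) := by
  rw [freeGroup_apply, fourier_gaussianState, mulL2_apply]
  congr 1
  refine toL2_congr ?_
  filter_upwards [toL2_ae (memLp_gaussian re_pi_pos y)] with ξ h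
  rw [h, phase_mul_gaussian]

/-- The explicit free evolution of a Gaussian decays uniformly, at the rate `|t|^{-3/2}`. -/
theorem norm_freeGroup_gaussianState_le (t : ℝ) (y : R3) :
    ∀ᵐ x, ‖freeGroup t (gaussianState y) x‖ ≤
      (2 : ℝ) ^ (3 / 2 : ℝ) * (1 + ‖t‖) ^ (-(3 / 2) : ℝ) := by
  set b : ℂ := Real.pi + 4 * Real.pi ^ 2 * t * Complex.I with hb
  have hre : b.re = Real.pi := by
    simp [hb, ← Complex.ofReal_pow]
  have him : b.im = 4 * Real.pi ^ 2 * t := by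
    simp [hb, ← Complex.ofReal_pow]
  have hpos : 0 < b.re := hre ▸ Real.pi_pos
  have hpi := Real.pi_pos
  have hpi3 := Real.pi_gt_three
  have hnb : Real.pi * (1 + ‖t‖) / 2 ≤ ‖b‖ := by
    have h1 := Complex.abs_re_le_norm b
    have h2 := Complex.abs_im_le_norm b
    rw [hre, abs_of_pos hpi] at h1
    rw [him, abs_mul, abs_of_pos (by positivity)] at h2
    rw [Real.norm_eq_abs]
    nlinarith [abs_nonneg t, mul_nonneg hpi.le (abs_nonneg t)]
  rw [freeGroup_gaussianState]
  filter_upwards [fourierInv_toL2_ae (integrable_gaussian hpos y) (memLp_gaussian hpos y)] with x hx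
  rw [hx, fourierInv_gaussian hpos, norm_mul]
  have h1 : ‖Complex.exp (-Real.pi ^ 2 * ‖y - x‖ ^ 2 / b)‖ ≤ 1 := by
    rw [Complex.norm_exp, Real.exp_le_one_iff]
    have : (-Real.pi ^ 2 * ‖y - x‖ ^ 2 / b : ℂ) =
        ((-(Real.pi ^ 2 * ‖y - x‖ ^ 2) : ℝ) : ℂ) * b⁻¹ := by
      push_cast
      ring
    rw [this, Complex.re_ofReal_mul, Complex.inv_re]
    have : 0 ≤ b.re / Complex.normSq b := div_nonneg hpos.le (Complex.normSq_nonneg _)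
    nlinarith [mul_nonneg (sq_nonneg Real.pi) (sq_nonneg ‖y - x‖)]
  have h2 : ‖(Real.pi / b : ℂ) ^ (3 / 2 : ℂ)‖ ≤ (2 * (1 + ‖t‖)⁻¹) ^ (3 / 2 : ℝ) := by
    rw [show (3 / 2 : ℂ) = ((3 / 2 : ℝ) : ℂ) by push_cast; rfl, Complex.norm_cpow_real]
    refine Real.rpow_le_rpow (norm_nonneg _) ?_ (by norm_num)
    have ht : 0 < 1 + ‖t‖ := by positivity
    rw [norm_div, Complex.norm_real, Real.norm_of_nonneg hpi.le,
      div_le_iff₀ (lt_of_lt_of_le (by positivity) hnb)]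
    calc Real.pi = 2 * (1 + ‖t‖)⁻¹ * (Real.pi * (1 + ‖t‖) / 2) := by field_simp
      _ ≤ _ := by gcongr
  calc _ ≤ (2 * (1 + ‖t‖)⁻¹) ^ (3 / 2 : ℝ) * 1 := by gcongr
    _ = _ := by
      rw [mul_one, Real.mul_rpow (by norm_num) (by positivity), Real.inv_rpow (by positivity),
        Real.rpow_neg (by positivity)]

/-- The Gaussian wave packets span a dense subspace: a function orthogonal to all of them has, after
multiplication of its Fourier transform by a Gaussian, a vanishing inverse Fourier transform. -/
theorem dense_span_gaussianState :
    Dense (Submodule.span ℂ (Set.range gaussianState) : Set L2) := by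
  rw [Submodule.dense_iff_topologicalClosure_eq_top, Submodule.topologicalClosure_eq_top_iff,
    Submodule.eq_bot_iff]
  intro ψ hψ
  have h1 : ∀ y, inner ℂ (gaussianState y) ψ = 0 := fun y =>
    (Submodule.mem_orthogonal _ _).1 hψ _ (Submodule.subset_span ⟨y, rfl⟩)
  set h : R3 → ℂ := fun ξ => gaussian Real.pi 0 ξ * (𝓕 ψ : L2) ξ with hh
  have hint : Integrable h :=
    (memLp_gaussian re_pi_pos 0).integrable_mul (Lp.memLp (𝓕 ψ : L2))
  have hL2 : MemLp h 2 := by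
    refine memLp_mul_of_memLp_top (memLp_top_of_bound
      (continuous_gaussian _ _).aestronglyMeasurable 1 (Eventually.of_forall fun ξ => ?_))
      (Lp.memLp _)
    rw [norm_gaussian, Real.exp_le_one_iff]
    have := Real.pi_pos
    simp only [Complex.ofReal_re]
    nlinarith [sq_nonneg ‖ξ‖, mul_nonneg this.le (sq_nonneg ‖ξ‖)]
  have h2 : ∀ y, 𝓕⁻ h y = 0 := by
    intro y
    rw [← h1 y, gaussianState, inner_fourierInv_left, inner_toL2_left (memLp_gaussian re_pi_pos y),
      Real.fourierInv_eq']
    refine integral_congr_ae (Eventually.of_forall fun ξ => ?_)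
    simp only [hh, smul_eq_mul, gaussian, ← Complex.exp_conj, ← mul_assoc, ← Complex.exp_add]
    congr 2
    simp only [inner_neg_left, inner_zero_left, neg_zero, Complex.ofReal_zero, map_add, map_mul,
      map_neg, map_pow, Complex.conj_ofReal, Complex.conj_I, mul_zero, add_zero,
      real_inner_comm ξ y, Complex.ofReal_neg, Complex.ofReal_mul, map_ofNat, Complex.ofReal_ofNat]
    ring
  have h3 : toL2 h = 0 := by
    have h4 : (𝓕⁻ (toL2 h) : L2) = 0 := by
      refine Lp.ext ?_
      filter_upwards [fourierInv_toL2_ae hint hL2, Lp.coeFn_zero ℂ 2 (volume : Measure R3)]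
        with x hx h0
      rw [hx, h2, h0, Pi.zero_apply]
    rw [← norm_eq_zero, ← norm_fourierInv_eq, h4, norm_zero]
  have h5 : (𝓕 ψ : L2) = 0 := by
    refine Lp.ext ?_
    have h6 := toL2_ae hL2
    rw [h3] at h6
    filter_upwards [h6, Lp.coeFn_zero ℂ 2 (volume : Measure R3)] with ξ h7 h0
    rw [h0, Pi.zero_apply, hh] at h7
    rw [h0, Pi.zero_apply]
    exact (mul_eq_zero.1 h7.symm).resolve_left (Complex.exp_ne_zero _)
  rw [← norm_eq_zero, ← Lp.norm_fourier_eq, h5, norm_zero]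

theorem norm_toL2_mul_le {v u : R3 → ℂ} (hv : MemLp v 2) (hu : AEStronglyMeasurable u) {c : ℝ}
    (hc : 0 ≤ c) (h : ∀ᵐ x, ‖u x‖ ≤ c) : ‖toL2 fun x => v x * u x‖ ≤ c * ‖toL2 v‖ := by
  have hm : MemLp (fun x => v x * u x) 2 := by
    simpa [mul_comm] using memLp_mul_of_memLp_top (memLp_top_of_bound hu c h) hv
  refine norm_le_of_ae_le hc ?_
  filter_upwards [h, toL2_ae hm, toL2_ae hv] with x h1 h2 h3
  rw [h2, h3, norm_mul, mul_comm]
  gcongr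

/-- Uniformly bounded functionals converge to `0` everywhere if they do so on a set with dense
span. -/
theorem tendsto_zero_of_dense_span {E ι : Type*} [NormedAddCommGroup E] [NormedSpace ℂ E]
    {L : ι → E →L[ℂ] ℂ} {C : ℝ} (hL : ∀ i x, ‖L i x‖ ≤ C * ‖x‖) {l : Filter ι} {S : Set E}
    (hS : Dense (Submodule.span ℂ S : Set E)) (h : ∀ x ∈ S, Tendsto (fun i => L i x) l (𝓝 0))
    (x : E) : Tendsto (fun i => L i x) l (𝓝 0) := by
  have hspan : ∀ x ∈ Submodule.span ℂ S, Tendsto (fun i => L i x) l (𝓝 0) := by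
    intro x hx
    induction hx using Submodule.span_induction with
    | mem x hx => exact h x hx
    | zero => simpa using tendsto_const_nhds
    | add x y _ _ hx hy => simpa using hx.add hy
    | smul c x _ hx => simpa using hx.const_mul c
  rw [Metric.tendsto_nhds]
  intro ε hε
  obtain ⟨x', hx', hxx⟩ := Metric.mem_closure_iff.1 (hS x) (ε / (2 * (|C| + 1))) (by positivity)
  filter_upwards [Metric.tendsto_nhds.1 (hspan x' hx') (ε / 2) (by positivity)] with i hi
  rw [dist_zero_right] at hi ⊢
  have h1 : ‖L i (x - x')‖ < ε / 2 := by
    rw [dist_eq_norm, lt_div_iff₀ (by positivity)] at hxx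
    have := hL i (x - x')
    nlinarith [le_abs_self C, norm_nonneg (x - x')]
  calc ‖L i x‖ = ‖L i (x - x') + L i x'‖ := by rw [map_sub, sub_add_cancel]
    _ ≤ _ := norm_add_le _ _
    _ < ε := by linarith

theorem tendsto_decay_cocompact :
    Tendsto (fun t : ℝ => (2 : ℝ) ^ (3 / 2 : ℝ) * (1 + ‖t‖) ^ (-(3 / 2) : ℝ)) (cocompact ℝ)
      (𝓝 0) := by
  have h1 : Tendsto (fun t : ℝ => 1 + ‖t‖) (cocompact ℝ) atTop :=
    tendsto_atTop_add_const_left _ _ tendsto_norm_cocompact_atTop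
  simpa using ((tendsto_rpow_neg_atTop (by norm_num : (0 : ℝ) < 3 / 2)).comp h1).const_mul
    ((2 : ℝ) ^ (3 / 2 : ℝ))

/-- The free evolution tends weakly to zero: by density it suffices to consider Gaussian wave
packets, paired with Schwartz functions. -/
theorem tendsto_inner_freeGroup (f g : L2) :
    Tendsto (fun t => inner ℂ f (freeGroup t g)) (cocompact ℝ) (𝓝 0) := by
  refine tendsto_zero_of_dense_span (L := fun t => (innerSL ℂ f) ∘L freeGroup t) (C := ‖f‖)
    (fun t x => ?_) dense_span_gaussianState ?_ g
  · exact (norm_inner_le_norm f (freeGroup t x)).trans_eq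
      (by rw [isUnitaryGroup_freeGroup.norm_map])
  rintro _ ⟨y, rfl⟩
  suffices h : Tendsto (fun t => inner ℂ (freeGroup t (gaussianState y)) f) (cocompact ℝ) (𝓝 0) by
    have := (Complex.continuous_conj.tendsto 0).comp h
    simpa [Function.comp_def] using this
  refine tendsto_zero_of_dense_span (L := fun t => innerSL ℂ (freeGroup t (gaussianState y)))
    (C := ‖gaussianState y‖) (fun t x => ?_)
    (S := Set.range (SchwartzMap.toLpCLM ℝ ℂ 2 (volume : Measure R3))) ?_ ?_ f
  · exact (norm_inner_le_norm (freeGroup t (gaussianState y)) x).trans_eq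
      (by rw [isUnitaryGroup_freeGroup.norm_map])
  · exact (SchwartzMap.denseRange_toLpCLM (p := 2) ENNReal.ofNat_ne_top).mono Submodule.subset_span
  rintro _ ⟨φ, rfl⟩
  rw [tendsto_zero_iff_norm_tendsto_zero]
  refine squeeze_zero (fun _ => norm_nonneg _) (fun t => ?_)
    (g := fun t : ℝ => ((2 : ℝ) ^ (3 / 2 : ℝ) * (1 + ‖t‖) ^ (-(3 / 2) : ℝ)) * ∫ x, ‖φ x‖)
    (by simpa using tendsto_decay_cocompact.mul_const (∫ x, ‖φ x‖))
  change ‖inner ℂ (freeGroup t (gaussianState y)) (φ.toLp 2)‖ ≤ _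
  rw [inner_eq_integral, ← integral_const_mul]
  refine norm_integral_le_of_norm_le (φ.integrable.norm.const_mul _) ?_
  filter_upwards [norm_freeGroup_gaussianState_le t y, φ.coeFn_toLp 2] with x h1 h2
  rw [norm_mul, RCLike.norm_conj, h2]
  gcongr

/-- Riemann–Lebesgue lemma for the symbol of the free group: the integral is a matrix element of the
free evolution, which tends weakly to zero. -/
theorem tendsto_integral_phase {G : R3 → ℂ} (hG : Integrable G) :
    Tendsto (fun t => ∫ ξ, phase t ξ * G ξ) (cocompact ℝ) (𝓝 0) := by
  -- write `G = a b` with `a`, `b` square integrable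
  let a : R3 → ℂ := fun ξ => (Real.sqrt ‖G ξ‖ : ℂ)
  let b : R3 → ℂ := fun ξ => G ξ / (Real.sqrt ‖G ξ‖ : ℂ)
  have hab : ∀ ξ, a ξ * b ξ = G ξ := by
    intro ξ
    by_cases h : G ξ = 0
    · simp [a, b, h]
    · have : (Real.sqrt ‖G ξ‖ : ℂ) ≠ 0 := by
        simpa [Real.sqrt_eq_zero'] using h
      exact mul_div_cancel₀ _ this
  have hna : ∀ ξ, ‖a ξ‖ ^ 2 = ‖G ξ‖ := by
    intro ξ
    rw [Complex.norm_real, Real.norm_of_nonneg (Real.sqrt_nonneg _), Real.sq_sqrt (norm_nonneg _)]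
  have hnb : ∀ ξ, ‖b ξ‖ ^ 2 = ‖G ξ‖ := by
    intro ξ
    rw [norm_div, div_pow, Complex.norm_real, Real.norm_of_nonneg (Real.sqrt_nonneg _),
      Real.sq_sqrt (norm_nonneg _), sq, mul_self_div_self]
  have ham : AEStronglyMeasurable a :=
    (Complex.continuous_ofReal.comp Real.continuous_sqrt).comp_aestronglyMeasurable hG.1.norm
  have ha : MemLp a 2 := by
    rw [memLp_two_iff_integrable_sq_norm ham]
    simpa only [hna] using hG.norm
  have hbm : AEStronglyMeasurable b := hG.1.div₀ ham
  have hb : MemLp b 2 := by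
    rw [memLp_two_iff_integrable_sq_norm hbm]
    simpa only [hnb] using hG.norm
  refine (tendsto_inner_freeGroup (𝓕⁻ (toL2 a)) (𝓕⁻ (toL2 b))).congr fun t => ?_
  rw [freeGroup_apply, inner_fourierInv_right, FourierTransform.fourier_fourierInv_eq,
    FourierTransform.fourier_fourierInv_eq, inner_toL2_left ha]
  refine integral_congr_ae ?_
  filter_upwards [mulL2_ae (phase t) (memLp_phase t) (toL2 b), toL2_ae hb] with ξ h1 h2
  rw [h1, h2, ← hab ξ, Complex.conj_ofReal]
  ring

/-- Cook's criterion holds on Gaussian wave packets if the potential is square integrable. -/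
theorem integrable_potentialOp_gaussianState {V : R3 → ℝ} (hV : MemLp V ⊤) (hV2 : MemLp V 2)
    (y : R3) : Integrable fun t => potentialOp V hV (freeGroup t (gaussianState y)) := by
  have h1 : Integrable fun t : ℝ => (2 : ℝ) ^ (3 / 2 : ℝ) * (1 + ‖t‖) ^ (-(3 / 2) : ℝ) :=
    (integrable_one_add_norm (by norm_num)).const_mul _
  refine (h1.mul_const ‖toL2 fun x => (V x : ℂ)‖).mono'
    ((potentialOp V hV).continuous.comp
      (isUnitaryGroup_freeGroup.continuous _)).aestronglyMeasurable
    (Eventually.of_forall fun t => ?_)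
  exact norm_toL2_mul_le hV2.ofReal (Lp.aestronglyMeasurable _) (by positivity)
    (norm_freeGroup_gaussianState_le t y)

end Gaussians

end ScatteringR3

/-! ### The Japanese bracket and Riesz potentials -/

namespace ScatteringR3

noncomputable section Riesz

theorem one_le_japanese (x : R3) : 1 ≤ japanese x := by
  rw [japanese, Real.one_le_sqrt]
  nlinarith [sq_nonneg ‖x‖]

theorem japanese_pos (x : R3) : 0 < japanese x := one_pos.trans_le (one_le_japanese x)

theorem continuous_japanese : Continuous japanese := by
  unfold japanese
  fun_prop

theorem continuous_japanese_rpow (r : ℝ) : Continuous fun x => japanese x ^ r :=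
  continuous_japanese.rpow_const fun x => Or.inl (japanese_pos x).ne'

theorem japanese_rpow_pos (x : R3) (r : ℝ) : 0 < japanese x ^ r :=
  Real.rpow_pos_of_pos (japanese_pos x) r

theorem japanese_rpow_eq (x : R3) (r : ℝ) : japanese x ^ r = (1 + ‖x‖ ^ 2) ^ (r / 2) := by
  rw [japanese, Real.sqrt_eq_rpow, ← Real.rpow_mul (by positivity)]
  congr 1
  ring

theorem japanese_le_add (x y : R3) : japanese x ≤ japanese y + ‖x - y‖ := by
  have h : 0 ≤ japanese y + ‖x - y‖ := by
    have := japanese_pos y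
    positivity
  rw [japanese, Real.sqrt_le_left h]
  have h1 : ‖x‖ ≤ ‖y‖ + ‖x - y‖ := by
    have := norm_add_le y (x - y)
    rwa [add_sub_cancel] at this
  have h2 : japanese y ^ 2 = 1 + ‖y‖ ^ 2 := Real.sq_sqrt (by positivity)
  have h3 : ‖y‖ ≤ japanese y := by
    rw [japanese]
    exact Real.le_sqrt_of_sq_le (by linarith)
  nlinarith [norm_nonneg x, norm_nonneg y, norm_nonneg (x - y),
    mul_le_mul_of_nonneg_right h3 (norm_nonneg (x - y))]

theorem integrable_japanese_rpow {r : ℝ} (hr : 3 < r) : Integrable fun x => japanese x ^ (-r) := by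
  simp only [japanese_rpow_eq]
  exact integrable_rpow_neg_one_add_norm_sq (by simpa using hr)

theorem memLp_japanese_rpow {r : ℝ} (hr : 3 / 2 < r) :
    MemLp (fun x => japanese x ^ (-r)) 2 := by
  rw [memLp_two_iff_integrable_sq (continuous_japanese_rpow _).aestronglyMeasurable]
  refine (integrable_japanese_rpow (r := 2 * r) (by linarith)).congr
    (Eventually.of_forall fun x => ?_)
  simp only
  rw [← Real.rpow_natCast, ← Real.rpow_mul (japanese_pos x).le]
  congr 1
  push_cast
  ring

theorem integrable_indicator_norm_rpow {c : ℝ} (hc : c < 3) :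
    Integrable fun z : R3 => (Set.Iic (1 : ℝ)).indicator (fun r => r ^ (-c)) ‖z‖ := by
  rw [integrable_fun_norm_addHaar volume (f := (Set.Iic (1 : ℝ)).indicator fun r => r ^ (-c))]
  have h : IntegrableOn (fun r : ℝ => r ^ (2 - c)) (Set.Ioc 0 1) := by
    have := intervalIntegral.intervalIntegrable_rpow' (a := 0) (b := 1)
      (r := 2 - c) (by linarith)
    rwa [intervalIntegrable_iff_integrableOn_Ioc_of_le zero_le_one] at this
  have h2 : IntegrableOn ((Set.Iic (1 : ℝ)).indicator fun r : ℝ => r ^ (2 - c)) (Set.Ioi 0) := by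
    rw [IntegrableOn, integrable_indicator_iff measurableSet_Iic, IntegrableOn,
      Measure.restrict_restrict measurableSet_Iic, Set.Iic_inter_Ioi]
    exact h
  refine h2.congr_fun (fun r hr => ?_) measurableSet_Ioi
  simp only [finrank_euclideanSpace, Fintype.card_fin, smul_eq_mul, Set.indicator_apply]
  split_ifs
  · rw [show (2 - c) = ((2 : ℕ) : ℝ) + -c by push_cast; ring, Real.rpow_add hr, Real.rpow_natCast]
  · simp

/-- Separates the local singularity from the behaviour at infinity, where `p^b q^c` is bounded by
`p^{b+c} + q^{b+c}`. -/
theorem japanese_rpow_mul_norm_rpow_le {b c : ℝ} (hb : 0 ≤ b) (hc : 0 ≤ c) (y z : R3) :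
    japanese y ^ (-b) * ‖z‖ ^ (-c) ≤ (Set.Iic (1 : ℝ)).indicator (fun r => r ^ (-c)) ‖z‖ +
      2 ^ c * (japanese y ^ (-(b + c)) + japanese z ^ (-(b + c))) := by
  have h0 : 0 ≤ 2 ^ c * (japanese y ^ (-(b + c)) + japanese z ^ (-(b + c))) := by
    have := japanese_rpow_pos y (-(b + c))
    have := japanese_rpow_pos z (-(b + c))
    positivity
  rcases le_or_gt ‖z‖ 1 with hz | hz
  · rw [Set.indicator_of_mem (by exact hz)]
    have h1 : japanese y ^ (-b) ≤ 1 :=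
      Real.rpow_le_one_of_one_le_of_nonpos (one_le_japanese y) (by linarith)
    have h2 : 0 ≤ ‖z‖ ^ (-c) := by positivity
    nlinarith
  · rw [Set.indicator_of_notMem (by simpa using hz), zero_add]
    have h1 : japanese z ≤ 2 * ‖z‖ := by
      rw [japanese, Real.sqrt_le_left (by positivity)]
      nlinarith
    have h2 : ‖z‖ ^ (-c) ≤ 2 ^ c * japanese z ^ (-c) := by
      rw [Real.rpow_neg (norm_nonneg z), Real.rpow_neg (japanese_pos z).le, ← div_eq_mul_inv,
        le_div_iff₀ (Real.rpow_pos_of_pos (japanese_pos z) _),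
        inv_mul_le_iff₀ (Real.rpow_pos_of_pos (by linarith) _), mul_comm,
        ← Real.mul_rpow (by norm_num) (norm_nonneg z)]
      exact Real.rpow_le_rpow (japanese_pos z).le h1 hc
    refine (mul_le_mul_of_nonneg_left h2 (japanese_rpow_pos y _).le).trans ?_
    rw [mul_left_comm]
    refine mul_le_mul_of_nonneg_left ?_ (by positivity)
    have h3 : ∀ u v : R3, japanese u ≤ japanese v →
        japanese v ^ (-b) * japanese u ^ (-c) ≤ japanese u ^ (-(b + c)) ∧
        japanese u ^ (-b) * japanese v ^ (-c) ≤ japanese u ^ (-(b + c)) := by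
      intro u v huv
      rw [neg_add, Real.rpow_add (japanese_pos u)]
      constructor
      · gcongr ?_ * _
        · exact (japanese_rpow_pos u _).le
        · exact Real.rpow_le_rpow_of_nonpos (japanese_pos u) huv (by linarith)
      · gcongr _ * ?_
        · exact (japanese_rpow_pos u _).le
        · exact Real.rpow_le_rpow_of_nonpos (japanese_pos u) huv (by linarith)
    rcases le_total (japanese y) (japanese z) with h | h
    · exact (h3 y z h).2.trans (le_add_of_nonneg_right (japanese_rpow_pos z _).le)
    · exact (h3 z y h).1.trans (le_add_of_nonneg_left (japanese_rpow_pos y _).le)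

/-- Riesz potentials of powers of the Japanese bracket are bounded, as long as the integral
converges locally (`c < 3`) and at infinity (`b + c > 3`). -/
theorem exists_lintegral_japanese_mul_norm_rpow_le {b c : ℝ} (hb : 0 ≤ b) (hc : 0 ≤ c)
    (hc3 : c < 3) (hbc : 3 < b + c) : ∃ C : ℝ≥0, ∀ x : R3,
      ∫⁻ y, ENNReal.ofReal (japanese y ^ (-b) * ‖x - y‖ ^ (-c)) ≤ C := by
  set F : R3 → ℝ := fun z => (Set.Iic (1 : ℝ)).indicator (fun r => r ^ (-c)) ‖z‖ +
    2 ^ c * japanese z ^ (-(b + c))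
  set G : R3 → ℝ := fun y => 2 ^ c * japanese y ^ (-(b + c))
  have hF : Integrable F :=
    (integrable_indicator_norm_rpow hc3).add ((integrable_japanese_rpow hbc).const_mul _)
  have hG : Integrable G := (integrable_japanese_rpow hbc).const_mul _
  have hfin : (∫⁻ z, ENNReal.ofReal (F z)) + ∫⁻ y, ENNReal.ofReal (G y) ≠ ⊤ :=
    ENNReal.add_ne_top.2 ⟨hF.lintegral_lt_top.ne, hG.lintegral_lt_top.ne⟩
  refine ⟨((∫⁻ z, ENNReal.ofReal (F z)) + ∫⁻ y, ENNReal.ofReal (G y)).toNNReal, fun x => ?_⟩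
  rw [ENNReal.coe_toNNReal hfin, ← lintegral_sub_left_eq_self (fun z => ENNReal.ofReal (F z)) x,
    ← lintegral_add_right' _ (by exact hG.aemeasurable.ennreal_ofReal)]
  refine lintegral_mono fun y => ?_
  refine (ENNReal.ofReal_le_ofReal ?_).trans ENNReal.ofReal_add_le
  have := japanese_rpow_mul_norm_rpow_le hb hc y (x - y)
  simp only [F, G]
  linarith

/-- The Riesz potential `∫ |f(y)| / |x - y| dy`, which dominates `H₀⁻¹ f`. The value `0` of the
kernel at `y = x` is immaterial. -/
def riesz (f : R3 → ℂ) (x : R3) : ℝ≥0∞ := ∫⁻ y, ‖f y‖ₑ * ENNReal.ofReal (‖x - y‖⁻¹)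

/-- The kernel `⟨x⟩^{-σ} |x - y|^{-1} ⟨y⟩^{-σ}` is square integrable in `y`, with a bound which
improves by the factor `⟨x⟩^{-1}` because `⟨x⟩ ≤ ⟨y⟩ + |x - y|`. -/
theorem exists_lintegral_japanese_le {σ : ℝ} (hσ : 1 < σ) : ∃ C : ℝ≥0, ∀ x : R3,
    ∫⁻ y, ENNReal.ofReal (japanese y ^ (-σ) * ‖x - y‖⁻¹) ^ (2 : ℝ) ≤
      C * ENNReal.ofReal (japanese x ^ (-1 : ℝ)) := by
  obtain ⟨C₁, h₁⟩ := exists_lintegral_japanese_mul_norm_rpow_le (b := 2 * σ - 1) (c := 2)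
    (by linarith) (by norm_num) (by norm_num) (by linarith)
  obtain ⟨C₂, h₂⟩ := exists_lintegral_japanese_mul_norm_rpow_le (b := 2 * σ) (c := 1)
    (by linarith) (by norm_num) (by norm_num) (by linarith)
  refine ⟨C₁ + C₂, fun x => ?_⟩
  have hx := japanese_pos x
  have key : ENNReal.ofReal (japanese x) *
      ∫⁻ y, ENNReal.ofReal (japanese y ^ (-σ) * ‖x - y‖⁻¹) ^ (2 : ℝ) ≤ C₁ + C₂ := by
    refine le_trans ?_ (add_le_add (h₁ x) (h₂ x))
    have hm : Measurable fun y =>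
        ENNReal.ofReal (japanese y ^ (-(2 * σ)) * ‖x - y‖ ^ (-1 : ℝ)) := by
      have := (continuous_japanese_rpow (-(2 * σ))).measurable
      fun_prop
    rw [← lintegral_add_right _ hm, ← lintegral_const_mul' _ _ ENNReal.ofReal_ne_top]
    refine lintegral_mono fun y => ?_
    have hy := japanese_pos y
    simp only
    rw [ENNReal.ofReal_rpow_of_nonneg (mul_nonneg (japanese_rpow_pos y _).le (by positivity))
      (by norm_num), ← ENNReal.ofReal_mul hx.le, ← ENNReal.ofReal_add
      (mul_nonneg (japanese_rpow_pos y _).le (by positivity))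
      (mul_nonneg (japanese_rpow_pos y _).le (by positivity))]
    refine ENNReal.ofReal_le_ofReal ?_
    rw [Real.mul_rpow (japanese_rpow_pos y _).le (by positivity), ← Real.rpow_mul hy.le,
      show -(2 * σ - 1) = -(2 * σ) + 1 by ring, Real.rpow_add hy, Real.rpow_one,
      show -σ * 2 = -(2 * σ) by ring]
    have hp := (japanese_rpow_pos y (-(2 * σ))).le
    rcases eq_or_ne x y with rfl | hxy
    · simp
    have hz : 0 < ‖x - y‖ := norm_pos_iff.2 (sub_ne_zero.2 hxy)
    have h3 : (‖x - y‖⁻¹ ^ (2 : ℝ) : ℝ) = ‖x - y‖ ^ (-2 : ℝ) := by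
      rw [Real.inv_rpow hz.le, Real.rpow_neg hz.le]
    have h4 : (‖x - y‖ ^ (-1 : ℝ) : ℝ) = ‖x - y‖ * ‖x - y‖ ^ (-2 : ℝ) := by
      rw [← Real.rpow_one_add' hz.le (by norm_num)]
      norm_num
    rw [h3, h4]
    have h5 : 0 ≤ japanese y ^ (-(2 * σ)) * ‖x - y‖ ^ (-2 : ℝ) := by positivity
    nlinarith [mul_le_mul_of_nonneg_right (japanese_le_add x y) h5]
  rw [Real.rpow_neg_one, ENNReal.ofReal_inv_of_pos hx, ← div_eq_mul_inv,
    ENNReal.le_div_iff_mul_le (by simp [hx]) (by simp), mul_comm]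
  exact_mod_cast key

/-- The Riesz potential of an element of `L²_σ` decays like `⟨x⟩^{-1/2}` if `σ > 1`. -/
theorem exists_riesz_le {σ : ℝ} (hσ : 1 < σ) : ∃ C : ℝ≥0, ∀ (f : L2) (x : R3),
    riesz f x ≤ C * ENNReal.ofReal (japanese x ^ (-(1 / 2) : ℝ)) * weightedNorm σ f := by
  obtain ⟨C, hC⟩ := exists_lintegral_japanese_le hσ
  refine ⟨C ^ (1 / 2 : ℝ), fun f x => ?_⟩
  have hw : riesz f x = ∫⁻ y, ((fun y => ‖((japanese y ^ σ : ℝ) : ℂ) * f y‖ₑ) *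
      fun y => ENNReal.ofReal (japanese y ^ (-σ) * ‖x - y‖⁻¹)) y := by
    refine lintegral_congr fun y => ?_
    rw [Pi.mul_apply, enorm_mul, ENNReal.ofReal_mul (japanese_rpow_pos y _).le]
    have h1 : ‖((japanese y ^ σ : ℝ) : ℂ)‖ₑ = ENNReal.ofReal (japanese y ^ σ) := by
      rw [← ofReal_norm, Complex.norm_of_nonneg (japanese_rpow_pos y _).le]
    have h2 : ENNReal.ofReal (japanese y ^ σ) * ENNReal.ofReal (japanese y ^ (-σ)) = 1 := by
      rw [← ENNReal.ofReal_mul (japanese_rpow_pos y _).le, ← Real.rpow_add (japanese_pos y)]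
      simp
    rw [h1]
    calc _ = (ENNReal.ofReal (japanese y ^ σ) * ENNReal.ofReal (japanese y ^ (-σ))) *
          (‖f y‖ₑ * ENNReal.ofReal ‖x - y‖⁻¹) := by rw [h2, one_mul]
      _ = _ := by ring
  have hm1 : AEMeasurable fun y => ‖((japanese y ^ σ : ℝ) : ℂ) * f y‖ₑ :=
    ((Complex.continuous_ofReal.comp (continuous_japanese_rpow σ)).aestronglyMeasurable.mul
      (Lp.aestronglyMeasurable f)).enorm
  have hm2 : AEMeasurable fun y => ENNReal.ofReal (japanese y ^ (-σ) * ‖x - y‖⁻¹) := by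
    have := (continuous_japanese_rpow (-σ)).measurable
    exact Measurable.aemeasurable (by fun_prop)
  rw [hw]
  refine (ENNReal.lintegral_mul_le_Lp_mul_Lq volume Real.HolderConjugate.two_two hm1 hm2).trans ?_
  rw [weightedNorm, eLpNorm_eq_lintegral_rpow_enorm_toReal (by norm_num) (by norm_num), mul_comm,
    ENNReal.toReal_ofNat]
  gcongr
  refine (ENNReal.rpow_le_rpow (hC x) (by norm_num)).trans (le_of_eq ?_)
  rw [ENNReal.mul_rpow_of_nonneg _ _ (by norm_num),
    ENNReal.ofReal_rpow_of_pos (japanese_rpow_pos x _), ← Real.rpow_mul (japanese_pos x).le, ENNReal.coe_rpow_of_nonneg _ (by norm_num)]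
  norm_num

end Riesz

end ScatteringR3

/-! ### The heat semigroup and the pointwise bound for `H₀⁻¹` -/

namespace ScatteringR3

noncomputable section Heat

/-- The heat multiplier `e^{-λ/τ²}`, i.e. the heat semigroup at time `τ⁻²`, with the weight
`2τ⁻³` which is the Jacobian of this parametrization of time. -/
def heat (τ : ℝ) (ξ : R3) : ℝ := 2 / τ ^ 3 * Real.exp (-(freeSymbol ξ / τ ^ 2))

theorem measurable_heat : Measurable (Function.uncurry heat) := by
  have := continuous_freeSymbol.measurable
  unfold heat Function.uncurry
  fun_prop

theorem heat_nonneg {τ : ℝ} (hτ : 0 < τ) (ξ : R3) : 0 ≤ heat τ ξ := by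
  unfold heat
  positivity

/-- Subordination `1/λ = ∫ e^{-sλ} ds`, in the variable `s = τ⁻²`. -/
theorem integral_heat {ξ : R3} (hξ : 0 < freeSymbol ξ) :
    IntegrableOn (fun τ => heat τ ξ) (Set.Ioi 0) ∧
      ∫ τ in Set.Ioi (0 : ℝ), heat τ ξ = 1 / freeSymbol ξ := by
  set a := freeSymbol ξ with ha
  -- the antiderivative `e^{-a/τ²} / a`, extended continuously by zero to `τ = 0`
  set g : ℝ → ℝ := fun τ => expNegInvGlue (τ ^ 2 / a) / a with hg
  have hcont : Continuous g := by
    have := (expNegInvGlue.contDiff (n := 0)).continuous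
    fun_prop
  have hderiv : ∀ τ ∈ Set.Ioi (0 : ℝ), HasDerivAt g (heat τ ξ) τ := by
    intro τ hτ
    have hτ0 : τ ≠ 0 := (ne_of_gt hτ)
    have h1 : HasDerivAt (fun τ : ℝ => Real.exp (-(a / τ ^ 2)) / a) (heat τ ξ) τ := by
      have h2 : HasDerivAt (fun τ : ℝ => -(a / τ ^ 2)) (2 * a / τ ^ 3) τ := by
        have := (((hasDerivAt_pow 2 τ).fun_inv (pow_ne_zero 2 hτ0)).const_mul a).neg
        refine (this.congr_deriv ?_).congr_of_eventuallyEq (Eventually.of_forall fun s => ?_)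
        · field_simp
          simp [mul_comm]
        · simp [div_eq_mul_inv]
      refine (h2.exp.div_const a).congr_deriv ?_
      rw [heat, ← ha]
      field_simp
    refine h1.congr_of_eventuallyEq ?_
    filter_upwards [lt_mem_nhds (Set.mem_Ioi.1 hτ)] with s hs
    have : 0 < s ^ 2 / a := by positivity
    simp [hg, expNegInvGlue, this.not_ge]
  have hpos : ∀ τ ∈ Set.Ioi (0 : ℝ), 0 ≤ heat τ ξ := fun τ hτ => heat_nonneg hτ ξ
  have hlim : Tendsto g atTop (𝓝 (1 / a)) := by
    have h1 : Tendsto (fun τ : ℝ => Real.exp (-(a / τ ^ 2)) / a) atTop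
        (𝓝 (Real.exp (-0) / a)) :=
      (Real.continuous_exp.tendsto _).comp
        ((tendsto_const_nhds.div_atTop (tendsto_pow_atTop two_ne_zero)).neg) |>.div_const a
    rw [neg_zero, Real.exp_zero] at h1
    refine h1.congr' ?_
    filter_upwards [eventually_gt_atTop 0] with s hs
    have : 0 < s ^ 2 / a := by positivity
    simp [hg, expNegInvGlue, this.not_ge]
  have h0 : g 0 = 0 := by simp [hg, expNegInvGlue]
  refine ⟨integrableOn_Ioi_deriv_of_nonneg hcont.continuousWithinAt hderiv hpos hlim, ?_⟩
  rw [integral_Ioi_of_hasDerivAt_of_nonneg hcont.continuousWithinAt hderiv hpos hlim, h0, sub_zero]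

theorem lintegral_heat {ξ : R3} (hξ : 0 < freeSymbol ξ) :
    ∫⁻ τ in Set.Ioi (0 : ℝ), ENNReal.ofReal (heat τ ξ) = ENNReal.ofReal (1 / freeSymbol ξ) := by
  obtain ⟨h1, h2⟩ := integral_heat hξ
  rw [← h2, ofReal_integral_eq_lintegral_ofReal h1]
  filter_upwards [ae_restrict_mem measurableSet_Ioi] with τ hτ using heat_nonneg hτ ξ

theorem ae_freeSymbol_pos : ∀ᵐ ξ : R3, 0 < freeSymbol ξ := by
  have : ∀ᵐ ξ : R3, ξ ≠ 0 := by simp [ae_iff]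
  filter_upwards [this] with ξ hξ
  have := norm_pos_iff.2 hξ
  have := Real.pi_pos
  unfold freeSymbol
  positivity

/-- A bound for the integral kernel of the multiplier `heat τ`. The power `τ³` of the heat kernel at
time `τ⁻²` cancels the weight `2τ⁻³`, which leaves a Gaussian in `τ`. -/
def heatKernel (τ : ℝ) (x y : R3) : ℝ := Real.exp (-(‖x - y‖ ^ 2 / 4) * τ ^ 2) / 4

theorem measurable_heatKernel : Measurable fun p : ℝ × R3 × R3 => heatKernel p.1 p.2.1 p.2.2 := by
  unfold heatKernel
  fun_prop

/-- The Gaussian integral in `τ` gives a multiple of the Newtonian kernel. -/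
theorem lintegral_heatKernel_le {x y : R3} (hxy : x ≠ y) :
    ∫⁻ τ in Set.Ioi (0 : ℝ), ENNReal.ofReal (heatKernel τ x y) ≤ ENNReal.ofReal (‖x - y‖⁻¹) := by
  have hr : 0 < ‖x - y‖ := norm_pos_iff.2 (sub_ne_zero.2 hxy)
  have hb : 0 < ‖x - y‖ ^ 2 / 4 := by positivity
  have hint : IntegrableOn (fun τ => heatKernel τ x y) (Set.Ioi 0) :=
    ((integrable_exp_neg_mul_sq hb).div_const 4).integrableOn
  rw [← ofReal_integral_eq_lintegral_ofReal hint
    (Eventually.of_forall fun τ => by unfold heatKernel; positivity)]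
  refine ENNReal.ofReal_le_ofReal ?_
  simp only [heatKernel]
  rw [integral_div, integral_gaussian_Ioi]
  have h1 : Real.sqrt (Real.pi / (‖x - y‖ ^ 2 / 4)) ≤ 4 * ‖x - y‖⁻¹ := by
    rw [Real.sqrt_le_left (by positivity)]
    have := Real.pi_lt_four
    rw [mul_pow, inv_pow, div_div_eq_mul_div, div_eq_mul_inv]
    gcongr
    linarith
  have : 0 ≤ ‖x - y‖⁻¹ := by positivity
  linarith

/-- Integrating the heat kernel over all times bounds the Newtonian potential of `|f|`. -/
theorem lintegral_heatKernel_mul_le (f : L2) (x : R3) :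
    ∫⁻ τ in Set.Ioi (0 : ℝ), ∫⁻ y, ENNReal.ofReal (heatKernel τ x y) * ‖f y‖ₑ ≤ riesz f x := by
  have hf : Measurable fun x => ‖f x‖ₑ := (Lp.stronglyMeasurable f).measurable.enorm
  rw [lintegral_lintegral_swap]
  · refine lintegral_mono_ae ?_
    have hne : ∀ᵐ y : R3, y ≠ x := by simp [ae_iff]
    filter_upwards [hne] with y hy
    rw [lintegral_mul_const' _ _ (by simp), mul_comm]
    gcongr
    exact lintegral_heatKernel_le hy.symm
  · refine Measurable.aemeasurable ?_
    have h : Measurable fun p : ℝ × R3 => heatKernel p.1 x p.2 := by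
      unfold heatKernel
      fun_prop
    exact h.ennreal_ofReal.mul (hf.comp measurable_snd)

theorem heat_eq (τ : ℝ) (x ξ : R3) :
    heat τ ξ = 2 / τ ^ 3 * ‖gaussian ((4 * Real.pi ^ 2 / τ ^ 2 : ℝ) : ℂ) x ξ‖ := by
  rw [heat, norm_gaussian, freeSymbol, Complex.ofReal_re]
  congr 2
  ring

theorem memLp_top_heat {τ : ℝ} (hτ : 0 < τ) : MemLp (fun ξ => (heat τ ξ : ℂ)) ⊤ := by
  have := continuous_freeSymbol
  refine memLp_top_of_bound (Continuous.aestronglyMeasurable ?_) (2 / τ ^ 3)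
    (Eventually.of_forall fun ξ => ?_)
  · unfold heat
    fun_prop
  · rw [Complex.norm_of_nonneg (heat_nonneg hτ ξ), heat]
    refine mul_le_of_le_one_right (by positivity) (Real.exp_le_one_iff.2 ?_)
    have := freeSymbol_nonneg ξ
    rw [neg_nonpos]
    positivity

theorem memLp_heat {τ : ℝ} (hτ : 0 < τ) : MemLp (fun ξ => (heat τ ξ : ℂ)) 2 := by
  have hb : 0 < ((4 * Real.pi ^ 2 / τ ^ 2 : ℝ) : ℂ).re := by
    have := Real.pi_pos
    rw [Complex.ofReal_re]
    positivity
  simp_rw [heat_eq _ 0]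
  exact ((memLp_gaussian hb 0).norm.const_mul _).ofReal

/-- The heat flow is the convolution with the inverse Fourier transform of a Gaussian. -/
theorem fourierInv_heat_mul {τ : ℝ} (hτ : 0 < τ) (f : L2) (x : R3) :
    𝓕⁻ (fun ξ => (heat τ ξ : ℂ) * (𝓕 f : L2) ξ) x =
      ∫ y, ((2 / τ ^ 3 : ℝ) : ℂ) * ((starRingEnd ℂ)
        (𝓕⁻ (gaussian ((4 * Real.pi ^ 2 / τ ^ 2 : ℝ) : ℂ) x) y) * f y) := by
  set b : ℂ := ((4 * Real.pi ^ 2 / τ ^ 2 : ℝ) : ℂ)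
  have hb : 0 < b.re := by
    have := Real.pi_pos
    rw [Complex.ofReal_re]
    positivity
  have h1 : ∫ ξ, (starRingEnd ℂ) (gaussian b x ξ) * (𝓕 f : L2) ξ =
      ∫ y, (starRingEnd ℂ) (𝓕⁻ (gaussian b x) y) * f y := by
    rw [← inner_toL2_left (memLp_gaussian hb x), ← inner_fourierInv_left, inner_eq_integral]
    refine integral_congr_ae ?_
    filter_upwards [fourierInv_toL2_ae (integrable_gaussian hb x) (memLp_gaussian hb x)] with y hy
    rw [hy]
  rw [integral_const_mul, ← h1, ← integral_const_mul, Real.fourierInv_eq']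
  refine integral_congr_ae (Eventually.of_forall fun ξ => ?_)
  simp only [smul_eq_mul, heat_eq τ x]
  have hre : b.re = 4 * Real.pi ^ 2 / τ ^ 2 := Complex.ofReal_re _
  rw [norm_gaussian, gaussian, ← Complex.exp_conj, hre]
  push_cast
  rw [mul_left_comm, mul_assoc, ← mul_assoc (Complex.exp _), ← Complex.exp_add]
  congr 3
  rw [map_add, map_mul, map_mul, map_mul, map_mul, Complex.conj_I, Complex.conj_ofReal,
    Complex.conj_ofReal, map_neg, map_pow, Complex.conj_ofReal, inner_neg_left, real_inner_comm]
  simp only [Complex.conj_ofReal, map_ofNat]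
  push_cast
  ring

theorem enorm_fourierInv_heat_le {τ : ℝ} (hτ : 0 < τ) (f : L2) (x : R3) :
    ‖𝓕⁻ (fun ξ => (heat τ ξ : ℂ) * (𝓕 f : L2) ξ) x‖ₑ ≤
      ∫⁻ y, ENNReal.ofReal (heatKernel τ x y) * ‖f y‖ₑ := by
  have hb : 0 < ((4 * Real.pi ^ 2 / τ ^ 2 : ℝ) : ℂ).re := by
    have := Real.pi_pos
    rw [Complex.ofReal_re]
    positivity
  rw [fourierInv_heat_mul hτ]
  refine (enorm_integral_le_lintegral_enorm _).trans (lintegral_mono fun y => ?_)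
  rw [← mul_assoc, enorm_mul]
  gcongr
  rw [← ofReal_norm]
  refine ENNReal.ofReal_le_ofReal ?_
  rw [norm_mul, RCLike.norm_conj, fourierInv_gaussian hb, norm_mul,
    Complex.norm_of_nonneg (by positivity)]
  have hpi := Real.pi_pos
  have h1 : ‖((Real.pi : ℂ) / ((4 * Real.pi ^ 2 / τ ^ 2 : ℝ) : ℂ)) ^ (3 / 2 : ℂ)‖ ≤ τ ^ 3 / 8 := by
    rw [show (3 / 2 : ℂ) = ((3 / 2 : ℝ) : ℂ) by push_cast; rfl, Complex.norm_cpow_real,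
      ← Complex.ofReal_div, Complex.norm_of_nonneg (by positivity)]
    have h2 : Real.pi / (4 * Real.pi ^ 2 / τ ^ 2) ≤ (τ / 2) ^ (2 : ℝ) := by
      rw [Real.rpow_two]
      have : Real.pi / (4 * Real.pi ^ 2 / τ ^ 2) = (τ / 2) ^ 2 * Real.pi⁻¹ := by
        field_simp
        norm_num
      rw [this]
      exact mul_le_of_le_one_right (by positivity)
        (inv_le_one_of_one_le₀ (by linarith [Real.pi_gt_three]))
    refine (Real.rpow_le_rpow (by positivity) h2 (by norm_num)).trans (le_of_eq ?_)
    rw [← Real.rpow_mul (by positivity)]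
    norm_num
    ring
  have h3 : ‖Complex.exp (-Real.pi ^ 2 * ‖x - y‖ ^ 2 / ((4 * Real.pi ^ 2 / τ ^ 2 : ℝ) : ℂ))‖ =
      Real.exp (-(‖x - y‖ ^ 2 / 4) * τ ^ 2) := by
    rw [Complex.norm_exp]
    congr 1
    have : (-Real.pi ^ 2 * ‖x - y‖ ^ 2 / ((4 * Real.pi ^ 2 / τ ^ 2 : ℝ) : ℂ) : ℂ) =
        ((-(‖x - y‖ ^ 2 / 4) * τ ^ 2 : ℝ) : ℂ) := by
      have hpc : (Real.pi : ℂ) ≠ 0 := by exact_mod_cast hpi.ne'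
      have htc : (τ : ℂ) ≠ 0 := by exact_mod_cast hτ.ne'
      push_cast
      field_simp
    rw [this, Complex.ofReal_re]
  rw [h3, heatKernel]
  calc _ ≤ 2 / τ ^ 3 * (τ ^ 3 / 8 * Real.exp (-(‖x - y‖ ^ 2 / 4) * τ ^ 2)) := by gcongr
    _ = _ := by field_simp; norm_num

theorem lintegral_heat_energy_le {τ : ℝ} (hτ : 0 < τ) (f : L2) :
    ∫⁻ ξ, ‖(𝓕 f : L2) ξ‖ₑ ^ 2 * ENNReal.ofReal (heat τ ξ) ≤
      ∫⁻ x, ∫⁻ y, ‖f x‖ₑ * (ENNReal.ofReal (heatKernel τ x y) * ‖f y‖ₑ) := by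
  set u : R3 → ℂ := fun ξ => (heat τ ξ : ℂ) * (𝓕 f : L2) ξ with hu
  have hu2 : MemLp u 2 := memLp_mul_of_memLp_top (memLp_top_heat hτ) (Lp.memLp _)
  have hu1 : Integrable u := (memLp_heat hτ).integrable_mul (Lp.memLp _)
  have h1 : inner ℂ (𝓕 f : L2) (toL2 u) =
      ((∫ ξ, heat τ ξ * ‖(𝓕 f : L2) ξ‖ ^ 2 : ℝ) : ℂ) := by
    rw [inner_eq_integral, ← integral_complex_ofReal]
    refine integral_congr_ae ((toL2_ae hu2).mono fun ξ hξ => ?_)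
    simp only [hξ]
    simp only [hu]
    rw [mul_left_comm, Complex.conj_mul']
    push_cast
    rfl
  have hint : Integrable fun ξ => heat τ ξ * ‖(𝓕 f : L2) ξ‖ ^ 2 := by
    have := ((memLp_congr_coe (f := toL2 u) (toL2_ae hu2)).norm).integrable_mul
      (Lp.memLp (𝓕 f : L2)).norm
    refine this.congr (Eventually.of_forall fun ξ => ?_)
    simp only [hu, Pi.mul_apply, norm_mul, Complex.norm_of_nonneg (heat_nonneg hτ ξ)]
    ring
  have hnn : ∀ ξ, 0 ≤ heat τ ξ * ‖(𝓕 f : L2) ξ‖ ^ 2 := fun ξ =>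
    mul_nonneg (heat_nonneg hτ ξ) (by positivity)
  have h2 : ∫⁻ ξ, ‖(𝓕 f : L2) ξ‖ₑ ^ 2 * ENNReal.ofReal (heat τ ξ) =
      ‖inner ℂ (𝓕 f : L2) (toL2 u)‖ₑ := by
    rw [h1, ← ofReal_norm, Complex.norm_of_nonneg (integral_nonneg hnn),
      ofReal_integral_eq_lintegral_ofReal hint (Eventually.of_forall hnn)]
    refine lintegral_congr fun ξ => ?_
    rw [ENNReal.ofReal_mul (heat_nonneg hτ ξ), ENNReal.ofReal_pow (norm_nonneg _), ofReal_norm,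
      mul_comm]
  rw [h2, ← inner_fourierInv_right, inner_eq_integral]
  refine (enorm_integral_le_lintegral_enorm _).trans (lintegral_mono_ae ?_)
  filter_upwards [fourierInv_toL2_ae hu1 hu2] with x hx
  rw [lintegral_const_mul' _ _ (by simp), enorm_mul, hx, RCLike.enorm_conj]
  gcongr
  exact enorm_fourierInv_heat_le hτ f x

/-- The quadratic form of `H₀⁻¹` is bounded by that of the Riesz potential. -/
theorem lintegral_energy_le (f : L2) :
    ∫⁻ ξ, ‖(𝓕 f : L2) ξ‖ₑ ^ 2 * ENNReal.ofReal (1 / freeSymbol ξ) ≤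
      ∫⁻ x, ‖f x‖ₑ * riesz f x := by
  have hf : Measurable fun x => ‖f x‖ₑ := (Lp.stronglyMeasurable f).measurable.enorm
  have hF : Measurable fun ξ => ‖(𝓕 f : L2) ξ‖ₑ := (Lp.stronglyMeasurable _).measurable.enorm
  have hK := measurable_heatKernel
  calc _ = ∫⁻ ξ, ∫⁻ τ in Set.Ioi (0 : ℝ), ‖(𝓕 f : L2) ξ‖ₑ ^ 2 * ENNReal.ofReal (heat τ ξ) := by
        refine lintegral_congr_ae (ae_freeSymbol_pos.mono fun ξ hξ => ?_)
        simp only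
        rw [lintegral_const_mul' _ _ (by simp), lintegral_heat hξ]
    _ = ∫⁻ τ in Set.Ioi (0 : ℝ), ∫⁻ ξ, ‖(𝓕 f : L2) ξ‖ₑ ^ 2 * ENNReal.ofReal (heat τ ξ) := by
        refine lintegral_lintegral_swap (Measurable.aemeasurable ?_)
        have := measurable_heat.comp (measurable_swap (α := R3) (β := ℝ))
        exact ((hF.comp measurable_fst).pow_const 2).mul this.ennreal_ofReal
    _ ≤ ∫⁻ τ in Set.Ioi (0 : ℝ),
          ∫⁻ x, ∫⁻ y, ‖f x‖ₑ * (ENNReal.ofReal (heatKernel τ x y) * ‖f y‖ₑ) :=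
        setLIntegral_mono' measurableSet_Ioi fun τ hτ => lintegral_heat_energy_le hτ f
    _ = ∫⁻ x, ∫⁻ τ in Set.Ioi (0 : ℝ),
          ∫⁻ y, ‖f x‖ₑ * (ENNReal.ofReal (heatKernel τ x y) * ‖f y‖ₑ) := by
        refine lintegral_lintegral_swap (Measurable.aemeasurable ?_)
        refine Measurable.lintegral_prod_right' (f := fun q : (ℝ × R3) × R3 =>
          ‖f q.1.2‖ₑ * (ENNReal.ofReal (heatKernel q.1.1 q.1.2 q.2) * ‖f q.2‖ₑ)) ?_
        have := hK.comp (MeasurableEquiv.prodAssoc (α := ℝ) (β := R3) (γ := R3)).measurable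
        exact (hf.comp (measurable_snd.comp measurable_fst)).mul
          (this.ennreal_ofReal.mul (hf.comp measurable_snd))
    _ ≤ ∫⁻ x, ‖f x‖ₑ * riesz f x := by
        refine lintegral_mono fun x => ?_
        have : ∀ τ, ∫⁻ y, ‖f x‖ₑ * (ENNReal.ofReal (heatKernel τ x y) * ‖f y‖ₑ) =
          ‖f x‖ₑ * ∫⁻ y, ENNReal.ofReal (heatKernel τ x y) * ‖f y‖ₑ := fun τ =>
            lintegral_const_mul' _ _ (by simp)
        simp only [this]
        rw [lintegral_const_mul' _ _ (by simp)]
        gcongr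
        exact lintegral_heatKernel_mul_le f x

end Heat

end ScatteringR3

/-! ### The operator `H₀⁻¹` on weighted spaces -/

namespace ScatteringR3

noncomputable section FreeInverse

variable {σ : ℝ}

/-- The pointwise bound of `H₀⁻¹ f` by the Riesz potential of `f`. -/
theorem enorm_freeInverse_le {f : L2}
    (hf : Integrable fun ξ => (1 / (freeSymbol ξ : ℂ)) * (𝓕 f : L2) ξ) (x : R3) :
    ‖freeInverse f x‖ₑ ≤ riesz f x := by
  set e : R3 → ℂ := fun ξ => Complex.exp (((2 * Real.pi * inner ℝ ξ x : ℝ) : ℂ) * Complex.I)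
  have he : ∀ ξ, ‖e ξ‖ = 1 := fun ξ => Complex.norm_exp_ofReal_mul_I _
  have hec : Continuous e := by fun_prop
  have hF : AEStronglyMeasurable (𝓕 f : L2) := Lp.aestronglyMeasurable _
  have hprod : Integrable (Function.uncurry fun (ξ : R3) (τ : ℝ) =>
      (heat τ ξ : ℂ) * (e ξ * (𝓕 f : L2) ξ)) (volume.prod (volume.restrict (Set.Ioi 0))) := by
    have hmeas : AEStronglyMeasurable (Function.uncurry fun (ξ : R3) (τ : ℝ) =>
        (heat τ ξ : ℂ) * (e ξ * (𝓕 f : L2) ξ)) (volume.prod (volume.restrict (Set.Ioi 0))) := by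
      have h1 : Measurable fun p : R3 × ℝ => (heat p.2 p.1 : ℂ) :=
        Complex.measurable_ofReal.comp (measurable_heat.comp measurable_swap)
      exact h1.aestronglyMeasurable.mul ((hec.aestronglyMeasurable.mul hF).comp_fst)
    refine ⟨hmeas, ?_⟩
    rw [HasFiniteIntegral, lintegral_prod _ hmeas.enorm]
    refine lt_of_le_of_lt (le_of_eq ?_) hf.2
    refine lintegral_congr_ae (ae_freeSymbol_pos.mono fun ξ hξ => ?_)
    simp only [Function.uncurry, enorm_mul]
    rw [lintegral_mul_const' _ _ (by simp [ENNReal.mul_eq_top])]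
    have h1 : ‖e ξ‖ₑ = 1 := by rw [← ofReal_norm, he, ENNReal.ofReal_one]
    have h2 : ∫⁻ τ in Set.Ioi (0 : ℝ), ‖(heat τ ξ : ℂ)‖ₑ = ‖1 / (freeSymbol ξ : ℂ)‖ₑ := by
      have h3 : 1 / (freeSymbol ξ : ℂ) = ((1 / freeSymbol ξ : ℝ) : ℂ) := by push_cast; rfl
      rw [h3, ← ofReal_norm, Complex.norm_of_nonneg (by positivity), ← lintegral_heat hξ]
      refine setLIntegral_congr_fun measurableSet_Ioi fun τ hτ => ?_
      rw [← ofReal_norm, Complex.norm_of_nonneg (heat_nonneg hτ ξ)]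
    rw [h1, h2, one_mul]
  have hrep : freeInverse f x =
      ∫ τ in Set.Ioi (0 : ℝ), 𝓕⁻ (fun ξ => (heat τ ξ : ℂ) * (𝓕 f : L2) ξ) x := by
    have h1 : ∀ τ, 𝓕⁻ (fun ξ => (heat τ ξ : ℂ) * (𝓕 f : L2) ξ) x =
        ∫ ξ, (heat τ ξ : ℂ) * (e ξ * (𝓕 f : L2) ξ) := fun τ => by
      rw [Real.fourierInv_eq']
      refine integral_congr_ae (Eventually.of_forall fun ξ => ?_)
      simp only [smul_eq_mul, e]
      ring
    simp only [h1]
    rw [← integral_integral_swap hprod, freeInverse, Real.fourierInv_eq']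
    refine integral_congr_ae (ae_freeSymbol_pos.mono fun ξ hξ => ?_)
    simp only [smul_eq_mul]
    rw [integral_mul_const, integral_complex_ofReal, (integral_heat hξ).2]
    simp only [e]
    push_cast
    ring
  rw [hrep]
  refine (enorm_integral_le_lintegral_enorm _).trans (le_trans ?_ (lintegral_heatKernel_mul_le f x))
  exact setLIntegral_mono' measurableSet_Ioi fun τ hτ => enorm_fourierInv_heat_le hτ f x

theorem memLp_top_japanese_rpow (hσ : 0 ≤ σ) :
    MemLp (fun x => ((japanese x ^ (-σ) : ℝ) : ℂ)) ⊤ :=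
  (memLp_top_of_bound (continuous_japanese_rpow _).aestronglyMeasurable 1
    (Eventually.of_forall fun x => by
      rw [Real.norm_of_nonneg (japanese_rpow_pos x _).le]
      exact Real.rpow_le_one_of_one_le_of_nonpos (one_le_japanese x) (by linarith))).ofReal

/-- Multiplication by `⟨x⟩^{-σ}`, an isometry of `L²` onto `L²_σ`. -/
def weightOp (σ : ℝ) (hσ : 0 ≤ σ) : L2 →L[ℂ] L2 :=
  mulL2 (fun x => ((japanese x ^ (-σ) : ℝ) : ℂ)) (memLp_top_japanese_rpow hσ)

theorem japanese_rpow_mul_neg (x : R3) (σ : ℝ) : japanese x ^ σ * japanese x ^ (-σ) = 1 := by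
  rw [← Real.rpow_add (japanese_pos x)]
  simp

theorem weightOp_ae (hσ : 0 ≤ σ) (u : L2) :
    (fun x => ((japanese x ^ σ : ℝ) : ℂ) * weightOp σ hσ u x) =ᵐ[volume] u := by
  filter_upwards [mulL2_ae _ (memLp_top_japanese_rpow hσ) u] with x hx
  rw [weightOp, hx, ← mul_assoc, ← Complex.ofReal_mul, japanese_rpow_mul_neg, Complex.ofReal_one,
    one_mul]

theorem weightOp_mem (hσ : 0 ≤ σ) (u : L2) : weightOp σ hσ u ∈ weightedL2 σ :=
  (memLp_congr_ae (weightOp_ae hσ u)).2 (Lp.memLp u)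

theorem weightedNorm_weightOp (hσ : 0 ≤ σ) (u : L2) :
    weightedNorm σ (weightOp σ hσ u) = ENNReal.ofReal ‖u‖ := by
  rw [weightedNorm, eLpNorm_congr_ae (weightOp_ae hσ u), Lp.norm_def,
    ENNReal.ofReal_toReal (Lp.eLpNorm_ne_top u)]

theorem exists_weightOp_eq (hσ : 0 ≤ σ) {f : L2} (hf : f ∈ weightedL2 σ) :
    ∃ u, weightOp σ hσ u = f := by
  refine ⟨toL2 fun x => ((japanese x ^ σ : ℝ) : ℂ) * f x, Lp.ext ?_⟩
  filter_upwards [mulL2_ae _ (memLp_top_japanese_rpow hσ)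
    (toL2 fun x => ((japanese x ^ σ : ℝ) : ℂ) * f x), toL2_ae hf] with x h1 h2
  rw [weightOp, h1, h2, ← mul_assoc, ← Complex.ofReal_mul, mul_comm (japanese x ^ (-σ)),
    japanese_rpow_mul_neg, Complex.ofReal_one, one_mul]

theorem weightOp_injective (hσ : 0 ≤ σ) {u v : L2} (h : weightOp σ hσ u = weightOp σ hσ v) :
    u = v := by
  refine Lp.ext ((weightOp_ae hσ u).symm.trans (EventuallyEq.trans ?_ (weightOp_ae hσ v)))
  rw [h]

/-- The energy `∫ |f̂|² / λ` is finite for `f ∈ L²_σ`, `σ > 1`. -/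
theorem lintegral_energy_lt_top (hσ : 1 < σ) {f : L2} (hf : f ∈ weightedL2 σ) :
    ∫⁻ ξ, ‖(𝓕 f : L2) ξ‖ₑ ^ 2 * ENNReal.ofReal (1 / freeSymbol ξ) < ⊤ := by
  obtain ⟨C, hC⟩ := exists_riesz_le hσ
  refine (lintegral_energy_le f).trans_lt ?_
  have h1 : Integrable fun x => ((japanese x ^ (-(1 / 2) : ℝ) : ℝ) : ℂ) * f x := by
    have h2 := (memLp_japanese_rpow (r := σ + 1 / 2) (by linarith)).ofReal (K := ℂ)
    refine (h2.integrable_mul hf).congr (Eventually.of_forall fun x => ?_)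
    simp only [Pi.mul_apply, RCLike.ofReal_eq_complex_ofReal]
    rw [← mul_assoc, ← Complex.ofReal_mul, ← Real.rpow_add (japanese_pos x)]
    congr 3
    ring
  calc _ ≤ ∫⁻ x, ‖((japanese x ^ (-(1 / 2) : ℝ) : ℝ) : ℂ) * f x‖ₑ * (C * weightedNorm σ f) := by
        refine lintegral_mono fun x => ?_
        rw [enorm_mul, ← ofReal_norm ((japanese x ^ (-(1 / 2) : ℝ) : ℝ) : ℂ),
          Complex.norm_of_nonneg (japanese_rpow_pos x _).le]
        calc _ ≤ _ := mul_le_mul_right (hC f x) _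
          _ = _ := by ring
    _ = (∫⁻ x, ‖((japanese x ^ (-(1 / 2) : ℝ) : ℝ) : ℂ) * f x‖ₑ) * (C * weightedNorm σ f) :=
        lintegral_mul_const' _ _ (ENNReal.mul_ne_top (by simp) hf.2.ne)
    _ < ⊤ := ENNReal.mul_lt_top h1.2 (ENNReal.mul_lt_top (by simp) hf.2)

/-- For `f ∈ L²_σ` with `σ > 1` the function `f̂ / λ` is integrable: it is the product of `f̂`, which
is square integrable with weight `1 + 1/λ`, and of `1/λ`, which is square integrable with the
inverse weight. -/
theorem integrable_inv_freeSymbol_mul (hσ : 1 < σ) {f : L2} (hf : f ∈ weightedL2 σ) :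
    Integrable fun ξ => (1 / (freeSymbol ξ : ℂ)) * (𝓕 f : L2) ξ := by
  have hms := continuous_freeSymbol.measurable
  have hmeas : AEStronglyMeasurable fun ξ => (1 / (freeSymbol ξ : ℂ)) * (𝓕 f : L2) ξ :=
    Measurable.aestronglyMeasurable (by fun_prop) |>.mul (Lp.aestronglyMeasurable _)
  refine ⟨hmeas, ?_⟩
  obtain ⟨C, hC⟩ := exists_lintegral_japanese_mul_norm_rpow_le (b := 2) (c := 2)
    (by norm_num) (by norm_num) (by norm_num) (by norm_num)
  have h1 : ∫⁻ ξ, ‖(𝓕 f : L2) ξ‖ₑ ^ 2 < ⊤ := by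
    have := ((Lp.memLp (𝓕 f : L2)).integrable_norm_pow two_ne_zero).2
    simpa [HasFiniteIntegral] using this
  have h2 := lintegral_energy_lt_top hσ hf
  have hF : AEMeasurable fun ξ => ‖(𝓕 f : L2) ξ‖ₑ := (Lp.aestronglyMeasurable _).enorm
  have hm2 : Measurable fun ξ => ENNReal.ofReal (japanese ξ ^ (-2 : ℝ) * ‖0 - ξ‖ ^ (-2 : ℝ)) := by
    have := (continuous_japanese_rpow (-2)).measurable
    fun_prop
  refine lt_of_le_of_lt (b := (∫⁻ ξ, ‖(𝓕 f : L2) ξ‖ₑ ^ 2) +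
    (∫⁻ ξ, ‖(𝓕 f : L2) ξ‖ₑ ^ 2 * ENNReal.ofReal (1 / freeSymbol ξ)) +
    ∫⁻ ξ, ENNReal.ofReal (japanese ξ ^ (-2 : ℝ) * ‖0 - ξ‖ ^ (-2 : ℝ))) ?_
    (ENNReal.add_lt_top.2 ⟨ENNReal.add_lt_top.2 ⟨h1, h2⟩, (hC 0).trans_lt (by simp)⟩)
  rw [← lintegral_add_left' (hF.pow_const 2), ← lintegral_add_right _ hm2]
  refine lintegral_mono_ae (ae_freeSymbol_pos.mono fun ξ hξ => ?_)
  have hn : ∀ z : ℂ, ‖z‖ₑ = ENNReal.ofReal ‖z‖ := fun z => (ofReal_norm z).symm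
  have hj := japanese_rpow_pos ξ (-2)
  rw [hn, hn, ← ENNReal.ofReal_pow (norm_nonneg _), ← ENNReal.ofReal_mul (by positivity),
    ← ENNReal.ofReal_add (by positivity) (by positivity),
    ← ENNReal.ofReal_add (by positivity) (by positivity)]
  refine ENNReal.ofReal_le_ofReal ?_
  rw [norm_mul, norm_div, norm_one, Complex.norm_of_nonneg hξ.le, zero_sub, norm_neg]
  set a := ‖(𝓕 f : L2) ξ‖
  have hξ0 : 0 < ‖ξ‖ ^ 2 := by
    have : 0 < 4 * Real.pi ^ 2 * ‖ξ‖ ^ 2 := hξ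
    have hpi := Real.pi_pos
    exact pos_of_mul_pos_right this (by positivity)
  have hle : ‖ξ‖ ^ 2 ≤ freeSymbol ξ := by
    have : 1 ≤ 4 * Real.pi ^ 2 := by nlinarith [Real.pi_gt_three]
    exact le_mul_of_one_le_left hξ0.le this
  have hjap : japanese ξ ^ (-2 : ℝ) = (1 + ‖ξ‖ ^ 2)⁻¹ := by
    rw [japanese_rpow_eq, ← Real.rpow_neg_one]
    norm_num
  have h3 : (freeSymbol ξ * (1 + freeSymbol ξ))⁻¹ ≤ japanese ξ ^ (-2 : ℝ) * ‖ξ‖ ^ (-2 : ℝ) := by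
    rw [hjap, Real.rpow_neg (norm_nonneg _), Real.rpow_two, ← mul_inv, mul_comm]
    gcongr
  refine le_trans ?_ (add_le_add_right h3 _)
  set l := freeSymbol ξ
  -- the inequality between the arithmetic and the geometric mean, with this weight
  have h4 : a ^ 2 + a ^ 2 * (1 / l) + (l * (1 + l))⁻¹ - 1 / l * a =
      (l * (1 + l))⁻¹ * (((1 + l) * a) ^ 2 + 1 - (1 + l) * a) := by
    field_simp
    ring
  have h5 : 0 ≤ (l * (1 + l))⁻¹ * (((1 + l) * a) ^ 2 + 1 - (1 + l) * a) := by
    refine mul_nonneg (by positivity) ?_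
    nlinarith [sq_nonneg ((1 + l) * a - 1), sq_nonneg ((1 + l) * a)]
  linarith

theorem continuous_freeInverse (hσ : 1 < σ) {f : L2} (hf : f ∈ weightedL2 σ) :
    Continuous (freeInverse f) := continuous_fourierInv (integrable_inv_freeSymbol_mul hσ hf)

theorem fourierInv_add_apply {u v : R3 → ℂ} (hu : Integrable u) (hv : Integrable v) (x : R3) :
    𝓕⁻ (fun ξ => u ξ + v ξ) x = 𝓕⁻ u x + 𝓕⁻ v x := by
  have h1 := (Real.fourierIntegral_convergent_iff (-x)).2 hu
  have h2 := (Real.fourierIntegral_convergent_iff (-x)).2 hv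
  simp only [inner_neg_right, neg_neg] at h1 h2
  simp only [Real.fourierInv_eq, smul_add]
  exact integral_add h1 h2

theorem fourierInv_const_mul_apply (c : ℂ) (u : R3 → ℂ) (x : R3) :
    𝓕⁻ (fun ξ => c * u ξ) x = c * 𝓕⁻ u x := by
  simp only [Real.fourierInv_eq, ← smul_eq_mul (a := c), ← integral_smul]
  simp only [smul_comm c]

theorem fourierInv_congr_ae {u v : R3 → ℂ} (h : u =ᵐ[volume] v) (x : R3) :
    𝓕⁻ u x = 𝓕⁻ v x := by
  simp only [Real.fourierInv_eq]
  exact integral_congr_ae (h.mono fun ξ hξ => by simp only [hξ])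

theorem freeInverse_add (hσ : 1 < σ) {f g : L2} (hf : f ∈ weightedL2 σ) (hg : g ∈ weightedL2 σ)
    (x : R3) : freeInverse (f + g) x = freeInverse f x + freeInverse g x := by
  have h : (𝓕 (f + g) : L2) = 𝓕 f + 𝓕 g := FourierTransform.fourier_add f g
  rw [freeInverse, freeInverse, freeInverse, ← fourierInv_add_apply
    (integrable_inv_freeSymbol_mul hσ hf) (integrable_inv_freeSymbol_mul hσ hg)]
  refine fourierInv_congr_ae ?_ x
  rw [h]
  filter_upwards [Lp.coeFn_add (𝓕 f : L2) (𝓕 g)] with ξ hξ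
  rw [hξ, Pi.add_apply, mul_add]

theorem freeInverse_smul (c : ℂ) (f : L2) (x : R3) :
    freeInverse (c • f) x = c * freeInverse f x := by
  have h : (𝓕 (c • f) : L2) = c • 𝓕 f := FourierTransform.fourier_smul c f
  rw [freeInverse, freeInverse, ← fourierInv_const_mul_apply]
  refine fourierInv_congr_ae ?_ x
  rw [h]
  filter_upwards [Lp.coeFn_smul c (𝓕 f : L2)] with ξ hξ
  rw [hξ, Pi.smul_apply, smul_eq_mul, mul_left_comm]

/-- `H₀⁻¹` maps `L²_σ` to functions which decay like `⟨x⟩^{-1/2}`. -/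
theorem exists_norm_freeInverse_weightOp_le (hσ : 1 < σ) : ∃ C : ℝ≥0, ∀ (u : L2) (x : R3),
    ‖freeInverse (weightOp σ (zero_le_one.trans hσ.le) u) x‖ ≤
      C * japanese x ^ (-(1 / 2) : ℝ) * ‖u‖ := by
  obtain ⟨C, hC⟩ := exists_riesz_le hσ
  refine ⟨C, fun u x => ?_⟩
  have hσ0 := zero_le_one.trans hσ.le
  have h1 := (enorm_freeInverse_le (integrable_inv_freeSymbol_mul hσ (weightOp_mem hσ0 u)) x).trans
    (hC _ x)
  have hj := (japanese_rpow_pos x (-(1 / 2))).le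
  rw [weightedNorm_weightOp, ← ofReal_norm, ← ENNReal.ofReal_coe_nnreal,
    ← ENNReal.ofReal_mul C.coe_nonneg, ← ENNReal.ofReal_mul (mul_nonneg C.coe_nonneg hj)] at h1
  exact (ENNReal.ofReal_le_ofReal_iff (by positivity)).1 h1

/-- Evaluation of `H₀⁻¹ ⟨·⟩^{-σ} u` at a point, a bounded functional of `u ∈ L²`. -/
def evalFreeInverse (hσ : 1 < σ) (x : R3) : L2 →L[ℂ] ℂ :=
  LinearMap.mkContinuousOfExistsBound
    { toFun := fun u => freeInverse (weightOp σ (zero_le_one.trans hσ.le) u) x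
      map_add' := fun u v => by
        rw [map_add, freeInverse_add hσ (weightOp_mem _ u) (weightOp_mem _ v)]
      map_smul' := fun c u => by
        rw [map_smul, freeInverse_smul, RingHom.id_apply, smul_eq_mul] }
    (by
      obtain ⟨C, hC⟩ := exists_norm_freeInverse_weightOp_le hσ
      exact ⟨C * japanese x ^ (-(1 / 2) : ℝ), fun u => hC u x⟩)

theorem evalFreeInverse_apply (hσ : 1 < σ) (x : R3) (u : L2) :
    evalFreeInverse hσ x u = freeInverse (weightOp σ (zero_le_one.trans hσ.le) u) x := rfl

end FreeInverse

/-! ### Compactness and the Fredholm alternative -/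

section Compact

/-- An operator on a separable Hilbert space which turns weak into strong convergence of bounded
sequences is compact. -/
theorem isCompactOperator_of_weak_to_strong {E : Type*} [NormedAddCommGroup E]
    [InnerProductSpace ℂ E] [CompleteSpace E] [TopologicalSpace.SeparableSpace E] {K : E →L[ℂ] E}
    (hK : ∀ (u : ℕ → E) (v : E), (∀ n, ‖u n‖ ≤ 1) →
      (∀ L : E →L[ℂ] ℂ, Tendsto (fun n => L (u n)) atTop (𝓝 (L v))) →
      Tendsto (fun n => K (u n)) atTop (𝓝 (K v))) : IsCompactOperator K := by
  have hseq : IsSeqCompact (K '' Metric.closedBall 0 1) := by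
    intro w hw
    choose u hu hKu using hw
    have hu1 : ∀ n, ‖u n‖ ≤ 1 := fun n => by simpa using hu n
    let J := InnerProductSpace.toDual ℂ E
    obtain ⟨ℓ, hℓ, φ, hφ, hlim⟩ := WeakDual.isSeqCompact_closedBall ℂ E 0 1
      (x := fun n => StrongDual.toWeakDual (J (u n))) (fun n => by simpa using hu1 n)
    set v := J.symm (WeakDual.toStrongDual ℓ)
    have hv : ‖v‖ ≤ 1 := by simpa [v] using hℓ
    refine ⟨K v, ⟨v, by simpa using hv, rfl⟩, φ, hφ, ?_⟩
    have h1 : ∀ y, Tendsto (fun n => inner ℂ (u (φ n)) y) atTop (𝓝 (inner ℂ v y)) := by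
      intro y
      have h2 := ((WeakDual.eval_continuous y).tendsto ℓ).comp hlim
      have h3 : ℓ y = inner ℂ v y := by
        rw [InnerProductSpace.toDual_symm_apply]
        rfl
      rw [h3] at h2
      exact h2
    have h2 := hK (u ∘ φ) v (fun n => hu1 _) fun L => by
      have h3 : ∀ z, L z = inner ℂ (J.symm L) z := fun z => by
        rw [InnerProductSpace.toDual_symm_apply]
      simp only [h3, Function.comp_apply]
      have h4 := (Complex.continuous_conj.tendsto _).comp (h1 (J.symm L))
      simpa [Function.comp_def] using h4
    exact h2.congr fun n => hKu _
  have h := hseq.isCompact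
  exact (isCompactOperator_iff_isCompact_closure_image_closedBall K.toLinearMap one_pos).2
    (h.isClosed.closure_eq.symm ▸ h)

end Compact

end ScatteringR3

namespace ScatteringR3

noncomputable section BirmanSchwinger

variable {V : R3 → ℝ} {σ : ℝ}

theorem exists_abs_potential_le (hV : MemLp (fun x => japanese x ^ (2 * σ) * V x) ⊤) :
    ∃ C : ℝ, 0 ≤ C ∧ ∀ᵐ x, |V x| ≤ C * japanese x ^ (-(2 * σ)) := by
  obtain ⟨C, hC, h⟩ := ae_bound_of_memLp_top hV
  refine ⟨C, hC, h.mono fun x hx => ?_⟩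
  have hj := japanese_rpow_pos x (2 * σ)
  rw [Real.norm_eq_abs, abs_mul, abs_of_pos hj] at hx
  rwa [Real.rpow_neg (japanese_pos x).le, ← div_eq_mul_inv, le_div_iff₀ hj, mul_comm]

theorem aestronglyMeasurable_potential (hV : MemLp (fun x => japanese x ^ (2 * σ) * V x) ⊤) :
    AEStronglyMeasurable V := by
  refine ((continuous_japanese_rpow (-(2 * σ))).aestronglyMeasurable.mul hV.1).congr
    (Eventually.of_forall fun x => ?_)
  simp only [Pi.mul_apply]
  rw [← mul_assoc, mul_comm (japanese x ^ (-(2 * σ))), japanese_rpow_mul_neg, one_mul]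

theorem memLp_top_potential (hσ : 1 < σ) (hV : MemLp (fun x => japanese x ^ (2 * σ) * V x) ⊤) :
    MemLp V ⊤ := by
  obtain ⟨C, hC, h⟩ := exists_abs_potential_le hV
  refine memLp_top_of_bound (aestronglyMeasurable_potential hV) C (h.mono fun x hx => hx.trans ?_)
  exact mul_le_of_le_one_right hC
    (Real.rpow_le_one_of_one_le_of_nonpos (one_le_japanese x) (by linarith))

theorem memLp_two_potential (hσ : 1 < σ) (hV : MemLp (fun x => japanese x ^ (2 * σ) * V x) ⊤) :
    MemLp V 2 := by
  obtain ⟨C, hC, h⟩ := exists_abs_potential_le hV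
  exact ((memLp_japanese_rpow (r := 2 * σ) (by linarith)).const_mul C).mono'
    (aestronglyMeasurable_potential hV) h

/-- The value at `x` of `⟨x⟩^σ V H₀⁻¹ ⟨x⟩^{-σ} u`. -/
def birmanSchwingerFun (V : R3 → ℝ) (hσ : 1 < σ) (u : L2) (x : R3) : ℂ :=
  ((japanese x ^ σ * V x : ℝ) : ℂ) * evalFreeInverse hσ x u

theorem aestronglyMeasurable_birmanSchwingerFun (hσ : 1 < σ)
    (hV : MemLp (fun x => japanese x ^ (2 * σ) * V x) ⊤) (u : L2) :
    AEStronglyMeasurable (birmanSchwingerFun V hσ u) :=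
  (Complex.continuous_ofReal.comp_aestronglyMeasurable
    ((continuous_japanese_rpow σ).aestronglyMeasurable.mul (aestronglyMeasurable_potential hV))).mul
    (continuous_freeInverse hσ (weightOp_mem _ u)).aestronglyMeasurable

/-- The functions `⟨x⟩^σ V H₀⁻¹ ⟨x⟩^{-σ} u` with `‖u‖ ≤ 1` have a common square integrable
majorant. -/
theorem exists_norm_birmanSchwingerFun_le (hσ : 1 < σ)
    (hV : MemLp (fun x => japanese x ^ (2 * σ) * V x) ⊤) :
    ∃ g : R3 → ℝ, MemLp g 2 ∧ ∀ᵐ x, ∀ u, ‖birmanSchwingerFun V hσ u x‖ ≤ g x * ‖u‖ := by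
  obtain ⟨C, hC, hVC⟩ := exists_abs_potential_le hV
  obtain ⟨D, hD⟩ := exists_norm_freeInverse_weightOp_le hσ
  refine ⟨fun x => C * D * japanese x ^ (-(σ + 1 / 2)),
    (memLp_japanese_rpow (by linarith)).const_mul _, hVC.mono fun x hx u => ?_⟩
  have hj := japanese_rpow_pos x σ
  rw [birmanSchwingerFun, norm_mul, Complex.norm_real, norm_mul, Real.norm_eq_abs,
    Real.norm_eq_abs, abs_of_pos hj]
  have h1 : japanese x ^ (-(σ + 1 / 2)) =
      japanese x ^ σ * japanese x ^ (-(2 * σ)) * japanese x ^ (-(1 / 2) : ℝ) := by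
    rw [← Real.rpow_add (japanese_pos x), ← Real.rpow_add (japanese_pos x)]
    congr 1
    ring
  simp only [h1]
  have := japanese_rpow_pos x (-(2 * σ))
  calc _ ≤ japanese x ^ σ * (C * japanese x ^ (-(2 * σ))) *
        (D * japanese x ^ (-(1 / 2) : ℝ) * ‖u‖) := by
        gcongr
        exact hD u x
    _ = _ := by ring

theorem memLp_birmanSchwingerFun (hσ : 1 < σ)
    (hV : MemLp (fun x => japanese x ^ (2 * σ) * V x) ⊤) (u : L2) :
    MemLp (birmanSchwingerFun V hσ u) 2 := by
  obtain ⟨g, hg, h⟩ := exists_norm_birmanSchwingerFun_le hσ hV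
  exact (hg.mul_const ‖u‖).mono' (aestronglyMeasurable_birmanSchwingerFun hσ hV u)
    (h.mono fun x hx => hx u)

/-- The operator `⟨x⟩^σ V H₀⁻¹ ⟨x⟩^{-σ}` on `L²`, which is unitarily equivalent to `V H₀⁻¹` on
`L²_σ`. -/
def birmanSchwinger (hσ : 1 < σ) (hV : MemLp (fun x => japanese x ^ (2 * σ) * V x) ⊤) :
    L2 →L[ℂ] L2 :=
  LinearMap.mkContinuousOfExistsBound
    { toFun := fun u => toL2 (birmanSchwingerFun V hσ u)
      map_add' := fun u v => by
        refine Lp.ext ?_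
        filter_upwards [toL2_ae (memLp_birmanSchwingerFun hσ hV u),
          toL2_ae (memLp_birmanSchwingerFun hσ hV v),
          toL2_ae (memLp_birmanSchwingerFun hσ hV (u + v)),
          Lp.coeFn_add (toL2 (birmanSchwingerFun V hσ u)) (toL2 (birmanSchwingerFun V hσ v))]
          with x h1 h2 h3 h4
        rw [h4, Pi.add_apply, h1, h2, h3, birmanSchwingerFun, map_add, mul_add]
        rfl
      map_smul' := fun c u => by
        refine Lp.ext ?_
        filter_upwards [toL2_ae (memLp_birmanSchwingerFun hσ hV u),
          toL2_ae (memLp_birmanSchwingerFun hσ hV (c • u)),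
          Lp.coeFn_smul c (toL2 (birmanSchwingerFun V hσ u))]
          with x h1 h2 h3
        rw [RingHom.id_apply, h3, Pi.smul_apply, h1, h2, birmanSchwingerFun, birmanSchwingerFun,
          map_smul, smul_eq_mul, smul_eq_mul]
        ring }
    (by
      obtain ⟨g, hg, h⟩ := exists_norm_birmanSchwingerFun_le hσ hV
      refine ⟨‖toL2 fun x => (g x : ℂ)‖, fun u => ?_⟩
      refine (norm_le_of_ae_le (norm_nonneg u) ?_).trans_eq (mul_comm _ _)
      filter_upwards [h, toL2_ae hg.ofReal, toL2_ae (memLp_birmanSchwingerFun hσ hV u)]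
        with x h1 h2 h3
      refine (le_of_eq (congrArg norm h3)).trans ((h1 u).trans ?_)
      rw [show ‖(toL2 fun x => (g x : ℂ)) x‖ = ‖(g x : ℂ)‖ from congrArg norm h2,
        Complex.norm_real, Real.norm_eq_abs, mul_comm]
      gcongr
      exact le_abs_self _)

theorem birmanSchwinger_ae (hσ : 1 < σ) (hV : MemLp (fun x => japanese x ^ (2 * σ) * V x) ⊤)
    (u : L2) : birmanSchwinger hσ hV u =ᵐ[volume] birmanSchwingerFun V hσ u :=
  toL2_ae (memLp_birmanSchwingerFun hσ hV u)

theorem isCompactOperator_birmanSchwinger (hσ : 1 < σ)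
    (hV : MemLp (fun x => japanese x ^ (2 * σ) * V x) ⊤) :
    IsCompactOperator (birmanSchwinger hσ hV) := by
  obtain ⟨g, hg, h⟩ := exists_norm_birmanSchwingerFun_le hσ hV
  have : Fact ((2 : ℝ≥0∞) ≠ ⊤) := ⟨by norm_num⟩
  have : SecondCountableTopology L2 := Lp.SecondCountableTopology
  refine isCompactOperator_of_weak_to_strong fun u v hu hL => ?_
  have hmaj : ∀ w : L2, ‖w‖ ≤ 1 + ‖v‖ →
      ∀ᵐ x, ‖birmanSchwingerFun V hσ w x‖ ≤ (1 + ‖v‖) * ‖g x‖ := fun w hw =>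
    h.mono fun x hx => (hx w).trans <| calc
      g x * ‖w‖ ≤ ‖g x‖ * ‖w‖ := by gcongr; exact Real.le_norm_self _
      _ ≤ (1 + ‖v‖) * ‖g x‖ := by rw [mul_comm]; gcongr
  exact tendsto_toL2_of_dominated (hg.norm.const_mul (1 + ‖v‖))
    (fun n => aestronglyMeasurable_birmanSchwingerFun hσ hV _)
    (aestronglyMeasurable_birmanSchwingerFun hσ hV _)
    (fun n => hmaj _ ((hu n).trans (le_add_of_nonneg_right (norm_nonneg v))))
    (hmaj v (le_add_of_nonneg_left zero_le_one))
    (Eventually.of_forall fun x => (hL (evalFreeInverse hσ x)).const_mul _)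

theorem onePlusVH₀Inv_weightOp (hσ : 1 < σ)
    (hV : MemLp (fun x => japanese x ^ (2 * σ) * V x) ⊤) (u : L2) :
    onePlusVH₀Inv V (weightOp σ (zero_le_one.trans hσ.le) u) =
      weightOp σ (zero_le_one.trans hσ.le) (u + birmanSchwinger hσ hV u) := by
  have hσ0 := zero_le_one.trans hσ.le
  rw [onePlusVH₀Inv, map_add]
  congr 1
  refine (eq_toL2 ?_).symm
  filter_upwards [mulL2_ae _ (memLp_top_japanese_rpow hσ0) (birmanSchwinger hσ hV u),
    birmanSchwinger_ae hσ hV u] with x h1 h2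
  rw [weightOp, h1, h2, birmanSchwingerFun, evalFreeInverse_apply, ← mul_assoc,
    ← Complex.ofReal_mul, ← mul_assoc, mul_comm (japanese x ^ (-σ)), japanese_rpow_mul_neg, one_mul]
  rfl

/-- The Fredholm alternative: if `1 + V H₀⁻¹` is injective on `L²_σ`, it has a bounded inverse. -/
theorem bijOn_of_injective (hσ : 1 < σ) (hV : MemLp (fun x => japanese x ^ (2 * σ) * V x) ⊤)
    (hinj : ∀ f ∈ weightedL2 σ, onePlusVH₀Inv V f = 0 → f = 0) :
    Set.BijOn (onePlusVH₀Inv V) (weightedL2 σ) (weightedL2 σ) ∧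
    ∃ C : ℝ≥0, ∀ g ∈ weightedL2 σ,
      weightedNorm σ (onePlusVH₀InvInverse V σ g) ≤ C * weightedNorm σ g := by
  have hσ0 := zero_le_one.trans hσ.le
  set K := birmanSchwinger hσ hV
  have hunit : IsUnit (1 + K) := by
    rcases (isCompactOperator_birmanSchwinger hσ hV).hasEigenvalue_or_mem_resolventSet
      (μ := (-1 : ℂ)) (by norm_num) with h | h
    · obtain ⟨u, hu⟩ := h.exists_hasEigenvector
      refine absurd ?_ hu.2
      have h1 : K u = (-1 : ℂ) • u := hu.apply_eq_smul
      refine weightOp_injective hσ0 ?_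
      rw [map_zero]
      refine hinj _ (weightOp_mem hσ0 u) ?_
      rw [onePlusVH₀Inv_weightOp hσ hV]
      change weightOp σ hσ0 (u + K u) = 0
      rw [h1, neg_one_smul, add_neg_cancel, map_zero]
    · rw [spectrum.mem_resolventSet_iff, map_neg, map_one] at h
      have := h.neg
      rwa [neg_sub, sub_neg_eq_add, add_comm] at this
  obtain ⟨T, hT⟩ := hunit
  set S : L2 →L[ℂ] L2 := ↑T⁻¹
  have hTS : ∀ u, S u + K (S u) = u := fun u => by
    have := congrArg (fun A : L2 →L[ℂ] L2 => A u) T.mul_inv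
    rw [hT] at this
    exact this
  have hST : ∀ u, S (u + K u) = u := fun u => by
    have := congrArg (fun A : L2 →L[ℂ] L2 => A u) T.inv_mul
    rw [hT] at this
    exact this
  have hbij : Set.BijOn (onePlusVH₀Inv V) (weightedL2 σ) (weightedL2 σ) := by
    refine ⟨fun f hf => ?_, fun f hf g hg hfg => ?_, fun g hg => ?_⟩
    · obtain ⟨u, rfl⟩ := exists_weightOp_eq hσ0 hf
      rw [onePlusVH₀Inv_weightOp hσ hV]
      exact weightOp_mem hσ0 _
    · obtain ⟨u, rfl⟩ := exists_weightOp_eq hσ0 hf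
      obtain ⟨v, rfl⟩ := exists_weightOp_eq hσ0 hg
      simp only [onePlusVH₀Inv_weightOp hσ hV] at hfg
      have := weightOp_injective hσ0 hfg
      rw [← hST u, ← hST v]
      exact congrArg _ (congrArg S this)
    · obtain ⟨v, rfl⟩ := exists_weightOp_eq hσ0 hg
      refine ⟨weightOp σ hσ0 (S v), weightOp_mem hσ0 _, ?_⟩
      rw [onePlusVH₀Inv_weightOp hσ hV]
      exact congrArg _ (hTS v)
  refine ⟨hbij, ‖S‖₊, fun g hg => ?_⟩
  obtain ⟨v, rfl⟩ := exists_weightOp_eq hσ0 hg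
  have h1 : onePlusVH₀InvInverse V σ (weightOp σ hσ0 v) = weightOp σ hσ0 (S v) := by
    refine hbij.injOn (hbij.surjOn.mapsTo_invFunOn hg) (weightOp_mem hσ0 _) ?_
    rw [onePlusVH₀Inv_weightOp hσ hV]
    exact (hbij.surjOn.rightInvOn_invFunOn hg).trans (congrArg _ (hTS v)).symm
  rw [h1, weightedNorm_weightOp, weightedNorm_weightOp, ← ENNReal.ofReal_coe_nnreal,
    ← ENNReal.ofReal_mul (by positivity), coe_nnnorm]
  exact ENNReal.ofReal_le_ofReal (S.le_opNorm v)

end BirmanSchwinger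

end ScatteringR3

/-! ### Solutions at zero energy -/

namespace ScatteringR3

noncomputable section ZeroEnergy

variable {V : R3 → ℝ} {σ : ℝ}

theorem freeSymbol_mul_fourierInv (φ : 𝓢(R3, ℂ)) (ξ : R3) :
    𝓕⁻ (-Δ φ : 𝓢(R3, ℂ)) ξ = (freeSymbol ξ : ℂ) * 𝓕⁻ φ ξ := by
  have htg : (fun x : R3 => ‖x‖ ^ 2).HasTemperateGrowth := by fun_prop
  have h1 : 𝓕 (-Δ φ : 𝓢(R3, ℂ)) (-ξ) = (freeSymbol ξ : ℂ) * 𝓕 φ (-ξ) := by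
    rw [SchwartzMap.laplacian_eq_fourierMultiplierCLM, SchwartzMap.fourierMultiplierCLM_apply,
      neg_smul, neg_neg, FourierTransform.fourier_smul, FourierTransform.fourier_fourierInv_eq,
      smul_apply, SchwartzMap.smulLeftCLM_apply_apply htg, norm_neg, freeSymbol,
      Complex.real_smul, Complex.real_smul]
    push_cast
    ring
  have h2 : ∀ χ : 𝓢(R3, ℂ), 𝓕⁻ χ ξ = 𝓕 χ (-ξ) := fun χ => by
    rw [SchwartzMap.fourierInv_coe, SchwartzMap.fourier_coe, Real.fourierInv_eq_fourier_neg]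
  rw [h2, h2, h1]

/-- The equation `-Δ(H₀⁻¹ f) = f` in the sense of distributions. -/
theorem integral_freeInverse_mul_neg_laplacian {f : L2}
    (hf : Integrable fun ξ => (1 / (freeSymbol ξ : ℂ)) * (𝓕 f : L2) ξ) (φ : 𝓢(R3, ℂ)) :
    ∫ x, freeInverse f x * (-Δ φ : 𝓢(R3, ℂ)) x = ∫ x, f x * φ x := by
  have h1 : ∫ x, freeInverse f x * (-Δ φ : 𝓢(R3, ℂ)) x = ∫ ξ, 𝓕⁻ φ ξ * (𝓕 f : L2) ξ := by
    rw [freeInverse, integral_mul_fourierInv_eq hf (SchwartzMap.integrable _)]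
    refine integral_congr_ae (ae_freeSymbol_pos.mono fun ξ hξ => ?_)
    have h := freeSymbol_mul_fourierInv φ ξ
    rw [SchwartzMap.fourierInv_coe] at h
    have hξ' : (freeSymbol ξ : ℂ) ≠ 0 := by exact_mod_cast hξ.ne'
    simp only
    rw [h]
    field_simp
  have h2 : ((𝓕 f : L2) : 𝓢'(R3, ℂ)) (𝓕⁻ φ) = (f : 𝓢'(R3, ℂ)) φ := by
    rw [← Lp.fourier_toTemperedDistribution_eq, TemperedDistribution.fourier_apply,
      FourierTransform.fourier_fourierInv_eq]
  rw [Lp.toTemperedDistribution_apply, Lp.toTemperedDistribution_apply] at h2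
  simp only [smul_eq_mul] at h2
  rw [h1, h2]
  exact integral_congr_ae (Eventually.of_forall fun x => mul_comm _ _)

/-- `H₀⁻¹` gains two powers of decay, up to the decay `⟨x⟩^{-1}` of the Newtonian kernel. -/
theorem exists_norm_freeInverse_le_of_decay {f : L2}
    (hf : Integrable fun ξ => (1 / (freeSymbol ξ : ℂ)) * (𝓕 f : L2) ξ) {a b C : ℝ}
    (hfb : ∀ᵐ y, ‖f y‖ ≤ C * japanese y ^ (-b)) (ha : 0 ≤ a) (ha1 : a < 1) (hab : a + 2 < b) :
    ∃ D : ℝ, ∀ x, ‖freeInverse f x‖ ≤ D * japanese x ^ (-a) := by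
  obtain ⟨C₁, h₁⟩ := exists_lintegral_japanese_mul_norm_rpow_le (b := b - a) (c := 1)
    (by linarith) (by norm_num) (by norm_num) (by linarith)
  obtain ⟨C₂, h₂⟩ := exists_lintegral_japanese_mul_norm_rpow_le (b := b) (c := 1 - a)
    (by linarith) (by linarith) (by linarith) (by linarith)
  have hC : 0 ≤ C := by
    obtain ⟨y, hy⟩ := hfb.exists
    exact nonneg_of_mul_nonneg_left ((norm_nonneg _).trans hy) (japanese_rpow_pos y _)
  refine ⟨C * (C₁ + C₂), fun x => ?_⟩
  have hjx := japanese_rpow_pos x a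
  -- distribute `⟨x⟩^a ≤ ⟨y⟩^a + |x - y|^a` over the two factors of the integrand
  have key : ENNReal.ofReal (japanese x ^ a) * riesz f x ≤ ENNReal.ofReal C * (C₁ + C₂) := by
    refine le_trans ?_ (mul_le_mul_right (add_le_add (h₁ x) (h₂ x)) _)
    have hm : Measurable fun y => ENNReal.ofReal (japanese y ^ (-b) * ‖x - y‖ ^ (-(1 - a))) := by
      have := (continuous_japanese_rpow (-b)).measurable
      fun_prop
    rw [← lintegral_add_right _ hm, riesz, ← lintegral_const_mul' _ _ ENNReal.ofReal_ne_top,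
      ← lintegral_const_mul' _ _ ENNReal.ofReal_ne_top]
    refine lintegral_mono_ae (hfb.mono fun y hy => ?_)
    have hj := japanese_pos y
    have hjb := japanese_rpow_pos y (-b)
    rw [← ofReal_norm, ← ENNReal.ofReal_mul (norm_nonneg _), ← ENNReal.ofReal_mul hjx.le,
      ← ENNReal.ofReal_add (mul_nonneg (japanese_rpow_pos y _).le (by positivity))
      (mul_nonneg (japanese_rpow_pos y _).le (by positivity)), ← ENNReal.ofReal_mul hC]
    refine ENNReal.ofReal_le_ofReal ?_
    rcases eq_or_ne x y with rfl | hxy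
    · simp only [sub_self, norm_zero, inv_zero, mul_zero]
      have := japanese_rpow_pos x (-(b - a))
      positivity
    have hz : 0 < ‖x - y‖ := norm_pos_iff.2 (sub_ne_zero.2 hxy)
    have h3 : japanese x ^ a ≤ japanese y ^ a + ‖x - y‖ ^ a :=
      (Real.rpow_le_rpow (japanese_pos x).le (japanese_le_add x y) ha).trans
        (Real.rpow_add_le_add_rpow hj.le hz.le ha ha1.le)
    have h4 : japanese y ^ (-(b - a)) = japanese y ^ (-b) * japanese y ^ a := by
      rw [← Real.rpow_add hj]
      ring_nf
    have h5 : ‖x - y‖ ^ (-(1 - a)) = ‖x - y‖ ^ a * ‖x - y‖⁻¹ := by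
      rw [← Real.rpow_neg_one, ← Real.rpow_add hz]
      ring_nf
    rw [h4, h5, Real.rpow_neg_one]
    calc _ ≤ (japanese y ^ a + ‖x - y‖ ^ a) * (C * japanese y ^ (-b) * ‖x - y‖⁻¹) := by gcongr
      _ = _ := by ring
  have h6 : ENNReal.ofReal (japanese x ^ a * ‖freeInverse f x‖) ≤
      ENNReal.ofReal (C * (C₁ + C₂)) := by
    rw [ENNReal.ofReal_mul hjx.le, ofReal_norm, ENNReal.ofReal_mul hC,
      ENNReal.ofReal_add C₁.coe_nonneg C₂.coe_nonneg, ENNReal.ofReal_coe_nnreal,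
      ENNReal.ofReal_coe_nnreal]
    exact (mul_le_mul_right (enorm_freeInverse_le hf x) _).trans key
  have h7 := (ENNReal.ofReal_le_ofReal_iff (by positivity)).1 h6
  rw [Real.rpow_neg (japanese_pos x).le, ← div_eq_mul_inv, le_div_iff₀ hjx, mul_comm]
  exact h7

/-- Bootstrap: a solution of `f + V H₀⁻¹ f = 0` in `L²_σ` is such that `H₀⁻¹ f` decays faster than
any power `⟨x⟩^{-a}` with `a < 1`. -/
theorem exists_norm_freeInverse_le_of_zero (hσ : 1 < σ)
    (hV : MemLp (fun x => japanese x ^ (2 * σ) * V x) ⊤) {f : L2} (hf : f ∈ weightedL2 σ)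
    (h0 : ∀ᵐ x, f x = -(V x * freeInverse f x)) {a : ℝ} (ha : 0 ≤ a) (ha1 : a < 1) :
    ∃ D : ℝ, ∀ x, ‖freeInverse f x‖ ≤ D * japanese x ^ (-a) := by
  have hint := integrable_inv_freeSymbol_mul hσ hf
  -- each step gains the factor `⟨x⟩^{-(σ - 1)}`
  have hind : ∀ n : ℕ, ∀ a : ℝ, 0 ≤ a → a < 1 → a ≤ 1 / 2 + n * (σ - 1) →
      ∃ D : ℝ, ∀ x, ‖freeInverse f x‖ ≤ D * japanese x ^ (-a) := by
    intro n
    induction n with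
    | zero =>
      intro a ha ha1 han
      obtain ⟨u, rfl⟩ := exists_weightOp_eq (zero_le_one.trans hσ.le) hf
      obtain ⟨C, hC⟩ := exists_norm_freeInverse_weightOp_le hσ
      refine ⟨C * ‖u‖, fun x => (hC u x).trans ?_⟩
      rw [mul_right_comm]
      gcongr
      · exact one_le_japanese x
      · simpa using han
    | succ n ih =>
      intro a ha ha1 han
      push_cast at han
      obtain ⟨D, hD⟩ := ih (max (a - (σ - 1)) 0) (le_max_right _ _)
        (max_lt (by linarith) one_pos) (max_le (by linarith) (by
          have : 0 ≤ (n : ℝ) * (σ - 1) := mul_nonneg n.cast_nonneg (by linarith)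
          linarith))
      obtain ⟨C, hC, hVC⟩ := exists_abs_potential_le hV
      refine exists_norm_freeInverse_le_of_decay hint (C := C * D)
        (b := 2 * σ + max (a - (σ - 1)) 0) ?_ ha ha1
        (by linarith [le_max_left (a - (σ - 1)) 0])
      filter_upwards [h0, hVC] with x h1 h2
      rw [h1, norm_neg, norm_mul, Complex.norm_real, Real.norm_eq_abs, neg_add,
        Real.rpow_add (japanese_pos x)]
      have := japanese_rpow_pos x (-(2 * σ))
      calc _ ≤ (C * japanese x ^ (-(2 * σ))) * (D * japanese x ^ (-max (a - (σ - 1)) 0)) := by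
            gcongr
            exact hD x
        _ = _ := by ring
  obtain ⟨n, hn⟩ := exists_nat_ge (1 / (σ - 1))
  refine hind n a ha ha1 ?_
  rw [div_le_iff₀ (by linarith)] at hn
  linarith

/-- If zero is neither an eigenvalue nor a resonance, then `1 + V H₀⁻¹` is injective on `L²_σ`. -/
theorem eq_zero_of_onePlusVH₀Inv_eq_zero (hσ : 1 < σ)
    (hV : MemLp (fun x => japanese x ^ (2 * σ) * V x) ⊤) (heig : ¬ ZeroIsEigenvalue V)
    (hres : ¬ ZeroIsResonance V) {f : L2} (hf : f ∈ weightedL2 σ)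
    (h : onePlusVH₀Inv V f = 0) : f = 0 := by
  have hint := integrable_inv_freeSymbol_mul hσ hf
  have hVm := aestronglyMeasurable_potential hV
  have hVtop := memLp_top_potential hσ hV
  set ψ := freeInverse f with hψ
  have hψc : Continuous ψ := continuous_freeInverse hσ hf
  have hB : ∀ x, ‖ψ x‖ ≤ _ := norm_fourierInv_le _
  have hψtop : MemLp ψ ⊤ :=
    memLp_top_of_bound hψc.aestronglyMeasurable _ (Eventually.of_forall hB)
  have hVψ : MemLp (fun x => (V x : ℂ) * ψ x) 2 := by
    have h1 := memLp_mul_of_memLp_top hψtop (memLp_two_potential hσ hV).ofReal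
    exact (memLp_congr_ae (Eventually.of_forall fun x => mul_comm _ _)).1 h1
  have h0 : ∀ᵐ x, f x = -(V x * ψ x) := by
    have h1 : f = -potentialMul V ψ := eq_neg_of_add_eq_zero_left h
    have h2 : (f : R3 → ℂ) =ᵐ[volume] -(potentialMul V ψ : L2) := by
      rw [h1]
      exact Lp.coeFn_neg _
    filter_upwards [h2, toL2_ae hVψ] with x h3 h4
    rw [h3, Pi.neg_apply]
    exact congrArg _ h4
  have heq : ∀ φ : 𝓢(R3, ℂ), ∫ x, ψ x * (-Δ φ : 𝓢(R3, ℂ)) x = -∫ x, V x * ψ x * φ x := by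
    intro φ
    rw [integral_freeInverse_mul_neg_laplacian hint, ← integral_neg]
    exact integral_congr_ae (h0.mono fun x hx => by simp only [hx, neg_mul])
  by_cases hL2 : MemLp ψ 2
  · have hpair : IsEigenpair V 0 (toL2 ψ) := by
      rw [IsEigenpair, HamiltonianGraph]
      ext φ
      have h1 : (-Δ ((toL2 ψ : L2) : 𝓢'(R3, ℂ))) φ = ∫ x, ψ x * (-Δ φ : 𝓢(R3, ℂ)) x := by
        rw [neg_apply, TemperedDistribution.laplacian_apply_apply, ← map_neg,
          Lp.toTemperedDistribution_apply]
        refine integral_congr_ae ((toL2_ae hL2).mono fun x hx => ?_)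
        simp only [hx, smul_eq_mul, mul_comm]
      have h2 : (potentialMul V (toL2 ψ) : 𝓢'(R3, ℂ)) φ = ∫ x, V x * ψ x * φ x := by
        rw [Lp.toTemperedDistribution_apply, potentialMul_eq hVtop]
        refine integral_congr_ae ?_
        filter_upwards [mulL2_ae _ hVtop.ofReal (toL2 ψ), toL2_ae hL2] with x h3 h4
        have h5 : potentialOp V hVtop (toL2 ψ) x = V x * ψ x := h3.trans (by rw [h4]; rfl)
        rw [h5, smul_eq_mul, mul_comm]
      rw [add_apply, h1, h2, heq, neg_add_cancel, Complex.ofReal_zero,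
        zero_smul, Lp.toTemperedDistribution_apply]
      refine (integral_eq_zero_of_ae ?_).symm
      filter_upwards [Lp.coeFn_zero ℂ 2 (volume : Measure R3)] with x h5
      rw [h5]
      simp
    have h2 : toL2 ψ = 0 := by
      by_contra hne
      exact heig ⟨_, hne, hpair⟩
    refine Lp.ext ?_
    filter_upwards [h0, toL2_ae hL2, Lp.coeFn_zero ℂ 2 (volume : Measure R3)] with x h3 h4 h5
    rw [h2, h5] at h4
    rw [h3, ← h4, h5]
    simp
  · refine absurd ⟨ψ, fun s hs => ?_, hL2, fun φ hφ hφc => ?_⟩ hres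
    · -- an exponent in `(3/2 - s, 1)`, so that `⟨x⟩^{-s} ψ` is square integrable
      obtain ⟨D, hD⟩ := exists_norm_freeInverse_le_of_zero hσ hV hf h0
        (a := max (5 / 4 - s / 2) 0) (le_max_right _ _) (max_lt (by linarith) one_pos)
      refine ((memLp_japanese_rpow (r := s + max (5 / 4 - s / 2) 0) ?_).const_mul D).mono'
        ((Complex.continuous_ofReal.comp
          (continuous_japanese_rpow (-s))).mul hψc).aestronglyMeasurable
        (Eventually.of_forall fun x => ?_)
      · linarith [le_max_left (5 / 4 - s / 2) 0]
      · have hj := japanese_rpow_pos x (-s)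
        rw [norm_mul, Complex.norm_of_nonneg hj.le, neg_add, Real.rpow_add (japanese_pos x),
          mul_left_comm]
        gcongr
        exact hD x
    · set Φ : 𝓢(R3, ℂ) := hφc.toSchwartzMap hφ
      have h1 := heq Φ
      have hi1 : Integrable fun x => ψ x * (-Δ Φ : 𝓢(R3, ℂ)) x :=
        (SchwartzMap.integrable _).bdd_mul hψc.aestronglyMeasurable (Eventually.of_forall hB)
      have hi2 : Integrable fun x => V x * ψ x * Φ x := hVψ.integrable_mul (Φ.memLp 2)
      rw [← eq_neg_iff_add_eq_zero.1 h1, ← integral_add hi1 hi2]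
      refine integral_congr_ae (Eventually.of_forall fun x => ?_)
      have h2 : (-Δ Φ : 𝓢(R3, ℂ)) x = -(Δ φ) x := by
        rw [neg_apply, SchwartzMap.laplacian_apply]
        rfl
      have h3 : Φ x = φ x := rfl
      simp only [h2, h3]
      ring

end ZeroEnergy

end ScatteringR3

/-! ### Eigenvectors and the adjoint of the wave operator -/

namespace ScatteringR3

noncomputable section Eigenvectors

variable {V : R3 → ℝ} {U : ℝ → L2 →L[ℂ] L2}

theorem isUnitaryGroup_of_isUnitaryGroupOf (hU : IsUnitaryGroupOf V U) : IsUnitaryGroup U where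
  map_zero f := by rw [hU.map_zero]; rfl
  map_add s t f := by rw [hU.map_add]; rfl
  norm_map := hU.norm_map
  continuous := hU.continuous

/-- Eigenvectors of `H` evolve by a phase. -/
theorem apply_eigenvector (hU : IsUnitaryGroupOf V U) {E : ℝ} {ψ : L2} (hψ : IsEigenpair V E ψ)
    (t : ℝ) : U t ψ = Complex.exp (-Complex.I * E * t) • ψ := by
  have hG := isUnitaryGroup_of_isUnitaryGroupOf hU
  have h1 := hG.hasDerivAt_of_zero ((hU.generator _ _).1 hψ)
  have h2 : ∀ s : ℝ, HasDerivAt (fun s : ℝ => Complex.exp (Complex.I * E * s))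
      (Complex.exp (Complex.I * E * s) * (Complex.I * E)) s := fun s => by
    have := ((Complex.ofRealCLM.hasDerivAt (x := s)).const_mul (Complex.I * E)).cexp
    simpa using this
  have h3 : ∀ s : ℝ, HasDerivAt (fun s : ℝ => Complex.exp (Complex.I * E * s) • U s ψ) 0 s := by
    intro s
    refine ((h2 s).smul (h1 s)).congr_deriv ?_
    rw [map_smul, map_smul, smul_smul, smul_smul, ← add_smul]
    convert zero_smul ℂ (U s ψ) using 2
    ring
  have h4 := is_const_of_deriv_eq_zero (fun s => (h3 s).differentiableAt)
    (fun s => (h3 s).deriv) t 0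
  simp only [Complex.ofReal_zero, mul_zero, Complex.exp_zero, one_smul, hG.map_zero] at h4
  calc U t ψ = Complex.exp (-Complex.I * E * t) • (Complex.exp (Complex.I * E * t) • U t ψ) := by
        rw [smul_smul, ← Complex.exp_add]
        simp
    _ = _ := by rw [h4]

/-- The range of the wave operator is orthogonal to all eigenvectors, since the free evolution
tends weakly to zero. -/
theorem inner_eigenvector_wave (hU : IsUnitaryGroupOf V U) {Ω : L2 →L[ℂ] L2} {l : Filter ℝ}
    [l.NeBot] (hl : l ≤ cocompact ℝ)
    (hΩ : ∀ x, Tendsto (fun t => U (-t) (freeGroup t x)) l (𝓝 (Ω x))) {E : ℝ} {ψ : L2}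
    (hψ : IsEigenpair V E ψ) (φ : L2) : inner ℂ ψ (Ω φ) = 0 := by
  have hG := isUnitaryGroup_of_isUnitaryGroupOf hU
  have h1 : Tendsto (fun t => inner ℂ ψ (U (-t) (freeGroup t φ))) l (𝓝 (inner ℂ ψ (Ω φ))) :=
    tendsto_const_nhds.inner (hΩ φ)
  refine tendsto_nhds_unique h1 (tendsto_zero_iff_norm_tendsto_zero.2 ?_)
  have h2 := ((tendsto_inner_freeGroup ψ φ).mono_left hl).norm
  rw [norm_zero] at h2
  refine h2.congr fun t => ?_
  rw [← hG.inner_apply_left, apply_eigenvector hU hψ, inner_smul_left, norm_mul, RCLike.norm_conj,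
    show -Complex.I * E * t = ((-(E * t) : ℝ) : ℂ) * Complex.I by push_cast; ring,
    Complex.norm_exp_ofReal_mul_I, one_mul]

theorem adjoint_wave_continuousProjection (hU : IsUnitaryGroupOf V U) {Ω : L2 →L[ℂ] L2}
    {l : Filter ℝ} [l.NeBot] (hl : l ≤ cocompact ℝ)
    (hΩ : ∀ x, Tendsto (fun t => U (-t) (freeGroup t x)) l (𝓝 (Ω x))) (ψ : L2) :
    ContinuousLinearMap.adjoint Ω (continuousProjection V ψ) = ContinuousLinearMap.adjoint Ω ψ := by
  refine ext_inner_left ℂ fun φ => ?_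
  rw [ContinuousLinearMap.adjoint_inner_right, ContinuousLinearMap.adjoint_inner_right,
    continuousProjection, ← Submodule.inner_starProjection_left_eq_right]
  congr 1
  rw [Submodule.starProjection_eq_self_iff]
  refine (Submodule.mem_orthogonal _ _).2 fun u hu => ?_
  induction hu using Submodule.span_induction with
  | mem x hx =>
    obtain ⟨E, hE⟩ := hx
    exact inner_eigenvector_wave hU hl hΩ hE φ
  | zero => exact inner_zero_left _
  | add x y _ _ hx hy => rw [inner_add_left, hx, hy, add_zero]
  | smul c x _ hx => rw [inner_smul_left, hx, mul_zero]

/-- The adjoint of the wave operator is the weak limit of `e^{itH₀} e^{-itH} P_c`. -/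
theorem tendsto_inner_continuousProjection (hU : IsUnitaryGroupOf V U) {Ω : L2 →L[ℂ] L2}
    {l : Filter ℝ} [l.NeBot] (hl : l ≤ cocompact ℝ)
    (hΩ : ∀ x, Tendsto (fun t => U (-t) (freeGroup t x)) l (𝓝 (Ω x))) (φ ψ : L2) :
    Tendsto (fun t => inner ℂ φ (freeGroup (-t) (U t (continuousProjection V ψ)))) l
      (𝓝 (inner ℂ φ (ContinuousLinearMap.adjoint Ω ψ))) := by
  have hG := isUnitaryGroup_of_isUnitaryGroupOf hU
  rw [← adjoint_wave_continuousProjection hU hl hΩ, ContinuousLinearMap.adjoint_inner_right]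
  have h1 : Tendsto (fun t => inner ℂ (U (-t) (freeGroup t φ)) (continuousProjection V ψ)) l
      (𝓝 (inner ℂ (Ω φ) (continuousProjection V ψ))) := (hΩ φ).inner tendsto_const_nhds
  refine h1.congr fun t => ?_
  rw [hG.inner_apply_left, neg_neg, isUnitaryGroup_freeGroup.inner_apply_left]

end Eigenvectors

/-! ### The evolution of `V (e^{-itH₀} / H₀) f` -/

noncomputable section Evolution

variable {V : R3 → ℝ} {σ : ℝ}

theorem integrable_phase_mul {t : ℝ} {h : R3 → ℂ} (hh : Integrable h) :
    Integrable fun ξ => phase t ξ * h ξ :=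
  hh.bdd_mul (continuous_phase t).aestronglyMeasurable (Eventually.of_forall fun ξ =>
    (norm_phase t ξ).le)

theorem freePropagatorDivH₀_eq (t : ℝ) (f : L2) :
    freePropagatorDivH₀ t f =
      𝓕⁻ (fun ξ => phase t ξ * ((1 / (freeSymbol ξ : ℂ)) * (𝓕 f : L2) ξ)) := by
  unfold freePropagatorDivH₀ phase
  congr 1
  ext ξ
  ring

/-- The multiplier `(e^{-itλ} - 1) / λ`, which is bounded. -/
def phaseQuot (t : ℝ) (ξ : R3) : ℂ := (phase t ξ - 1) * (1 / (freeSymbol ξ : ℂ))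

theorem norm_phaseQuot_sub_le (s t : ℝ) (ξ : R3) : ‖phaseQuot s ξ - phaseQuot t ξ‖ ≤ |s - t| := by
  have h1 : phaseQuot s ξ - phaseQuot t ξ =
      phase t ξ * (phase (s - t) ξ - 1) * (1 / (freeSymbol ξ : ℂ)) := by
    have := phase_add t (s - t) ξ
    rw [add_sub_cancel] at this
    rw [phaseQuot, phaseQuot, this]
    ring
  have h2 := norm_phase_sub_one_le (s - t) ξ
  rw [h1, norm_mul, norm_mul, norm_phase, one_mul, norm_div, norm_one,
    Complex.norm_of_nonneg (freeSymbol_nonneg ξ)]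
  rcases eq_or_lt_of_le (freeSymbol_nonneg ξ) with h0 | h0
  · simp [← h0]
  · rw [mul_one_div, div_le_iff₀ h0]
    exact h2

theorem memLp_top_phaseQuot (t : ℝ) : MemLp (phaseQuot t) ⊤ := by
  have := (continuous_phase t).measurable
  have := continuous_freeSymbol.measurable
  refine memLp_top_of_bound (Measurable.aestronglyMeasurable ?_) |t|
    (Eventually.of_forall fun ξ => ?_)
  · unfold phaseQuot
    fun_prop
  · have := norm_phaseQuot_sub_le t 0 ξ
    simpa [phaseQuot, phase_zero] using this

/-- The operator `(e^{-itH₀} - 1) / H₀` on `L²`. -/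
def phaseQuotOp (t : ℝ) (f : L2) : L2 := 𝓕⁻ (mulL2 (phaseQuot t) (memLp_top_phaseQuot t) (𝓕 f))

theorem hasDerivAt_phaseQuotOp (f : L2) (t : ℝ) :
    HasDerivAt (fun s => phaseQuotOp s f) (-Complex.I • freeGroup t f) t := by
  have hmain : HasDerivAt (fun s => mulL2 (phaseQuot s) (memLp_top_phaseQuot s) (𝓕 f : L2))
      (-Complex.I • mulL2 (phase t) (memLp_phase t) (𝓕 f : L2)) t := by
    rw [hasDerivAt_iff_tendsto_slope]
    have h1 : -Complex.I • mulL2 (phase t) (memLp_phase t) (𝓕 f : L2) =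
        toL2 fun ξ => -Complex.I * (phase t ξ * (𝓕 f : L2) ξ) := by
      refine eq_toL2 ?_
      filter_upwards [Lp.coeFn_smul (-Complex.I) (mulL2 (phase t) (memLp_phase t) (𝓕 f : L2)),
        mulL2_ae (phase t) (memLp_phase t) (𝓕 f : L2)] with ξ h2 h3
      rw [h2, Pi.smul_apply, h3, smul_eq_mul]
    have h2 : ∀ s, slope (fun s => mulL2 (phaseQuot s) (memLp_top_phaseQuot s) (𝓕 f : L2)) t s =
        toL2 fun ξ => ((s - t : ℝ) : ℂ)⁻¹ * (phaseQuot s ξ - phaseQuot t ξ) * (𝓕 f : L2) ξ := by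
      intro s
      refine eq_toL2 ?_
      have h3 : slope (fun s => mulL2 (phaseQuot s) (memLp_top_phaseQuot s) (𝓕 f : L2)) t s =
          ((s - t : ℝ) : ℂ)⁻¹ • (mulL2 (phaseQuot s) (memLp_top_phaseQuot s) (𝓕 f : L2) -
            mulL2 (phaseQuot t) (memLp_top_phaseQuot t) (𝓕 f : L2)) := by
        rw [slope_def_module, ← Complex.ofReal_inv, ← algebraMap_smul ℂ (s - t)⁻¹,
          Complex.coe_algebraMap]
      rw [h3]
      filter_upwards [Lp.coeFn_smul ((s - t : ℝ) : ℂ)⁻¹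
          (mulL2 (phaseQuot s) (memLp_top_phaseQuot s) (𝓕 f : L2) -
            mulL2 (phaseQuot t) (memLp_top_phaseQuot t) (𝓕 f : L2)),
        Lp.coeFn_sub (mulL2 (phaseQuot s) (memLp_top_phaseQuot s) (𝓕 f : L2))
          (mulL2 (phaseQuot t) (memLp_top_phaseQuot t) (𝓕 f : L2)),
        mulL2_ae (phaseQuot s) (memLp_top_phaseQuot s) (𝓕 f : L2),
        mulL2_ae (phaseQuot t) (memLp_top_phaseQuot t) (𝓕 f : L2)] with ξ h4 h5 h6 h7
      rw [h4, Pi.smul_apply, h5, Pi.sub_apply, h6, h7, smul_eq_mul]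
      ring
    rw [h1]
    refine Tendsto.congr (fun s => (h2 s).symm) ?_
    refine tendsto_toL2_of_dominated (g := fun ξ => ‖(𝓕 f : L2) ξ‖) (Lp.memLp _).norm
      (fun s => ?_) ?_ (fun s => Eventually.of_forall fun ξ => ?_)
      (Eventually.of_forall fun ξ => ?_) (ae_freeSymbol_pos.mono fun ξ hξ => ?_)
    · exact (((memLp_top_phaseQuot s).1.sub (memLp_top_phaseQuot t).1).const_mul _).mul
        (Lp.aestronglyMeasurable _)
    · exact ((continuous_phase t).aestronglyMeasurable.mul (Lp.aestronglyMeasurable _)).const_mul _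
    · rw [norm_mul, norm_mul, norm_inv, Complex.norm_real, Real.norm_eq_abs]
      refine mul_le_of_le_one_left (norm_nonneg _) ?_
      rcases eq_or_ne s t with rfl | hst
      · simp
      · rw [inv_mul_le_iff₀ (abs_pos.2 (sub_ne_zero.2 hst)), mul_one]
        exact norm_phaseQuot_sub_le s t ξ
    · simp [norm_phase]
    · have h3 := hasDerivAt_iff_tendsto_slope.1
        (((hasDerivAt_phase ξ t).sub_const 1).mul_const (1 / (freeSymbol ξ : ℂ)))
      have h4 := h3.mul_const ((𝓕 f : L2) ξ)
      have hξ' : (freeSymbol ξ : ℂ) ≠ 0 := by exact_mod_cast hξ.ne'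
      convert h4 using 1
      · ext s
        rw [slope_def_module, Complex.real_smul, Complex.ofReal_inv]
        rfl
      · congr 1
        field_simp
  have h := (((Lp.fourierTransformₗᵢ R3 ℂ).symm.toContinuousLinearEquiv :
    L2 →L[ℂ] L2).restrictScalars ℝ).hasFDerivAt.comp_hasDerivAt t hmain
  refine h.congr_deriv ?_
  exact (Lp.fourierTransformₗᵢ R3 ℂ).symm.map_smul _ _

theorem norm_freePropagatorDivH₀_le (t : ℝ) (f : L2) (x : R3) :
    ‖freePropagatorDivH₀ t f x‖ ≤ ∫ ξ, ‖(1 / (freeSymbol ξ : ℂ)) * (𝓕 f : L2) ξ‖ := by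
  rw [freePropagatorDivH₀_eq]
  refine (norm_fourierInv_le _ _).trans (le_of_eq ?_)
  simp only [norm_mul (phase t _), norm_phase, one_mul]

theorem memLp_potential_mul_freePropagatorDivH₀ (hσ : 1 < σ)
    (hV : MemLp (fun x => japanese x ^ (2 * σ) * V x) ⊤) {f : L2} (hf : f ∈ weightedL2 σ) (t : ℝ) :
    MemLp (fun x => (V x : ℂ) * freePropagatorDivH₀ t f x) 2 := by
  have hint := integrable_inv_freeSymbol_mul hσ hf
  have h1 : MemLp (freePropagatorDivH₀ t f) ⊤ := by
    refine memLp_top_of_bound ?_ _ (Eventually.of_forall (norm_freePropagatorDivH₀_le t f))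
    rw [freePropagatorDivH₀_eq]
    exact (continuous_fourierInv (integrable_phase_mul hint)).aestronglyMeasurable
  have h2 := memLp_mul_of_memLp_top h1 (memLp_two_potential hσ hV).ofReal
  exact (memLp_congr_ae (Eventually.of_forall fun x => mul_comm _ _)).1 h2

/-- Although `(e^{-itH₀} / H₀) f` is not in `L²`, its change in time is. -/
theorem potentialMul_freePropagatorDivH₀ (hσ : 1 < σ)
    (hV : MemLp (fun x => japanese x ^ (2 * σ) * V x) ⊤) {f : L2} (hf : f ∈ weightedL2 σ) (t : ℝ) :
    potentialMul V (freePropagatorDivH₀ t f) = potentialMul V (freePropagatorDivH₀ 0 f) +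
      potentialOp V (memLp_top_potential hσ hV) (phaseQuotOp t f) := by
  have hint := integrable_inv_freeSymbol_mul hσ hf
  set u : R3 → ℂ := fun ξ => phaseQuot t ξ * (𝓕 f : L2) ξ with hu
  have hu2 : MemLp u 2 := memLp_mul_of_memLp_top (memLp_top_phaseQuot t) (Lp.memLp _)
  have hu_eq : u = fun ξ => phase t ξ * ((1 / (freeSymbol ξ : ℂ)) * (𝓕 f : L2) ξ) -
      (1 / (freeSymbol ξ : ℂ)) * (𝓕 f : L2) ξ := by
    ext ξ
    simp only [hu, phaseQuot]
    ring
  have hu1 : Integrable u := by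
    rw [hu_eq]
    exact (integrable_phase_mul hint).sub hint
  have hsum : ∀ x, freePropagatorDivH₀ t f x = freePropagatorDivH₀ 0 f x + 𝓕⁻ u x := by
    intro x
    rw [freePropagatorDivH₀_eq, freePropagatorDivH₀_eq,
      ← fourierInv_add_apply (integrable_phase_mul hint) hu1]
    refine fourierInv_congr_ae (Eventually.of_forall fun ξ => ?_) x
    simp only [hu_eq, phase_zero]
    ring
  refine Lp.ext ?_
  filter_upwards [toL2_ae (memLp_potential_mul_freePropagatorDivH₀ hσ hV hf t),
    toL2_ae (memLp_potential_mul_freePropagatorDivH₀ hσ hV hf 0),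
    mulL2_ae _ (memLp_top_potential hσ hV).ofReal (phaseQuotOp t f),
    Lp.coeFn_add (potentialMul V (freePropagatorDivH₀ 0 f))
      (potentialOp V (memLp_top_potential hσ hV) (phaseQuotOp t f)),
    fourierInv_toL2_ae hu1 hu2] with x h1 h2 h3 h4 h5
  have h6 : potentialOp V (memLp_top_potential hσ hV) (phaseQuotOp t f) x = V x * 𝓕⁻ u x :=
    h3.trans (congrArg _ h5)
  have h7 : potentialMul V (freePropagatorDivH₀ 0 f) x = V x * freePropagatorDivH₀ 0 f x := h2
  rw [h4, Pi.add_apply, h6, h7, ← mul_add, ← hsum]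
  exact h1

theorem hasDerivAt_potentialMul_freePropagatorDivH₀ (hσ : 1 < σ)
    (hV : MemLp (fun x => japanese x ^ (2 * σ) * V x) ⊤) {f : L2} (hf : f ∈ weightedL2 σ) (t : ℝ) :
    HasDerivAt (fun s => potentialMul V (freePropagatorDivH₀ s f))
      (-Complex.I • potentialOp V (memLp_top_potential hσ hV) (freeGroup t f)) t := by
  have h := ((potentialOp V (memLp_top_potential hσ hV)).restrictScalars
    ℝ).hasFDerivAt.comp_hasDerivAt t (hasDerivAt_phaseQuotOp f t)
  have h1 := h.const_add (potentialMul V (freePropagatorDivH₀ 0 f))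
  refine (h1.congr_deriv ?_).congr_of_eventuallyEq (Eventually.of_forall fun s => ?_)
  · exact map_smul (potentialOp V (memLp_top_potential hσ hV)) _ _
  · exact potentialMul_freePropagatorDivH₀ hσ hV hf s

/-- By the Riemann–Lebesgue lemma `(e^{-itH₀} / H₀) f` tends to zero pointwise, and it is
bounded. -/
theorem tendsto_potentialMul_freePropagatorDivH₀ (hσ : 1 < σ)
    (hV : MemLp (fun x => japanese x ^ (2 * σ) * V x) ⊤) {f : L2} (hf : f ∈ weightedL2 σ)
    {l : Filter ℝ} [l.IsCountablyGenerated] (hl : l ≤ cocompact ℝ) :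
    Tendsto (fun t => potentialMul V (freePropagatorDivH₀ t f)) l (𝓝 0) := by
  have hint := integrable_inv_freeSymbol_mul hσ hf
  have h0 : (0 : L2) = toL2 fun _ => 0 := eq_toL2 (Lp.coeFn_zero _ _ _)
  rw [h0]
  refine tendsto_toL2_of_dominated
    (g := fun x => ‖V x‖ * ∫ ξ, ‖(1 / (freeSymbol ξ : ℂ)) * (𝓕 f : L2) ξ‖)
    ((memLp_two_potential hσ hV).norm.mul_const _)
    (fun t => (memLp_potential_mul_freePropagatorDivH₀ hσ hV hf t).1) aestronglyMeasurable_const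
    (fun t => Eventually.of_forall fun x => ?_) (Eventually.of_forall fun x => ?_)
    (Eventually.of_forall fun x => ?_)
  · rw [norm_mul, Complex.norm_real]
    gcongr
    exact norm_freePropagatorDivH₀_le t f x
  · rw [norm_zero]
    positivity
  · have h1 : Tendsto (fun t => freePropagatorDivH₀ t f x) l (𝓝 0) := by
      have h2 := (Real.fourierIntegral_convergent_iff (-x)).2 hint
      simp only [inner_neg_right, neg_neg] at h2
      refine ((tendsto_integral_phase h2).mono_left hl).congr fun t => ?_
      rw [freePropagatorDivH₀_eq, Real.fourierInv_eq]
      refine integral_congr_ae (Eventually.of_forall fun ξ => ?_)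
      simp only [mul_smul_comm]
    simpa using h1.const_mul (V x : ℂ)

end Evolution

end ScatteringR3

/-! ### The time integral -/

namespace ScatteringR3

noncomputable section TimeIntegral

variable {V : R3 → ℝ} {σ : ℝ}

/-- The complex conjugate of a Schwartz function. -/
def conjSchwartz (φ : 𝓢(R3, ℂ)) : 𝓢(R3, ℂ) :=
  φ.postcompCLM (Complex.conjCLE : ℂ →L[ℝ] ℂ)

theorem conjSchwartz_apply (φ : 𝓢(R3, ℂ)) (x : R3) :
    conjSchwartz φ x = (starRingEnd ℂ) (φ x) := rfl

theorem neg_laplacian_conjSchwartz (φ : 𝓢(R3, ℂ)) :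
    -Δ (conjSchwartz φ) = conjSchwartz (-Δ φ) := by
  ext x
  have h : Δ (conjSchwartz φ : R3 → ℂ) = Complex.conjCLE ∘ Δ (φ : R3 → ℂ) :=
    InnerProductSpace.laplacian_CLE_comp_left (l := Complex.conjCLE)
  rw [neg_apply, SchwartzMap.laplacian_apply, h, conjSchwartz_apply, neg_apply,
    SchwartzMap.laplacian_apply, map_neg]
  rfl

theorem toTemperedDistribution_eq_inner (f : L2) (φ : 𝓢(R3, ℂ)) :
    (f : 𝓢'(R3, ℂ)) φ = inner ℂ ((conjSchwartz φ).toLp 2) f := by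
  rw [Lp.toTemperedDistribution_apply, inner_eq_integral]
  refine integral_congr_ae (((conjSchwartz φ).coeFn_toLp 2 volume).mono fun x hx => ?_)
  simp only [hx, conjSchwartz_apply, smul_eq_mul, Complex.conj_conj]

theorem neg_laplacian_apply_eq_inner (f : L2) (φ : 𝓢(R3, ℂ)) :
    (-Δ (f : 𝓢'(R3, ℂ))) φ = inner ℂ ((-Δ (conjSchwartz φ)).toLp 2) f := by
  rw [neg_apply, TemperedDistribution.laplacian_apply_apply, ← map_neg,
    toTemperedDistribution_eq_inner, neg_laplacian_conjSchwartz]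

theorem hasDerivAt_freeGroup_schwartz (φ : 𝓢(R3, ℂ)) :
    HasDerivAt (fun t => freeGroup t (φ.toLp 2 volume)) (-Complex.I • (-Δ φ).toLp 2 volume) 0 := by
  rw [hasDerivAt_freeGroup_iff, Lp.toTemperedDistribution_toLp_eq,
    Lp.toTemperedDistribution_toLp_eq, TemperedDistribution.laplacian_toTemperedDistributionCLM_eq,
    map_neg]

/-- The integrand is the derivative of an `L²`-valued curve. Tested against a Schwartz function,
`H₀ e^{itH₀} Ω^*` becomes the derivative of `Ω e^{-itH₀} φ̄ = e^{-itH} Ω φ̄`, and an integration by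
parts moves this derivative onto `V (e^{-itH₀} / H₀) f`, where it cancels the factor `H₀⁻¹`. -/
theorem isDistributionIntegral_integrand (hσ : 1 < σ)
    (hV : MemLp (fun x => japanese x ^ (2 * σ) * V x) ⊤) {U : ℝ → L2 →L[ℂ] L2}
    (hU : IsUnitaryGroup.IsPerturbation freeGroup (potentialOp V (memLp_top_potential hσ hV)) U)
    {Ω : L2 →L[ℂ] L2} (hΩ : ∀ t x, Ω (freeGroup t x) = U t (Ω x))
    {f : L2} (hf : f ∈ weightedL2 σ) (T : ℝ) :
    IsDistributionIntegral (integrand V (ContinuousLinearMap.adjoint Ω) f) T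
      ((-Complex.I • ContinuousLinearMap.adjoint Ω
        (U (-T) (potentialMul V (freePropagatorDivH₀ T f)) + U (-T) (freeGroup T f) -
          onePlusVH₀Inv V f) : L2) : 𝓢'(R3, ℂ)) := by
  intro φ
  have hG := hU.isUnitaryGroup
  set w : ℝ → L2 := fun t => potentialMul V (freePropagatorDivH₀ t f) with hw
  set B := potentialOp V (memLp_top_potential hσ hV)
  set Φ : L2 := (conjSchwartz φ).toLp 2
  set Z : L2 := (-Δ (conjSchwartz φ)).toLp 2
  have hw' : ∀ t, HasDerivAt w (-Complex.I • B (freeGroup t f)) t :=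
    hasDerivAt_potentialMul_freePropagatorDivH₀ hσ hV hf
  have hχ : ∀ t, HasDerivAt (fun t => U t (Ω Φ)) (-Complex.I • U t (Ω Z)) t := by
    intro t
    have h1 := isUnitaryGroup_freeGroup.hasDerivAt_of_zero
      (hasDerivAt_freeGroup_schwartz (conjSchwartz φ)) t
    have h2 := (Ω.restrictScalars ℝ).hasFDerivAt.comp_hasDerivAt t h1
    refine (h2.congr_deriv ?_).congr_of_eventuallyEq
      (Eventually.of_forall fun s => (hΩ s Φ).symm)
    simp only [ContinuousLinearMap.coe_restrictScalars', map_smul]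
    rw [hΩ]
  have hint : ∀ t, integrand V (ContinuousLinearMap.adjoint Ω) f t φ =
      inner ℂ (U t (Ω Z)) (w t) := by
    intro t
    rw [integrand, neg_laplacian_apply_eq_inner, freePropagator_eq,
      ← isUnitaryGroup_freeGroup.inner_apply_left, ContinuousLinearMap.adjoint_inner_right, hΩ]
  have hcont : Continuous fun t => integrand V (ContinuousLinearMap.adjoint Ω) f t φ := by
    simp only [hint]
    exact (hG.continuous _).inner (continuous_iff_continuousAt.2 fun t => (hw' t).continuousAt)
  refine ⟨hcont.intervalIntegrable _ _, ?_⟩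
  have hprim : ∀ t, HasDerivAt (fun t => -Complex.I * (inner ℂ (U t (Ω Φ)) (w t) +
      inner ℂ (Ω Φ) (U (-t) (freeGroup t f))))
      (integrand V (ContinuousLinearMap.adjoint Ω) f t φ) t := by
    intro t
    have h1 := (hχ t).inner ℂ (hw' t)
    have h2 := (hasDerivAt_const t (Ω Φ)).inner ℂ
      (hU.hasDerivAt_wave isUnitaryGroup_freeGroup f t)
    refine ((h1.add h2).const_mul (-Complex.I)).congr_deriv ?_
    rw [hint, inner_smul_left, inner_smul_right, inner_smul_right, inner_zero_left,
      ← hG.inner_apply_left, map_neg, Complex.conj_I]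
    ring_nf
    simp
  rw [intervalIntegral.integral_eq_sub_of_hasDerivAt (fun t _ => hprim t)
    (hcont.intervalIntegrable _ _), toTemperedDistribution_eq_inner, inner_smul_right,
    ContinuousLinearMap.adjoint_inner_right, inner_sub_right, inner_add_right]
  have h0 : onePlusVH₀Inv V f = f + w 0 := by
    rw [onePlusVH₀Inv, hw]
    simp [freePropagatorDivH₀, freeInverse]
  rw [h0, inner_add_right, ← hG.inner_apply_left, ← hG.inner_apply_left, ← hG.inner_apply_left,
    hG.map_zero, isUnitaryGroup_freeGroup.map_zero]
  simp only [Φ, w]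
  ring

end TimeIntegral

end ScatteringR3

open ScatteringR3 in
theorem mainTheorem4 (V : R3 → ℝ) (σ : ℝ) (hσ : 1 < σ)
    (hV : MemLp (fun x => japanese x ^ (2 * σ) * V x) ∞ (volume : Measure R3))
    (heig : ¬ ZeroIsEigenvalue V) (hres : ¬ ZeroIsResonance V) :
    Set.BijOn (onePlusVH₀Inv V) (weightedL2 σ) (weightedL2 σ) ∧
    (∃ C : ℝ≥0, ∀ g ∈ weightedL2 σ,
      weightedNorm σ (onePlusVH₀InvInverse V σ g) ≤ C * weightedNorm σ g) ∧
    ∃ U : ℝ → L2 →L[ℂ] L2, IsUnitaryGroupOf V U ∧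
      ∀ l ∈ ({atTop, atBot} : Set (Filter ℝ)),
        ∃ Ω : L2 →L[ℂ] L2, IsWaveOperator U l Ω ∧
          (∀ φ ψ : L2, Tendsto
            (fun t : ℝ => inner ℂ φ (freePropagator (-t) (U t (continuousProjection V ψ)))) l
            (𝓝 (inner ℂ φ (ContinuousLinearMap.adjoint Ω ψ)))) ∧
          ∀ g ∈ weightedL2 σ, ∃ J : L2,
            HasImproperIntegral
              (integrand V (ContinuousLinearMap.adjoint Ω) (onePlusVH₀InvInverse V σ g)) l J ∧
            ContinuousLinearMap.adjoint Ω g =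
              onePlusVH₀InvInverse V σ g - Complex.I • J := by
  have hVtop := memLp_top_potential hσ hV
  obtain ⟨hbij, hinv⟩ := bijOn_of_injective hσ hV fun f hf h =>
    eq_zero_of_onePlusVH₀Inv_eq_zero hσ hV heig hres hf h
  obtain ⟨U, hU⟩ := IsUnitaryGroup.exists_isPerturbation isUnitaryGroup_freeGroup
    (inner_potentialOp hVtop)
  have hUH := isUnitaryGroupOf_of_isPerturbation hVtop hU
  refine ⟨hbij, hinv, U, hUH, fun l hl => ?_⟩
  have hl : l = atTop ∨ l = atBot := hl
  have hl_ne : l.NeBot := by rcases hl with rfl | rfl <;> infer_instance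
  have hl_cg : l.IsCountablyGenerated := by rcases hl with rfl | rfl <;> infer_instance
  have hl_le : l ≤ cocompact ℝ := by
    rcases hl with rfl | rfl
    exacts [atTop_le_cocompact, atBot_le_cocompact]
  have hl_shift : ∀ t : ℝ, Tendsto (fun s => s + t) l l := by
    rcases hl with rfl | rfl
    exacts [fun t => tendsto_atTop_add_const_right _ t tendsto_id,
      fun t => tendsto_atBot_add_const_right _ t tendsto_id]
  obtain ⟨Ω, hΩ⟩ := hU.exists_waveOperator isUnitaryGroup_freeGroup dense_span_gaussianState
    (by
      rintro _ ⟨y, rfl⟩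
      exact integrable_potentialOp_gaussianState hVtop (memLp_two_potential hσ hV) y) hl
  have hG := hU.isUnitaryGroup
  refine ⟨Ω, hΩ, tendsto_inner_continuousProjection hUH hl_le hΩ, fun g hg => ?_⟩
  have hf : onePlusVH₀InvInverse V σ g ∈ weightedL2 σ := hbij.surjOn.mapsTo_invFunOn hg
  have hfg : onePlusVH₀Inv V (onePlusVH₀InvInverse V σ g) = g :=
    hbij.surjOn.rightInvOn_invFunOn hg
  set f := onePlusVH₀InvInverse V σ g
  refine ⟨-Complex.I • (f - ContinuousLinearMap.adjoint Ω g), ⟨_, fun T =>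
    isDistributionIntegral_integrand hσ hV hU
      (IsUnitaryGroup.wave_apply isUnitaryGroup_freeGroup hG hΩ hl_shift) hf T, ?_⟩, ?_⟩
  · rw [hfg]
    have h1 : Tendsto (fun T => U (-T) (potentialMul V (freePropagatorDivH₀ T f))) l (𝓝 0) := by
      rw [tendsto_zero_iff_norm_tendsto_zero]
      simp only [hG.norm_map]
      exact tendsto_zero_iff_norm_tendsto_zero.1
        (tendsto_potentialMul_freePropagatorDivH₀ hσ hV hf hl_le)
    have h2 := ((ContinuousLinearMap.adjoint Ω).continuous.tendsto _).comp
      ((h1.add (hΩ f)).sub_const g)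
    rw [zero_add, map_sub, IsUnitaryGroup.adjoint_wave_wave isUnitaryGroup_freeGroup hG hΩ] at h2
    exact h2.const_smul _
  · rw [smul_smul, mul_neg, Complex.I_mul_I, neg_neg, one_smul, sub_sub_cancel]
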